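/- Let $H$ be a subgroup of a (discrete) group $G$. Let $BG=\bigl(\bigsqcup_{n\ge 0}\Delta^n\times G^n\bigr)/\!\sim$, where $\sim$ is generated by $(\partial_i t,x)\sim(t,d_ix)$; here $\partial_i$ inserts a zero as $i$-th coordinate, and $d_0(g_1,\dots,g_n)=(g_2,\dots,g_n)$, $d_n(g_1,\dots,g_n)=(g_1,\dots,g_{n-1})$ and $d_i(g_1,\dots,g_n)=(g_1,\dots,g_ig_{i+1},\dots,g_n)$ for $0<i<n$. Let $H_*(G,H)$ be the reduced singular homology, with integer coefficients, of the mapping cone of the map $BH\to BG$ induced by the inclusion. Let $C_0(G/H)$ be the free abelian group on the set of left cosets $G/H$, with $G$ acting by left multiplication, and let $K$ be the kernel of the augmentation $C_0(G/H)\to\mathbb Z$ sending every coset to $1$. Then $H_0(G,H)=0$. Moreover, let $\cdots\to F_2\to F_1\to K\to 0$ be a resolution of $K$ by free $\mathbb Z[G]$-modules, indexed so that $F_1$ is the module mapping onto $K$, with $F_0=0$. Then for all $n\ge 1$ there is a canonical isomorphism $$H_n\bigl(F_*\otimes_{\mathbb Z[G]}\mathbb Z\bigr)\cong H_n(G,H).$$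 In particular the isomorphisms induce isomorphisms $\operatorname{Tor}^{\mathbb Z[G]}_{n-1}(K,\mathbb Z)\cong H_n(G,H)$ for $n\ge 1$ which do not depend on the choice of the resolution. Here canonical means that the isomorphisms can be chosen simultaneously for all $G$, $H$ and $F_*$ so as to be natural: for every homomorphism $\varphi\colon G\to G'$ with $\varphi(H)\subseteq H'$ and every $\varphi$-equivariant chain map $F_*\to F'_*$ of free resolutions lying over the map $K\to K'$ induced by $G/H\to G'/H'$, they commute with the induced maps $H_n(F_*\otimes_{\mathbb Z[G]}\mathbb Z)\to H_n(F'_*\otimes_{\mathbb Z[G']}\mathbb Z)$ and $H_n(G,H)\to H_n(G',H')$. (In particular, taking $\varphi=\mathrm{id}$, they are compatible with comparison maps of resolutions.) -/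

import Mathlib

open CategoryTheory
open scoped TensorProduct

universe u

noncomputable section

namespace RelHom

/-! ### Classifying spaces of discrete groups -/

/-- The face maps `d_i : G^(n+1) → G^n` of the bar construction:
`d_0 (g_1, …, g_(n+1)) = (g_2, …, g_(n+1))`, `d_(n+1) (g_1, …, g_(n+1)) = (g_1, …, g_n)` and
`d_i (g_1, …, g_(n+1)) = (g_1, …, g_i * g_(i+1), …, g_(n+1))` for `0 < i < n + 1`. -/
def barFace {G : Type u} [Mul G] {n : ℕ} (i : Fin (n + 2)) (g : Fin (n + 1) → G) : Fin n → G :=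
  fun k =>
    if (k : ℕ) + 1 < i then g k.castSucc
    else if (k : ℕ) + 1 = i then g k.castSucc * g k.succ
    else g k.succ

/-- The disjoint union of the spaces `Δ^n × G^n`, `n ≥ 0`, for a discrete group `G`. -/
abbrev PreBG (G : Type u) : Type u :=
  Σ x : (Σ n : ℕ, (Fin n → G)), stdSimplex ℝ (Fin (x.1 + 1))

/-- The relation `(∂_i t, x) ∼ (t, d_i x)`, where `∂_i : Δ^n → Δ^(n+1)` inserts a zero as the
`i`-th coordinate. -/
inductive BGRel (G : Type u) [Mul G] : PreBG G → PreBG G → Prop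
  | face (n : ℕ) (i : Fin (n + 2)) (x : Fin (n + 1) → G) (t : stdSimplex ℝ (Fin (n + 1))) :
      BGRel G ⟨⟨n + 1, x⟩, stdSimplex.map i.succAbove t⟩ ⟨⟨n, barFace i x⟩, t⟩

/-- The classifying space `BG = (⨆ₙ Δ^n × G^n) / ∼` of a discrete group, with the quotient
topology (`Quot` is the quotient by the equivalence relation generated by `BGRel`). -/
def BG (G : Type u) [Mul G] : Type u := Quot (BGRel G)

instance (G : Type u) [Mul G] : TopologicalSpace (BG G) :=
  inferInstanceAs (TopologicalSpace (Quot (BGRel G)))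

section

variable {G G' : Type u} [Group G] [Group G']

lemma barFace_comp (φ : G →* G') {n : ℕ} (i : Fin (n + 2)) (g : Fin (n + 1) → G) :
    barFace i (φ ∘ g) = φ ∘ barFace i g := by
  funext k
  simp only [barFace, Function.comp_apply]
  split_ifs <;> simp

/-- The map `BG → BG'` induced by a homomorphism `φ : G → G'`, `[t, x] ↦ [t, φ x]`. -/
def BG.map (φ : G →* G') : C(BG G, BG G') where
  toFun := Quot.map (fun p => ⟨⟨p.1.1, φ ∘ p.1.2⟩, p.2⟩) (by
    rintro _ _ ⟨n, i, x, t⟩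
    have h := BGRel.face n i (φ ∘ x) t
    rwa [barFace_comp] at h)
  continuous_toFun := by
    refine continuous_quot_lift _ (continuous_quot_mk.comp ?_)
    refine continuous_sigma fun x => ?_
    exact continuous_sigmaMk (σ := fun x : (Σ n : ℕ, (Fin n → G')) =>
      stdSimplex ℝ (Fin (x.1 + 1))) (i := ⟨x.1, φ ∘ x.2⟩)

lemma BG.map_comp {G'' : Type u} [Group G''] (ψ : G' →* G'') (φ : G →* G') :
    (BG.map ψ).comp (BG.map φ) = BG.map (ψ.comp φ) := by
  ext p
  induction p using Quot.ind
  rfl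

end

/-! ### Mapping cones -/

section Cone

variable {X Y X' Y' : Type u} [TopologicalSpace X] [TopologicalSpace Y] [TopologicalSpace X']
  [TopologicalSpace Y']

/-- The identifications in `Y ⊔ (X × [0,1]) ⊔ {*}` defining the mapping cone of `f : X → Y`:
`(x, 0) ∼ *` and `(x, 1) ∼ f x`. -/
inductive ConeRel (f : C(X, Y)) :
    Y ⊕ ((X × unitInterval) ⊕ PUnit.{u + 1}) → Y ⊕ ((X × unitInterval) ⊕ PUnit.{u + 1}) → Prop
  | apex (x : X) : ConeRel f (Sum.inr (Sum.inl (x, 0))) (Sum.inr (Sum.inr PUnit.unit))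
  | base (x : X) : ConeRel f (Sum.inr (Sum.inl (x, 1))) (Sum.inl (f x))

/-- The mapping cone (cofiber) of a continuous map. -/
def Cof (f : C(X, Y)) : Type u := Quot (ConeRel f)

instance (f : C(X, Y)) : TopologicalSpace (Cof f) :=
  inferInstanceAs (TopologicalSpace (Quot (ConeRel f)))

/-- The map of mapping cones induced by a commutative square. -/
def Cof.map {f : C(X, Y)} {f' : C(X', Y')} (a : C(X, X')) (b : C(Y, Y'))
    (h : b.comp f = f'.comp a) : C(Cof f, Cof f') where
  toFun := Quot.map (Sum.map b (Sum.map (Prod.map a id) id)) (by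
    rintro _ _ (x | x)
    · exact ConeRel.apex (f := f') (a x)
    · have e : b (f x) = f' (a x) := DFunLike.congr_fun h x
      simp only [Sum.map_inl, Sum.map_inr, Prod.map, id, e]
      exact ConeRel.base (f := f') (a x))
  continuous_toFun := by
    refine continuous_quot_lift _ (continuous_quot_mk.comp ?_)
    exact b.continuous.sumMap ((a.continuous.prodMap continuous_id).sumMap continuous_id)

end Cone

/-! ### Reduced singular homology and the relative homology of groups -/

/-- Singular homology `H_n(X; ℤ)`. -/
abbrev singularH (n : ℕ) : TopCat.{u} ⥤ ModuleCat.{u} ℤ :=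
  (AlgebraicTopology.singularHomologyFunctor (ModuleCat.{u} ℤ) n).obj
    (ModuleCat.of ℤ (ULift.{u} ℤ))

/-- The map from a space to the one-point space. -/
def toPoint (X : TopCat.{u}) : X ⟶ TopCat.of PUnit.{u + 1} :=
  TopCat.ofHom (ContinuousMap.const X PUnit.unit)

/-- Reduced singular homology with integer coefficients: the kernel of `H_n(X) → H_n(point)`. -/
def reducedH (n : ℕ) (X : TopCat.{u}) : ModuleCat.{u} ℤ :=
  Limits.kernel ((singularH n).map (toPoint X))

/-- The map on reduced singular homology induced by a continuous map. -/
def reducedHMap (n : ℕ) {X Y : TopCat.{u}} (f : X ⟶ Y) : reducedH n X ⟶ reducedH n Y :=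
  Limits.kernel.map _ _ ((singularH n).map f) (𝟙 _) (by
    rw [Category.comp_id, ← Functor.map_comp]; rfl)

/-- The relative homology `H_n(G, H)`: the reduced singular homology of the mapping cone of the
map `BH → BG` induced by the inclusion. -/
def relH (G : Type u) [Group G] (H : Subgroup G) (n : ℕ) : ModuleCat.{u} ℤ :=
  reducedH n (TopCat.of (Cof (BG.map H.subtype)))

section

variable {G G' : Type u} [Group G] [Group G']

/-- The restriction `H → H'` of a homomorphism `φ : G → G'` with `φ(H) ⊆ H'`. -/
def restrictHom (φ : G →* G') {H : Subgroup G} {H' : Subgroup G'} (h : ∀ x ∈ H, φ x ∈ H') :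
    H →* H' :=
  (φ.comp H.subtype).codRestrict H' fun x => h x x.2

/-- The map `H_n(G, H) → H_n(G', H')` induced by a homomorphism `φ : G → G'` with
`φ(H) ⊆ H'`. -/
def relHMap (φ : G →* G') {H : Subgroup G} {H' : Subgroup G'} (h : ∀ x ∈ H, φ x ∈ H') (n : ℕ) :
    relH G H n ⟶ relH G' H' n :=
  reducedHMap n (TopCat.ofHom (Cof.map (BG.map (restrictHom φ h)) (BG.map φ) (by
    rw [BG.map_comp, BG.map_comp]; rfl)))

end

/-! ### The module `K` -/

/-- The integral group ring `ℤ[G]`. -/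
abbrev GroupRing (G : Type u) [Group G] : Type u := MonoidAlgebra ℤ G

section

variable (G : Type u) [Group G] (H : Subgroup G)

/-- `C_0(G/H)`, the free abelian group on the set `G/H` of left cosets, with the `ℤ[G]`-module
structure given by left multiplication. -/
abbrev C0 : Type u := (Representation.ofMulAction ℤ G (G ⧸ H)).asModule

/-- The `ℤ`-linear map `C_0(X) → ℤ`, `∑ n_x x ↦ ∑ n_x`. -/
def sumCoeff (X : Type u) : MonoidAlgebra ℤ X →ₗ[ℤ] ℤ :=
  (Finsupp.lsum ℤ fun _ : X => (LinearMap.id : ℤ →ₗ[ℤ] ℤ)) ∘ₗ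
    (MonoidAlgebra.coeffLinearEquiv ℤ).toLinearMap

@[simp]
lemma sumCoeff_single (X : Type u) (x : X) (n : ℤ) :
    sumCoeff X (MonoidAlgebra.single x n) = n := by
  simp [sumCoeff]

lemma sumCoeff_smul (g : G) (v : MonoidAlgebra ℤ (G ⧸ H)) :
    sumCoeff (G ⧸ H) (Representation.ofMulAction ℤ G (G ⧸ H) g v) = sumCoeff (G ⧸ H) v := by
  have : sumCoeff (G ⧸ H) ∘ₗ Representation.ofMulAction ℤ G (G ⧸ H) g = sumCoeff (G ⧸ H) := by
    ext; simp
  exact DFunLike.congr_fun this v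

/-- The augmentation `C_0(G/H) → ℤ`, sending every coset to `1`, as a homomorphism of
`ℤ[G]`-modules to the trivial module `ℤ`. -/
def augmentation : C0 G H →ₗ[GroupRing G] (Representation.trivial ℤ G ℤ).asModule :=
  MonoidAlgebra.equivariantOfLinearOfComm
    ((Representation.trivial ℤ G ℤ).asModuleEquiv.symm.toLinearMap ∘ₗ
      sumCoeff (G ⧸ H) ∘ₗ (Representation.ofMulAction ℤ G (G ⧸ H)).asModuleEquiv.toLinearMap) (by
    intro g v
    simp only [Representation.single_smul, one_smul]
    exact sumCoeff_smul G H g v)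

/-- The kernel `K` of the augmentation, as a `ℤ[G]`-module. -/
def augKer : ModuleCat.{u} (GroupRing G) := ModuleCat.of _ (LinearMap.ker (augmentation G H))

/-- The underlying element of `C_0(G/H)` (a finite formal sum of cosets) of an element of `K`. -/
def augKer.val {G : Type u} [Group G] {H : Subgroup G} (x : augKer G H) :
    MonoidAlgebra ℤ (G ⧸ H) :=
  (Representation.ofMulAction ℤ G (G ⧸ H)).asModuleEquiv
    (Subtype.val (p := fun y => y ∈ LinearMap.ker (augmentation G H)) x)

end

section

variable {G G' : Type u} [Group G] [Group G']

/-- The map `G/H → G'/H'`, `g H ↦ φ(g) H'`, induced by `φ : G → G'` with `φ(H) ⊆ H'`. -/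
def cosetMap (φ : G →* G') {H : Subgroup G} {H' : Subgroup G'} (h : ∀ x ∈ H, φ x ∈ H') :
    G ⧸ H → G' ⧸ H' :=
  Quotient.map' φ fun a b hab => by
    rw [QuotientGroup.leftRel_apply] at hab ⊢
    rw [← map_inv, ← map_mul]
    exact h _ hab

end

/-! ### Free resolutions and the tensor product with `ℤ` -/

section

variable {G G' : Type u} [Group G] [Group G']

/-- The subgroup of `M ⊗ ℤ` generated by the elements `g m ⊗ a - m ⊗ a`. -/
def balanceRel (M : Type u) [AddCommGroup M] [Module (GroupRing G) M] :
    Submodule ℤ (M ⊗[ℤ] ℤ) :=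
  Submodule.span ℤ {z | ∃ (g : G) (m : M) (a : ℤ),
    z = ((MonoidAlgebra.single g (1 : ℤ) : GroupRing G) • m) ⊗ₜ[ℤ] a - m ⊗ₜ[ℤ] a}

/-- The tensor product `M ⊗_{ℤ[G]} ℤ` of a left `ℤ[G]`-module `M`, regarded as a right module by
`m g = g⁻¹ m`, with the trivial module `ℤ`. It is the quotient of `M ⊗ ℤ` by the relations
`m g ⊗ a = m ⊗ g a = m ⊗ a`. -/
def TensorZ (M : ModuleCat.{u} (GroupRing G)) : ModuleCat.{u} ℤ :=
  ModuleCat.of ℤ ((M ⊗[ℤ] ℤ) ⧸ balanceRel (G := G) M)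

/-- The map `M ⊗_{ℤ[G]} ℤ → M' ⊗_{ℤ[G']} ℤ` induced by an additive map `f : M → M'` that is
equivariant along `φ : G → G'`. -/
def TensorZ.map (φ : G →* G') {M : ModuleCat.{u} (GroupRing G)}
    {M' : ModuleCat.{u} (GroupRing G')} (f : M →+ M')
    (hf : ∀ (g : G) (m : M), f ((MonoidAlgebra.single g (1 : ℤ) : GroupRing G) • m) =
      (MonoidAlgebra.single (φ g) (1 : ℤ) : GroupRing G') • f m) :
    TensorZ M ⟶ TensorZ M' :=
  ModuleCat.ofHom (Submodule.mapQ (balanceRel (G := G) M) (balanceRel (G := G') M')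
    (TensorProduct.map f.toIntLinearMap LinearMap.id) (by
      refine Submodule.span_le.2 ?_
      rintro _ ⟨g, m, a, rfl⟩
      refine Submodule.subset_span ⟨φ g, f m, a, ?_⟩
      refine (map_sub (TensorProduct.map f.toIntLinearMap LinearMap.id) _ _).trans ?_
      exact congrArg (fun y => y ⊗ₜ[ℤ] a - f m ⊗ₜ[ℤ] a) (hf g m)))

variable (G) in
/-- The functor `- ⊗_{ℤ[G]} ℤ`. -/
def tensorZ : ModuleCat.{u} (GroupRing G) ⥤ ModuleCat.{u} ℤ where
  obj M := TensorZ M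
  map f := TensorZ.map (MonoidHom.id G) f.hom.toAddMonoidHom (fun g m => f.hom.map_smul _ m)
  map_id M := by
    refine ModuleCat.hom_ext (Submodule.linearMap_qext _ (TensorProduct.ext' fun m a => ?_))
    rfl
  map_comp f f' := by
    refine ModuleCat.hom_ext (Submodule.linearMap_qext _ (TensorProduct.ext' fun m a => ?_))
    rfl

instance : (tensorZ G).Additive where
  map_add {M M' f f'} := by
    refine ModuleCat.hom_ext (Submodule.linearMap_qext _ (TensorProduct.ext' fun m a => ?_))
    exact congrArg (Submodule.mkQ (balanceRel (G := G) M'))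
      (TensorProduct.add_tmul (f.hom m) (f'.hom m) a)

variable (G) in
/-- `Tor_n^{ℤ[G]}(-, ℤ)`, the left derived functors of `- ⊗_{ℤ[G]} ℤ`. -/
abbrev TorZ (n : ℕ) : ModuleCat.{u} (GroupRing G) ⥤ ModuleCat.{u} ℤ :=
  (tensorZ G).leftDerived n

/-- A resolution `⋯ → F_1 → F_0 → M → 0` of a `ℤ[G]`-module by free `ℤ[G]`-modules. -/
structure FreeResolution (M : ModuleCat.{u} (GroupRing G)) extends ProjectiveResolution M where
  free : ∀ n, Module.Free (GroupRing G) (complex.X n)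

/-- The complex `F_* ⊗_{ℤ[G]} ℤ`. -/
abbrev FreeResolution.tensorComplex {M : ModuleCat.{u} (GroupRing G)} (F : FreeResolution M) :
    ChainComplex (ModuleCat.{u} ℤ) ℕ :=
  ((tensorZ G).mapHomologicalComplex _).obj F.complex

/-- A chain map `F_* → F'_*` from a free resolution of the `ℤ[G]`-module `K` of `(G, H)` to one of
the `ℤ[G']`-module `K'` of `(G', H')` which is equivariant along `φ : G → G'` and lies over the map
`K → K'` induced by `G/H → G'/H'`. -/
structure ResolutionMap (φ : G →* G') {H : Subgroup G} {H' : Subgroup G'}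
    (h : ∀ x ∈ H, φ x ∈ H') (F : FreeResolution (augKer G H))
    (F' : FreeResolution (augKer G' H')) where
  toFun : ∀ n, F.complex.X n →+ F'.complex.X n
  equivariant : ∀ n (g : G) (m : F.complex.X n),
    toFun n ((MonoidAlgebra.single g (1 : ℤ) : GroupRing G) • m) =
      (MonoidAlgebra.single (φ g) (1 : ℤ) : GroupRing G') • toFun n m
  comm_d : ∀ i j (m : F.complex.X i),
    toFun j (F.complex.d i j m) = F'.complex.d i j (toFun i m)
  comm_aug : ∀ m : F.complex.X 0,
    augKer.val (F'.π.f 0 (toFun 0 m) : augKer G' H') =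
      MonoidAlgebra.mapDomain (cosetMap φ h) (augKer.val (F.π.f 0 m : augKer G H))

/-- The map of complexes `F_* ⊗_{ℤ[G]} ℤ → F'_* ⊗_{ℤ[G']} ℤ` induced by an equivariant chain
map. -/
def ResolutionMap.tensorMap {φ : G →* G'} {H : Subgroup G} {H' : Subgroup G'}
    {h : ∀ x ∈ H, φ x ∈ H'} {F : FreeResolution (augKer G H)}
    {F' : FreeResolution (augKer G' H')} (α : ResolutionMap φ h F F') :
    F.tensorComplex ⟶ F'.tensorComplex where
  f n := TensorZ.map φ (α.toFun n) (α.equivariant n)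
  comm' i j _ := by
    refine ModuleCat.hom_ext (Submodule.linearMap_qext _ (TensorProduct.ext' fun m a => ?_))
    exact congrArg (fun x => Submodule.mkQ (balanceRel (G := G') (F'.complex.X j)) (x ⊗ₜ[ℤ] a))
      (α.comm_d i j m).symm

end

end RelHom

end

-- Let `C` be the complex with `C_n` free on `G^(n+1)`, whose faces omit entries. It is acyclic with
-- a free action of `G`. The tuples whose entries all lie in one coset of `H` span a subcomplex `D`,
-- with homology `C_0(G/H)` concentrated in degree 0. Hence `C/D`, which vanishes in degree 0, has
-- homology only in degree 1, where it is `K`. With its index lowered by one, `C/D` is therefore a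
-- projective resolution of `K`, the relative bar resolution `relResolution`; its exactness is
-- proved directly, from contractions of `C` and `D` (`relPerm_exact`, `bd_prependRep`). Orbits of
-- tuples are the simplices of the bar construction of `G`, and orbits of coset tuples are those of
-- `H`. So the coinvariants of the relative bar resolution are the relative chains of the two bar
-- constructions, shifted by one degree (`relShift`).
--
-- It remains to compare these relative chains with the mapping cone. The tuples and the singular
-- simplices of the contractible covering space `EG` of `BG` both give free acyclic
-- `G`-semisimplicial sets. The chains of their quotients, the bar construction and the singular
-- simplices of `BG`, both compute `Tor` of the trivial module, so the inclusion of one in the other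
-- is a quasi-isomorphism (`quasiIso_nerveToSing`). The five lemma gives the relative statement for
-- `BH → BG`, which is injective. Finally, for an injective map `f : X → Y` the reduced homology of
-- the cone is the homology of the singular chains of `Y` modulo those of `X` (`Cof.relIso`). This
-- follows by covering the cone with a contractible neighbourhood of the apex and a neighbourhood
-- retracting to `Y`, whose intersection retracts to `X`, and by excision (`excisionMap_quasiIso`),
-- which rests on barycentric subdivision.
--
-- An arbitrary free resolution maps to the relative bar resolution. Naturality in all data holds
-- because two `φ`-equivariant chain maps over the same map `K → K'` become homotopic
-- (`homologyMap_eq_of_equivariant`), and because every map of spaces in the chain of comparisons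
-- commutes strictly with the induced ones. Degree 0 only needs the cone to be path connected.

universe v

noncomputable section

namespace RelHom

/-! ### Homology of complexes of modules in terms of elements -/

section Elements

variable {R : Type*} [Ring R] {K L : ChainComplex (ModuleCat.{u} R) ℕ}

lemma exists_homologyπ {n : ℕ} (h : K.homology n) :
    ∃ c : K.cycles n, K.homologyπ n c = h :=
  (ModuleCat.epi_iff_surjective _).1 inferInstance h

lemma iCycles_injective (n : ℕ) : Function.Injective (K.iCycles n) :=
  (ModuleCat.mono_iff_injective _).1 inferInstance

lemma d_iCycles {n : ℕ} (c : K.cycles n) (j : ℕ) : K.d n j (K.iCycles n c) = 0 := by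
  rw [← ConcreteCategory.comp_apply, HomologicalComplex.iCycles_d]
  rfl

lemma exists_cycles {n : ℕ} (x : K.X n) (hx : ∀ j, K.d n j x = 0) :
    ∃ c : K.cycles n, K.iCycles n c = x :=
  ⟨K.cyclesMk x _ rfl (hx _), K.i_cyclesMk x _ rfl (hx _)⟩

lemma homologyπ_eq_zero_iff {n : ℕ} (c : K.cycles n) :
    K.homologyπ n c = 0 ↔ ∃ y : K.X (n + 1), K.d (n + 1) n y = K.iCycles n c := by
  have hex : (ShortComplex.mk (K.toCycles (n + 1) n) (K.homologyπ n) (by simp)).Exact :=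
    ShortComplex.exact_of_g_is_cokernel _ (K.homologyIsCokernel (n + 1) n (by simp))
  rw [ShortComplex.moduleCat_exact_iff] at hex
  constructor
  · intro h
    obtain ⟨y, hy⟩ := hex c h
    refine ⟨y, ?_⟩
    rw [← hy, ← K.toCycles_i (n + 1) n]
    rfl
  · rintro ⟨y, hy⟩
    have : K.toCycles (n + 1) n y = c := iCycles_injective n (by
      rw [← hy, ← K.toCycles_i (n + 1) n]
      rfl)
    rw [← this, ← ConcreteCategory.comp_apply, K.toCycles_comp_homologyπ]
    rfl

lemma homologyMap_homologyπ (f : K ⟶ L) {n : ℕ} (c : K.cycles n) :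
    HomologicalComplex.homologyMap f n (K.homologyπ n c) =
      L.homologyπ n (HomologicalComplex.cyclesMap f n c) := by
  rw [← ConcreteCategory.comp_apply, ← ConcreteCategory.comp_apply,
    HomologicalComplex.homologyπ_naturality]

lemma iCycles_cyclesMap (f : K ⟶ L) {n : ℕ} (c : K.cycles n) :
    L.iCycles n (HomologicalComplex.cyclesMap f n c) = f.f n (K.iCycles n c) := by
  rw [← ConcreteCategory.comp_apply, ← ConcreteCategory.comp_apply,
    HomologicalComplex.cyclesMap_i]

lemma f_d (f : K ⟶ L) {i j : ℕ} (x : K.X i) : f.f j (K.d i j x) = L.d i j (f.f i x) := by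
  rw [← ConcreteCategory.comp_apply, ← ConcreteCategory.comp_apply, f.comm]

lemma d_d_apply (i j k : ℕ) (x : K.X i) : K.d j k (K.d i j x) = 0 := by
  rw [← ConcreteCategory.comp_apply, K.d_comp_d]
  rfl

lemma mono_homologyMap (f : K ⟶ L) (n : ℕ)
    (h : ∀ (x : K.X n), (∀ j, K.d n j x = 0) → ∀ y : L.X (n + 1), L.d (n + 1) n y = f.f n x →
      ∃ z, K.d (n + 1) n z = x) :
    Mono (HomologicalComplex.homologyMap f n) := by
  rw [ModuleCat.mono_iff_injective, injective_iff_map_eq_zero]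
  intro a ha
  obtain ⟨c, rfl⟩ := exists_homologyπ a
  rw [homologyMap_homologyπ, homologyπ_eq_zero_iff] at ha
  obtain ⟨y, hy⟩ := ha
  rw [iCycles_cyclesMap] at hy
  rw [homologyπ_eq_zero_iff]
  exact h _ (d_iCycles c) y hy

lemma epi_homologyMap (f : K ⟶ L) (n : ℕ)
    (h : ∀ (y : L.X n), (∀ j, L.d n j y = 0) →
      ∃ x : K.X n, (∀ j, K.d n j x = 0) ∧ ∃ z, L.d (n + 1) n z = f.f n x - y) :
    Epi (HomologicalComplex.homologyMap f n) := by
  rw [ModuleCat.epi_iff_surjective]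
  intro b
  obtain ⟨c, rfl⟩ := exists_homologyπ b
  obtain ⟨x, hx, z, hz⟩ := h _ (d_iCycles c)
  obtain ⟨e, rfl⟩ := exists_cycles x hx
  refine ⟨K.homologyπ n e, ?_⟩
  rw [homologyMap_homologyπ, ← sub_eq_zero, ← map_sub, homologyπ_eq_zero_iff]
  refine ⟨z, hz.trans ?_⟩
  rw [map_sub, iCycles_cyclesMap]

/-- A chain map is a quasi-isomorphism if its mapping cone is acyclic. -/
lemma quasiIso_of_forall (f : K ⟶ L)
    (h₀ : ∀ b : L.X 0, ∃ (a : K.X 0) (b' : L.X 1), L.d 1 0 b' = f.f 0 a - b)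
    (h : ∀ n (a : K.X n) (b : L.X (n + 1)), (∀ j, K.d n j a = 0) → L.d (n + 1) n b = f.f n a →
      ∃ (a' : K.X (n + 1)) (b' : L.X (n + 2)), K.d (n + 1) n a' = a ∧
        L.d (n + 2) (n + 1) b' = f.f (n + 1) a' - b) :
    QuasiIso f := by
  refine ⟨fun n => ?_⟩
  rw [quasiIsoAt_iff_isIso_homologyMap]
  have : Mono (HomologicalComplex.homologyMap f n) := mono_homologyMap f n fun x hx y hy => by
    obtain ⟨a', _, ha', _⟩ := h n x y hx hy
    exact ⟨a', ha'⟩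
  have : Epi (HomologicalComplex.homologyMap f n) := by
    refine epi_homologyMap f n fun y hy => ?_
    cases n with
    | zero =>
      obtain ⟨a, b', hb'⟩ := h₀ y
      exact ⟨a, fun j => by rw [K.shape _ _ (by simp)]; rfl, b', hb'⟩
    | succ n =>
      -- Since `y` is a cycle, `(0, y)` is a cycle of the cone. A pair `(a', b')` bounding it has
      -- `a'` a cycle whose image is homologous to `y`.
      obtain ⟨a', b', ha', hb'⟩ := h n 0 y (fun j => map_zero _) (by rw [hy, map_zero])
      refine ⟨a', fun j => ?_, b', hb'⟩
      by_cases hj : n = j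
      · rw [← hj, ha']
      · rw [K.shape _ _ (by simpa using fun e => hj e.symm)]
        rfl
  exact isIso_of_mono_of_epi _

/-- A separate bounding chain for each cycle is enough, with no linearity in the cycle, so no chain
homotopy between complexes has to be assembled. -/
lemma homologyMap_eq_of_forall (f g : K ⟶ L) (n : ℕ)
    (h : ∀ x : K.X n, (∀ j, K.d n j x = 0) → ∃ y, L.d (n + 1) n y = f.f n x - g.f n x) :
    HomologicalComplex.homologyMap f n = HomologicalComplex.homologyMap g n := by
  ext a
  obtain ⟨c, rfl⟩ := exists_homologyπ a
  change HomologicalComplex.homologyMap f n _ = HomologicalComplex.homologyMap g n _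
  obtain ⟨y, hy⟩ := h _ (d_iCycles c)
  rw [homologyMap_homologyπ, homologyMap_homologyπ, ← sub_eq_zero, ← map_sub,
    homologyπ_eq_zero_iff]
  refine ⟨y, hy.trans ?_⟩
  rw [map_sub, iCycles_cyclesMap, iCycles_cyclesMap]

lemma exists_d_eq_of_isZero {n : ℕ} (hK : Limits.IsZero (K.homology n)) (x : K.X n)
    (hx : ∀ j, K.d n j x = 0) : ∃ y, K.d (n + 1) n y = x := by
  obtain ⟨c, rfl⟩ := exists_cycles x hx
  rw [← homologyπ_eq_zero_iff]
  have := ModuleCat.subsingleton_of_isZero hK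
  exact Subsingleton.elim _ _

end Elements

/-! ### Semisimplicial sets and their chain complexes -/

/-- A semisimplicial set. -/
structure SemiSimp where
  X : ℕ → Type u
  δ : ∀ {n : ℕ}, Fin (n + 2) → X (n + 1) → X n
  δ_δ : ∀ {n : ℕ} {i j : Fin (n + 2)}, i ≤ j → ∀ x : X (n + 2),
    δ i (δ j.succ x) = δ j (δ i.castSucc x)

namespace SemiSimp

/-- A morphism of semisimplicial sets. -/
@[ext]
structure Hom (A B : SemiSimp.{u}) where
  f : ∀ n, A.X n → B.X n
  comm : ∀ {n : ℕ} (i : Fin (n + 2)) (x : A.X (n + 1)), f n (A.δ i x) = B.δ i (f (n + 1) x)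

instance : Category SemiSimp.{u} where
  Hom := Hom
  id A := ⟨fun _ x => x, fun _ _ => rfl⟩
  comp f g := ⟨fun n x => g.f n (f.f n x), fun i x => by rw [f.comm, g.comm]⟩

variable (A B : SemiSimp.{u})

/-- The boundary operator on chains. -/
def bd (n : ℕ) : (A.X (n + 1) →₀ ℤ) →ₗ[ℤ] (A.X n →₀ ℤ) :=
  ∑ i : Fin (n + 2), (-1 : ℤ) ^ (i : ℕ) • Finsupp.lmapDomain ℤ ℤ (A.δ i)

lemma bd_apply {n : ℕ} (c : A.X (n + 1) →₀ ℤ) :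
    A.bd n c = ∑ i : Fin (n + 2), (-1 : ℤ) ^ (i : ℕ) • Finsupp.mapDomain (A.δ i) c := by
  simp [bd, LinearMap.sum_apply]

lemma bd_single {n : ℕ} (x : A.X (n + 1)) (a : ℤ) :
    A.bd n (Finsupp.single x a) =
      ∑ i : Fin (n + 2), (-1 : ℤ) ^ (i : ℕ) • Finsupp.single (A.δ i x) a := by
  simp [bd_apply]

/-- The terms of the double sum cancel in pairs: the pair `(i, j)` with `i ≤ j` is matched with `(j
+ 1, i)`, which gives the same iterated face with the opposite sign. -/
lemma bd_bd {n : ℕ} (c : A.X (n + 2) →₀ ℤ) : A.bd n (A.bd (n + 1) c) = 0 := by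
  suffices h : A.bd n ∘ₗ A.bd (n + 1) = 0 from LinearMap.congr_fun h c
  refine Finsupp.lhom_ext fun x a => ?_
  simp only [LinearMap.comp_apply, bd_single, map_sum, map_smul, LinearMap.zero_apply,
    Finset.smul_sum, ← Finset.sum_product']
  let P := Fin (n + 3) × Fin (n + 2)
  let S : Finset P := {ij : P | (ij.1 : ℕ) ≤ (ij.2 : ℕ)}
  rw [Finset.univ_product_univ, ← Finset.sum_add_sum_compl S, ← eq_neg_iff_add_eq_zero,
    ← Finset.sum_neg_distrib]
  let φ : ∀ ij : P, ij ∈ S → P := fun ij hij =>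
    (ij.2.succ, Fin.castLT ij.1 (lt_of_le_of_lt (Finset.mem_filter.mp hij).right (Fin.is_lt ij.2)))
  apply Finset.sum_bij φ
  · intro ij hij
    simp_rw [S, φ, Finset.compl_filter, Finset.mem_filter_univ, Fin.val_succ,
      Fin.val_castLT] at hij ⊢
    lia
  · rintro ⟨i, j⟩ hij ⟨i', j'⟩ hij' h
    rw [Prod.mk_inj]
    exact ⟨by simpa [φ, Fin.castSucc_castLT] using! congr_arg Fin.castSucc (congr_arg Prod.snd h),
      by simpa [φ] using! congr_arg Prod.fst h⟩
  · rintro ⟨i', j'⟩ hij'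
    simp_rw [S, Finset.compl_filter, Finset.mem_filter_univ, not_le] at hij'
    refine ⟨(Fin.castSucc j', i'.pred <| ?_), ?_, ?_⟩
    · rintro rfl
      simp only [Fin.val_zero, not_lt_zero] at hij'
    · simpa [S] using! Nat.le_sub_one_of_lt hij'
    · simp only [φ, Fin.castLT_castSucc, Fin.succ_pred]
  · rintro ⟨i, j⟩ hij
    have hij' : (i : ℕ) ≤ j := by simpa [S] using! hij
    dsimp only [φ]
    rw [smul_smul, smul_smul, ← neg_smul]
    congr 1
    · simp only [Fin.val_succ, Fin.val_castLT, pow_add, pow_one, mul_neg, neg_mul, neg_neg, mul_one]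
      ring
    · rw [A.δ_δ (i := i.castLT (lt_of_le_of_lt hij' j.2)) (j := j) (by simpa [Fin.le_def] using hij')]
      simp

/-- The chain complex of a semisimplicial set. -/
abbrev chains : ChainComplex (ModuleCat.{u} ℤ) ℕ where
  X n := ModuleCat.of ℤ (A.X n →₀ ℤ)
  d := ChainComplex.of.d _ fun n => ModuleCat.ofHom (A.bd n)
  shape _ _ h := ChainComplex.of_d_ne _ _ (Ne.symm h)
  d_comp_d' := by
    rintro _ _ n rfl rfl
    rw [ChainComplex.of_d, ChainComplex.of_d]
    exact ModuleCat.hom_ext (LinearMap.ext fun c => A.bd_bd c)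

lemma chains_d_apply (n : ℕ) (c : A.X (n + 1) →₀ ℤ) : (A.chains.d (n + 1) n) c = A.bd n c := by
  exact ConcreteCategory.congr_hom (ChainComplex.of_d (fun n => ModuleCat.of ℤ (A.X n →₀ ℤ))
    (fun n => ModuleCat.ofHom (A.bd n)) n) c

variable {A B}

/-- The sum of the coefficients. -/
def deg (I : Type u) : (I →₀ ℤ) →ₗ[ℤ] ℤ := Finsupp.linearCombination ℤ fun _ => (1 : ℤ)

@[simp]
lemma deg_single {I : Type u} (i : I) (a : ℤ) : deg I (Finsupp.single i a) = a := by
  simp [deg]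

lemma deg_mapDomain {I J : Type u} (f : I → J) (c : I →₀ ℤ) :
    deg J (Finsupp.mapDomain f c) = deg I c := by
  simp only [deg, Finsupp.linearCombination_mapDomain]
  rfl

lemma bd_zero_single (x : A.X 1) (a : ℤ) :
    A.bd 0 (Finsupp.single x a) = Finsupp.single (A.δ 0 x) a - Finsupp.single (A.δ 1 x) a := by
  rw [bd_single, Fin.sum_univ_two, Fin.val_zero, Fin.val_one, pow_zero, pow_one, one_smul,
    neg_smul, one_smul, sub_eq_add_neg]

lemma deg_bd (c : A.X 1 →₀ ℤ) : deg _ (A.bd 0 c) = 0 := by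
  suffices h : deg _ ∘ₗ A.bd 0 = 0 from LinearMap.congr_fun h c
  refine Finsupp.lhom_ext fun x a => ?_
  simp [bd_zero_single]

/-- Zero-chains of degree zero are boundaries if all vertices are joined by edges. -/
lemma exists_bd_eq_of_deg_eq_zero (x₀ : A.X 0)
    (h : ∀ x : A.X 0, ∃ y : A.X 1, A.δ 0 y = x ∧ A.δ 1 y = x₀) (c : A.X 0 →₀ ℤ)
    (hc : deg _ c = 0) : ∃ b, A.bd 0 b = c := by
  choose e he he' using h
  refine ⟨Finsupp.mapDomain e c, ?_⟩
  have h1 : A.bd 0 ∘ₗ Finsupp.lmapDomain ℤ ℤ e =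
      LinearMap.id - Finsupp.lsingle x₀ ∘ₗ deg _ := by
    refine Finsupp.lhom_ext fun x a => ?_
    simp [bd_zero_single, he, he']
  have h2 := LinearMap.congr_fun h1 c
  simpa [hc] using h2

/-- Families of maps are used instead of morphisms so that the two semisimplicial sets may lie in
different universes: affine simplices of a standard simplex live in the lowest one, singular
simplices need not. -/
lemma bd_mapDomain_of_comm {A : SemiSimp.{u}} {B : SemiSimp.{v}} (f : ∀ n, A.X n → B.X n)
    (hf : ∀ {n : ℕ} (i : Fin (n + 2)) (x : A.X (n + 1)), f n (A.δ i x) = B.δ i (f (n + 1) x))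
    {n : ℕ} (c : A.X (n + 1) →₀ ℤ) :
    B.bd n (Finsupp.mapDomain (f (n + 1)) c) = Finsupp.mapDomain (f n) (A.bd n c) := by
  rw [bd_apply, bd_apply, Finsupp.mapDomain_finsetSum]
  refine Finset.sum_congr rfl fun i _ => ?_
  rw [← Finsupp.mapDomain_comp, Finsupp.mapDomain_smul, ← Finsupp.mapDomain_comp]
  congr 2
  funext x
  exact (hf i x).symm

lemma bd_mapDomain (f : A ⟶ B) {n : ℕ} (c : A.X (n + 1) →₀ ℤ) :
    B.bd n (Finsupp.mapDomain (f.f (n + 1)) c) = Finsupp.mapDomain (f.f n) (A.bd n c) :=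
  bd_mapDomain_of_comm f.f f.comm c

/-- The chain complex functor. -/
abbrev chainsFunctor : SemiSimp.{u} ⥤ ChainComplex (ModuleCat.{u} ℤ) ℕ where
  obj A := A.chains
  map {A B} f :=
    { f := fun n => ModuleCat.ofHom (Finsupp.lmapDomain ℤ ℤ (f.f n))
      comm' := by
        rintro _ n rfl
        refine ModuleCat.hom_ext (LinearMap.ext fun c => ?_)
        refine (B.chains_d_apply n _).trans ((bd_mapDomain f c).trans ?_)
        exact congrArg (Finsupp.mapDomain (f.f n)) (A.chains_d_apply n c).symm }
  map_id A := by
    ext n : 2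
    exact LinearMap.ext fun c => Finsupp.mapDomain_id
  map_comp f g := by
    ext n : 2
    exact LinearMap.ext fun c => Finsupp.mapDomain_comp (f := f.f n) (g := g.f n)

lemma chainsFunctor_map_f (f : A ⟶ B) (n : ℕ) (c : A.X n →₀ ℤ) :
    (chainsFunctor.map f).f n c = Finsupp.mapDomain (f.f n) c := rfl

end SemiSimp

/-! ### Singular chains -/

section Singular

open Simplicial

/-- The `i`-th face inclusion of the standard simplex. -/
def faceIncl {n : ℕ} (i : Fin (n + 2)) :
    C(stdSimplex ℝ (Fin (n + 1)), stdSimplex ℝ (Fin (n + 2))) :=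
  ⟨stdSimplex.map i.succAbove, stdSimplex.continuous_map _⟩

@[simp]
lemma faceIncl_succAbove {n : ℕ} (i : Fin (n + 2)) (t : stdSimplex ℝ (Fin (n + 1)))
    (k : Fin (n + 1)) : faceIncl i t (i.succAbove k) = t k := by
  simp only [faceIncl, ContinuousMap.coe_mk, stdSimplex.map_coe,
    FunOnFinite.linearMap_apply_apply, Fin.succAbove_right_inj]
  rw [Finset.sum_filter, Finset.sum_ite_eq' Finset.univ k t, if_pos (Finset.mem_univ k)]

@[simp]
lemma faceIncl_self {n : ℕ} (i : Fin (n + 2)) (t : stdSimplex ℝ (Fin (n + 1))) :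
    faceIncl i t i = 0 := by
  simp [faceIncl, FunOnFinite.linearMap_apply_apply, Fin.succAbove_ne]

lemma faceIncl_faceIncl {n : ℕ} {i j : Fin (n + 2)} (h : i ≤ j) (t : stdSimplex ℝ (Fin (n + 1))) :
    faceIncl j.succ (faceIncl i t) = faceIncl i.castSucc (faceIncl j t) := by
  simp only [faceIncl, ContinuousMap.coe_mk, stdSimplex.map_comp_apply]
  congr 1
  funext k
  simp only [Function.comp_apply, Fin.ext_iff, Fin.succAbove, Fin.lt_def, Fin.le_def] at h ⊢
  split_ifs <;> simp_all <;> lia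

/-- The singular semisimplicial set of a topological space. -/
abbrev sing : TopCat.{u} ⥤ SemiSimp.{u} where
  obj X :=
    { X := fun n => C(stdSimplex ℝ (Fin (n + 1)), X)
      δ := fun i σ => σ.comp (faceIncl i)
      δ_δ := fun h σ => ContinuousMap.ext fun t => congrArg σ (faceIncl_faceIncl h t) }
  map f := ⟨fun _ σ => f.hom.comp σ, fun _ _ => rfl⟩

/-- Singular chains. -/
abbrev singChains : TopCat.{u} ⥤ ChainComplex (ModuleCat.{u} ℤ) ℕ :=
  sing ⋙ SemiSimp.chainsFunctor


/-- The coefficients of singular homology. -/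
abbrev coeffZ : ModuleCat.{u} ℤ := ModuleCat.of ℤ (ULift.{u} ℤ)

/-- The comparison of Mathlib's singular chains with functions of finite support on singular
simplices, in one degree. -/
def singChainsXHom (X : TopCat.{u}) (n : ℕ) :
    ((TopCat.toSSet.obj X).chainComplex coeffZ).X n ⟶ (singChains.obj X).X n :=
  ((TopCat.toSSet.obj X).isColimitChainComplexXCofan _ n).desc
    (Limits.Cofan.mk (ModuleCat.of ℤ (C(stdSimplex ℝ (Fin (n + 1)), X) →₀ ℤ)) fun σ =>
      ModuleCat.ofHom (Finsupp.lsingle (X.toSSetObjEquiv _ σ) ∘ₗ ULift.moduleEquiv.toLinearMap))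

lemma ι_singChainsXHom (X : TopCat.{u}) (n : ℕ) (σ : (TopCat.toSSet.obj X) _⦋n⦌) :
    (TopCat.toSSet.obj X).ιChainComplex σ ≫ singChainsXHom X n =
      ModuleCat.ofHom
        (Finsupp.lsingle (X.toSSetObjEquiv _ σ) ∘ₗ ULift.moduleEquiv.toLinearMap) :=
  ((TopCat.toSSet.obj X).isColimitChainComplexXCofan _ n).fac _ ⟨σ⟩

lemma ι_singChainsXHom_apply (X : TopCat.{u}) (n : ℕ) (σ : (TopCat.toSSet.obj X) _⦋n⦌)
    (a : ULift.{u} ℤ) :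
    singChainsXHom X n ((TopCat.toSSet.obj X).ιChainComplex (R := coeffZ) σ a) =
      Finsupp.single (X.toSSetObjEquiv _ σ) a.down :=
  ConcreteCategory.congr_hom (ι_singChainsXHom X n σ) a

/-- The linear map out of a free module with given restrictions to the summands. -/
def finsuppDesc {I : Type u} {M : ModuleCat.{u} ℤ} (φ : I → (coeffZ ⟶ M)) :
    ModuleCat.of ℤ (I →₀ ℤ) ⟶ M :=
  ModuleCat.ofHom (Finsupp.linearCombination ℤ fun i => φ i ⟨(1 : ℤ)⟩)

lemma finsuppDesc_single {I : Type u} {M : ModuleCat.{u} ℤ} (φ : I → (coeffZ ⟶ M)) (i : I)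
    (a : ℤ) : finsuppDesc φ (Finsupp.single i a) = φ i ⟨a⟩ := by
  refine (Finsupp.linearCombination_single ℤ a i).trans ?_
  refine ((φ i).hom.map_smul a ⟨1⟩).symm.trans (congrArg (φ i) ?_)
  exact ULift.ext _ _ (by simp)

lemma hom_sum_apply {ι : Type*} {M N : ModuleCat.{u} ℤ} (s : Finset ι) (f : ι → (M ⟶ N))
    (x : M) : ConcreteCategory.hom (C := ModuleCat.{u} ℤ) (X := M) (Y := N) (∑ i ∈ s, f i) x =
      ∑ i ∈ s, f i x := by
  refine (LinearMap.congr_fun (ModuleCat.hom_sum f s) x).trans ?_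
  rw [LinearMap.sum_apply]

instance (X : TopCat.{u}) (n : ℕ) : IsIso (singChainsXHom X n) := by
  let inv : (singChains.obj X).X n ⟶ ((TopCat.toSSet.obj X).chainComplex coeffZ).X n :=
    finsuppDesc fun σ =>
      (TopCat.toSSet.obj X).ιChainComplex (R := coeffZ) ((X.toSSetObjEquiv (.op ⦋n⦌)).symm σ)
  have hinv (σ : C(stdSimplex ℝ (Fin (n + 1)), X)) (a : ℤ) : inv (Finsupp.single σ a) =
      (TopCat.toSSet.obj X).ιChainComplex (R := coeffZ) ((X.toSSetObjEquiv (.op ⦋n⦌)).symm σ)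
        ⟨a⟩ := finsuppDesc_single _ _ _
  refine ⟨inv, ?_, ?_⟩
  · refine SSet.chainComplex_hom_ext fun σ => ?_
    ext a
    change inv (singChainsXHom X n ((TopCat.toSSet.obj X).ιChainComplex (R := coeffZ) σ a)) =
      (TopCat.toSSet.obj X).ιChainComplex (R := coeffZ) σ a
    rw [ι_singChainsXHom_apply, hinv, Equiv.symm_apply_apply]
  · refine ModuleCat.hom_ext (Finsupp.lhom_ext fun σ a => ?_)
    change singChainsXHom X n (inv (Finsupp.single σ a)) = Finsupp.single σ a
    rw [hinv, ι_singChainsXHom_apply, Equiv.apply_symm_apply]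

/-- The comparison of Mathlib's singular chains with functions of finite support on singular
simplices. -/
def singChainsHom (X : TopCat.{u}) :
    ((AlgebraicTopology.singularChainComplexFunctor (ModuleCat.{u} ℤ)).obj coeffZ).obj X ⟶
      singChains.obj X where
  f n := singChainsXHom X n
  comm' := by
    rintro _ n rfl
    refine SSet.chainComplex_hom_ext fun σ => ?_
    ext a
    change (singChains.obj X).d (n + 1) n
      (singChainsXHom X (n + 1) ((TopCat.toSSet.obj X).ιChainComplex (R := coeffZ) σ a)) =
      ((TopCat.toSSet.obj X).ιChainComplex σ ≫
        ((TopCat.toSSet.obj X).chainComplex _).d (n + 1) n ≫ singChainsXHom X n) a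
    rw [SSet.ιChainComplex_d_assoc, ι_singChainsXHom_apply]
    refine (SemiSimp.chains_d_apply _ n _).trans ((SemiSimp.bd_single _ _ _).trans ?_)
    simp only [Preadditive.sum_comp, Preadditive.zsmul_comp, ι_singChainsXHom]
    rw [hom_sum_apply]
    rfl

instance (X : TopCat.{u}) : IsIso (singChainsHom X) := by
  have (n : ℕ) : IsIso ((singChainsHom X).f n) := inferInstanceAs (IsIso (singChainsXHom X n))
  exact HomologicalComplex.Hom.isIso_of_components _

lemma singChainsHom_naturality {X Y : TopCat.{u}} (f : X ⟶ Y) :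
    ((AlgebraicTopology.singularChainComplexFunctor (ModuleCat.{u} ℤ)).obj coeffZ).map f ≫
      singChainsHom Y = singChainsHom X ≫ singChains.map f := by
  ext n : 1
  refine SSet.chainComplex_hom_ext fun σ => ?_
  ext a
  change ((TopCat.toSSet.obj X).ιChainComplex σ ≫
    (SSet.chainComplexMap (TopCat.toSSet.map f) _).f n ≫ singChainsXHom Y n) a =
      (singChains.map f).f n
        (singChainsXHom X n ((TopCat.toSSet.obj X).ιChainComplex (R := coeffZ) σ a))
  rw [SSet.ι_chainComplexMap_f_assoc, ι_singChainsXHom_apply]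
  refine (ι_singChainsXHom_apply Y n _ _).trans (Eq.trans ?_
    (SemiSimp.chainsFunctor_map_f _ _ _).symm)
  rw [Finsupp.mapDomain_single]
  rfl

/-- Homotopic maps induce homotopic maps of singular chains. -/
lemma singChains_homotopy {X Y : TopCat.{u}} {f g : X ⟶ Y} (H : TopCat.Homotopy f g) :
    Nonempty (Homotopy (singChains.map f) (singChains.map g)) := by
  have h := ((H.singularChainComplexFunctorObjMap coeffZ).compRight (singChainsHom Y)).compLeft
    (inv (singChainsHom X))
  rw [singChainsHom_naturality, singChainsHom_naturality, IsIso.inv_hom_id_assoc,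
    IsIso.inv_hom_id_assoc] at h
  exact ⟨h⟩

/-- Homotopy equivalences induce quasi-isomorphisms of singular chains. -/
lemma singChains_quasiIso {X Y : TopCat.{u}} {f : X ⟶ Y} {g : Y ⟶ X}
    (h : TopCat.Homotopy (f ≫ g) (𝟙 X)) (h' : TopCat.Homotopy (g ≫ f) (𝟙 Y)) :
    QuasiIso (singChains.map f) := by
  obtain ⟨H⟩ := singChains_homotopy h
  obtain ⟨H'⟩ := singChains_homotopy h'
  rw [CategoryTheory.Functor.map_comp, CategoryTheory.Functor.map_id] at H H'
  exact (HomotopyEquiv.mk (singChains.map f) (singChains.map g) H H').quasiIso_hom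

/-- The comparison of Mathlib's singular homology with the homology of `singChains`. -/
def singularHIso (n : ℕ) (X : TopCat.{u}) :
    (singularH n).obj X ≅ (singChains.obj X).homology n :=
  HomologicalComplex.homologyMapIso (asIso (singChainsHom X)) n

lemma singularHIso_naturality (n : ℕ) {X Y : TopCat.{u}} (f : X ⟶ Y) :
    (singularH n).map f ≫ (singularHIso n Y).hom =
      (singularHIso n X).hom ≫ HomologicalComplex.homologyMap (singChains.map f) n := by
  change HomologicalComplex.homologyMap _ n ≫ HomologicalComplex.homologyMap (singChainsHom Y) n =
    HomologicalComplex.homologyMap (singChainsHom X) n ≫ _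
  rw [← HomologicalComplex.homologyMap_comp, ← HomologicalComplex.homologyMap_comp,
    singChainsHom_naturality]

lemma isZero_homology_singChains_of_totallyDisconnectedSpace (X : TopCat.{u})
    [TotallyDisconnectedSpace X] (n : ℕ) (hn : n ≠ 0) :
    Limits.IsZero ((singChains.obj X).homology n) :=
  (AlgebraicTopology.isZero_singularHomologyFunctor_of_totallyDisconnectedSpace _ n coeffZ X
    hn).of_iso (singularHIso n X).symm

/-- Reduced and unreduced homology agree in positive degrees. -/
lemma isIso_kernel_ι_toPoint (n : ℕ) (X : TopCat.{u}) :
    IsIso (Limits.kernel.ι ((singularH (n + 1)).map (toPoint X))) := by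
  have : TotallyDisconnectedSpace (TopCat.of PUnit.{u + 1}) :=
    inferInstanceAs (TotallyDisconnectedSpace PUnit)
  have h := AlgebraicTopology.isZero_singularHomologyFunctor_of_totallyDisconnectedSpace
    (ModuleCat.{u} ℤ) (n + 1) coeffZ (TopCat.of PUnit.{u + 1}) (by simp)
  have h0 : (singularH (n + 1)).map (toPoint X) = 0 := h.eq_of_tgt _ _
  rw [h0]
  infer_instance

/-- Reduced singular homology in positive degrees. -/
def reducedHIso (n : ℕ) (X : TopCat.{u}) :
    reducedH (n + 1) X ≅ (singChains.obj X).homology (n + 1) :=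
  @asIso _ _ _ _ (Limits.kernel.ι ((singularH (n + 1)).map (toPoint X)))
    (isIso_kernel_ι_toPoint n X) ≪≫ singularHIso (n + 1) X

lemma reducedHIso_naturality (n : ℕ) {X Y : TopCat.{u}} (f : X ⟶ Y) :
    reducedHMap (n + 1) f ≫ (reducedHIso n Y).hom =
      (reducedHIso n X).hom ≫ HomologicalComplex.homologyMap (singChains.map f) (n + 1) := by
  simp only [reducedHIso, Iso.trans_hom, asIso_hom, Category.assoc, reducedHMap, reducedH,
    ← singularHIso_naturality, Limits.kernel.lift_ι_assoc, Limits.kernel.map]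

lemma exists_bd_eq_of_pathConnectedSpace (X : TopCat.{u}) [PathConnectedSpace X]
    (c : (sing.obj X).X 0 →₀ ℤ) (hc : SemiSimp.deg _ c = 0) : ∃ b, (sing.obj X).bd 0 b = c := by
  let x₀ : X := Classical.arbitrary X
  refine SemiSimp.exists_bd_eq_of_deg_eq_zero (ContinuousMap.const _ x₀) (fun σ => ?_) c hc
  -- Face 0 of a singular 1-simplex is the end of the path and face 1 its start, so the path has to
  -- start at the base point.
  let γ := PathConnectedSpace.somePath x₀ (σ default)
  refine ⟨⟨fun t => γ (stdSimplexHomeomorphUnitInterval t), by fun_prop⟩, ?_, ?_⟩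
  · ext t
    obtain rfl : t = default := Subsingleton.elim _ _
    have : stdSimplexHomeomorphUnitInterval (faceIncl (n := 0) 0 default) = 1 :=
      Subtype.ext ((faceIncl_succAbove (n := 0) 0 default 0).trans
        (stdSimplex.eq_one_of_unique (X := Fin 1) _ _))
    change γ _ = _
    rw [this, γ.target]
  · ext t
    obtain rfl : t = default := Subsingleton.elim _ _
    have : stdSimplexHomeomorphUnitInterval (faceIncl (n := 0) 1 default) = 0 :=
      Subtype.ext (faceIncl_self (n := 0) 1 default)
    change γ _ = _
    rw [this, γ.source]
    rfl

/-- The map to the point preserves the degree of a 0-chain and boundaries have degree zero; 0-chains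
of degree zero bound in a path connected space. So `H_0` injects into that of the point. -/
lemma isZero_reducedH_zero (X : TopCat.{u}) [PathConnectedSpace X] :
    Limits.IsZero (reducedH 0 X) := by
  have h1 : Mono (HomologicalComplex.homologyMap (singChains.map (toPoint X)) 0) := by
    refine mono_homologyMap _ _ fun x _ y hy => ?_
    obtain ⟨b, hb⟩ := exists_bd_eq_of_pathConnectedSpace X x (by
      refine (SemiSimp.deg_mapDomain ((sing.map (toPoint X)).f 0) x).symm.trans ?_
      refine (congrArg (SemiSimp.deg _) (hy.symm.trans (SemiSimp.chains_d_apply _ 0 y))).trans ?_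
      exact SemiSimp.deg_bd y)
    exact ⟨b, (SemiSimp.chains_d_apply _ 0 b).trans hb⟩
  have h2 : Mono ((singularH 0).map (toPoint X)) := by
    have h := singularHIso_naturality 0 (toPoint X)
    have h3 : Mono ((singularH 0).map (toPoint X) ≫ (singularHIso 0 _).hom) := by
      rw [h]
      exact mono_comp _ _
    exact mono_of_mono _ (singularHIso 0 _).hom
  exact (Limits.isZero_zero _).of_iso (Limits.kernel.ofMono ((singularH 0).map (toPoint X)))

end Singular

/-! ### Tuples and cones -/

/-- The semisimplicial set of tuples of elements of a set. -/
abbrev Tup (S : Type u) : SemiSimp.{u} where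
  X n := Fin (n + 1) → S
  δ i v := v ∘ i.succAbove
  δ_δ {n i j} h v := by
    funext k
    simp only [Function.comp_apply]
    congr 1
    simp only [Fin.ext_iff, Fin.succAbove, Fin.lt_def, Fin.le_def] at h ⊢
    split_ifs <;> simp_all <;> lia

section Tup

variable {S : Type u}

lemma cons_comp_succ_succAbove {n : ℕ} (b : S) (v : Fin (n + 2) → S) (i : Fin (n + 2)) :
    (Fin.cons b v : Fin (n + 3) → S) ∘ i.succ.succAbove =
      (Fin.cons b (v ∘ i.succAbove) : Fin (n + 2) → S) := by
  funext k
  refine Fin.cases ?_ (fun k => ?_) k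
  · simp
  · simp [Fin.succ_succAbove_succ]

lemma bd_single_cons {n : ℕ} (b : S) (v : Fin (n + 2) → S) (a : ℤ) :
    (Tup S).bd (n + 1) (Finsupp.single (Fin.cons b v) a) =
      Finsupp.single v a - ∑ i : Fin (n + 2), (-1 : ℤ) ^ (i : ℕ) •
        Finsupp.single (Fin.cons b (v ∘ i.succAbove) : Fin (n + 2) → S) a := by
  rw [SemiSimp.bd_single, Fin.sum_univ_succ, Fin.val_zero, pow_zero, one_smul, sub_eq_add_neg,
    ← Finset.sum_neg_distrib]
  congr 1
  refine Finset.sum_congr rfl fun i _ => ?_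
  change (-1 : ℤ) ^ (i.succ : ℕ) •
    Finsupp.single ((Fin.cons b v : Fin (n + 3) → S) ∘ i.succ.succAbove) a = _
  rw [cons_comp_succ_succAbove, Fin.val_succ, pow_succ, mul_neg_one, neg_smul]

/-- The cone with a given vertex. -/
def coneOp (b : S) (n : ℕ) : ((Fin (n + 1) → S) →₀ ℤ) →ₗ[ℤ] ((Fin (n + 2) → S) →₀ ℤ) :=
  Finsupp.lmapDomain ℤ ℤ fun v : Fin (n + 1) → S => (Fin.cons b v : Fin (n + 2) → S)

@[simp]
lemma coneOp_single (b : S) {n : ℕ} (v : Fin (n + 1) → S) (a : ℤ) :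
    coneOp b n (Finsupp.single v a) = Finsupp.single (Fin.cons b v : Fin (n + 2) → S) a := by
  simp [coneOp]

/-- Omitting the new first vertex returns the chain, and every other face is a cone on a face with
its index raised by one, hence with the opposite sign. -/
lemma bd_coneOp (b : S) {n : ℕ} (c : (Fin (n + 2) → S) →₀ ℤ) :
    (Tup S).bd (n + 1) (coneOp b (n + 1) c) = c - coneOp b n ((Tup S).bd n c) := by
  suffices h : (Tup S).bd (n + 1) ∘ₗ coneOp b (n + 1) =
      LinearMap.id - coneOp b n ∘ₗ (Tup S).bd n from LinearMap.congr_fun h c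
  refine Finsupp.lhom_ext fun v a => ?_
  change (Tup S).bd (n + 1) (coneOp b (n + 1) (Finsupp.single v a)) =
    Finsupp.single v a - coneOp b n ((Tup S).bd n (Finsupp.single v a))
  rw [coneOp_single, bd_single_cons, SemiSimp.bd_single (A := Tup S), map_sum]
  simp only [map_smul]
  simp only [coneOp_single]

lemma bd_coneOp_zero (b : S) (c : (Fin 1 → S) →₀ ℤ) :
    (Tup S).bd 0 (coneOp b 0 c) = c - Finsupp.single (fun _ => b) (SemiSimp.deg _ c) := by
  suffices h : (Tup S).bd 0 ∘ₗ coneOp b 0 =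
      LinearMap.id - Finsupp.lsingle (fun _ => b) ∘ₗ SemiSimp.deg _ from LinearMap.congr_fun h c
  refine Finsupp.lhom_ext fun v a => ?_
  change (Tup S).bd 0 (coneOp b 0 (Finsupp.single v a)) =
    Finsupp.single v a - Finsupp.single (fun _ => b) (SemiSimp.deg _ (Finsupp.single v a))
  rw [coneOp_single, SemiSimp.bd_zero_single (A := Tup S), SemiSimp.deg_single]
  congr 2
  funext k
  obtain rfl : k = 0 := Subsingleton.elim (α := Fin 1) _ _
  simp

lemma coneOp_mapDomain {S' : Type v} (g : S → S') (b : S) {n : ℕ} (c : (Fin (n + 1) → S) →₀ ℤ) :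
    coneOp (g b) n (Finsupp.mapDomain (g ∘ ·) c) = Finsupp.mapDomain (g ∘ ·) (coneOp b n c) := by
  simp only [coneOp, Finsupp.lmapDomain_apply, ← Finsupp.mapDomain_comp]
  congr 1
  funext v k
  refine Fin.cases ?_ (fun k => ?_) k <;> simp

lemma bd_tup_mapDomain {S' : Type v} (g : S → S') {n : ℕ} (c : (Fin (n + 2) → S) →₀ ℤ) :
    (Tup S').bd n (Finsupp.mapDomain (g ∘ ·) c) = Finsupp.mapDomain (g ∘ ·) ((Tup S).bd n c) :=
  SemiSimp.bd_mapDomain_of_comm (A := Tup S) (B := Tup S') (fun _ v => g ∘ v)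
    (fun _ _ => rfl) c

end Tup

/-! ### Barycentric subdivision of affine chains -/

/-- The topological standard simplex. -/
abbrev Simp (n : ℕ) : Type := stdSimplex ℝ (Fin (n + 1))

section Affine

variable {m n k : ℕ}

/-- The affine map of standard simplices with given values at the vertices. -/
def aff (v : Fin (m + 1) → Simp n) : C(Simp m, Simp n) where
  toFun t := ⟨∑ i, t i • (v i : Fin (n + 1) → ℝ),
    (convex_stdSimplex ℝ _).sum_mem (fun i _ => t.2.1 i) t.2.2 fun i _ => (v i).2⟩
  continuous_toFun := by
    refine Continuous.subtype_mk (continuous_finsetSum _ fun i _ => ?_) _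
    exact ((continuous_apply i).comp continuous_subtype_val).smul continuous_const

lemma aff_apply (v : Fin (m + 1) → Simp n) (t : Simp m) (j : Fin (n + 1)) :
    aff v t j = ∑ i, t i * v i j := by
  change (∑ i, t i • (v i : Fin (n + 1) → ℝ)) j = _
  rw [Finset.sum_apply]
  rfl

lemma aff_face (v : Fin (m + 2) → Simp n) (i : Fin (m + 2)) :
    aff (v ∘ i.succAbove) = (aff v).comp (faceIncl i) := by
  ext t j
  simp only [ContinuousMap.comp_apply]
  rw [aff_apply, aff_apply, Fin.sum_univ_succAbove _ i]
  simp

lemma aff_aff (w : Fin (n + 1) → Simp k) (v : Fin (m + 1) → Simp n) (t : Simp m) :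
    aff (fun i => aff w (v i)) t = aff w (aff v t) := by
  ext j
  simp only [aff_apply, Finset.mul_sum, Finset.sum_mul]
  rw [Finset.sum_comm]
  simp only [mul_assoc]

/-- The vertices of the standard simplex. -/
def verts (n : ℕ) : Fin (n + 1) → Simp n := fun i => stdSimplex.vertex i

lemma aff_vertex (v : Fin (m + 1) → Simp n) (i : Fin (m + 1)) : aff v (verts m i) = v i := by
  ext j
  simp [aff_apply, verts, Pi.single_apply]

lemma aff_verts (t : Simp n) : aff (verts n) t = t := by
  ext j
  simp [aff_apply, verts, Pi.single_apply]

/-- The barycenter of a tuple of points. -/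
def bary (v : Fin (m + 1) → Simp n) : Simp n := aff v stdSimplex.barycenter

lemma bary_aff (w : Fin (n + 1) → Simp k) (v : Fin (m + 1) → Simp n) :
    bary (aff w ∘ v) = aff w (bary v) := aff_aff w v _

/-- The difference of `z` and a convex combination of the points `v i` is the same convex
combination of the differences `z - v i`. -/
lemma dist_aff_le (v : Fin (m + 1) → Simp n) (t : Simp m) (z : Simp n) :
    dist z (aff v t) ≤ ∑ i, t i * dist z (v i) := by
  have h1 : (z : Fin (n + 1) → ℝ) - (aff v t : Fin (n + 1) → ℝ) =
      ∑ i, t i • ((z : Fin (n + 1) → ℝ) - (v i : Fin (n + 1) → ℝ)) := by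
    simp only [smul_sub, Finset.sum_sub_distrib, ← Finset.sum_smul, stdSimplex.sum_eq_one,
      one_smul]
    rfl
  rw [Subtype.dist_eq, dist_eq_norm]
  refine (congrArg norm h1).trans_le ((norm_sum_le _ _).trans (Finset.sum_le_sum fun i _ => ?_))
  rw [norm_smul, Real.norm_of_nonneg (show 0 ≤ t i from t.2.1 i), Subtype.dist_eq, dist_eq_norm]
  rfl

lemma dist_aff_le_of_forall {v : Fin (m + 1) → Simp n} {z : Simp n} {r : ℝ}
    (h : ∀ i, dist z (v i) ≤ r) (t : Simp m) : dist z (aff v t) ≤ r :=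
  calc dist z (aff v t) ≤ ∑ i, t i * dist z (v i) := dist_aff_le v t z
    _ ≤ ∑ i, t i * r := Finset.sum_le_sum fun i _ => mul_le_mul_of_nonneg_left (h i) (t.2.1 i)
    _ = r := by rw [← Finset.sum_mul, stdSimplex.sum_eq_one, one_mul]

/-- Of the `m + 1` equally weighted distances from `v j` to the vertices, the one to `v j` itself
vanishes. This is the source of the factor `m / (m + 1)`. -/
lemma dist_bary_le {v : Fin (m + 1) → Simp n} {D : ℝ} (h : ∀ i j, dist (v i) (v j) ≤ D)
    (j : Fin (m + 1)) : dist (bary v) (v j) ≤ m / (m + 1) * D := by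
  rw [dist_comm]
  refine (dist_aff_le v _ _).trans ?_
  have : ∀ i, (stdSimplex.barycenter : Simp m) i = ((m : ℝ) + 1)⁻¹ := fun i => by
    refine (stdSimplex.barycenter_apply (𝕜 := ℝ) i).trans ?_
    simp
  simp only [this]
  rw [← Finset.mul_sum, Fin.sum_univ_succAbove _ j, dist_self, zero_add, div_eq_inv_mul, mul_assoc]
  gcongr
  refine (Finset.sum_le_sum fun i _ => h j _).trans ?_
  simp

/-- The barycentric subdivision of affine chains. -/
def sd (n : ℕ) : ∀ m : ℕ, ((Fin (m + 1) → Simp n) →₀ ℤ) →ₗ[ℤ] ((Fin (m + 1) → Simp n) →₀ ℤ)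
  | 0 => LinearMap.id
  | m + 1 => Finsupp.lsum ℤ fun v => LinearMap.toSpanSingleton ℤ _
      (coneOp (bary v) m (sd n m ((Tup (Simp n)).bd m (Finsupp.single v 1))))

/-- The chain homotopy between the identity and the barycentric subdivision. -/
def sdHtpy (n : ℕ) : ∀ m : ℕ, ((Fin (m + 1) → Simp n) →₀ ℤ) →ₗ[ℤ] ((Fin (m + 2) → Simp n) →₀ ℤ)
  | 0 => 0
  | m + 1 => Finsupp.lsum ℤ fun v => LinearMap.toSpanSingleton ℤ _
      (coneOp (bary v) (m + 1)
        (Finsupp.single v 1 - sdHtpy n m ((Tup (Simp n)).bd m (Finsupp.single v 1))))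

lemma sd_single (v : Fin (m + 2) → Simp n) :
    sd n (m + 1) (Finsupp.single v 1) =
      coneOp (bary v) m (sd n m ((Tup (Simp n)).bd m (Finsupp.single v 1))) := by
  simp [sd]

lemma sdHtpy_single (v : Fin (m + 2) → Simp n) :
    sdHtpy n (m + 1) (Finsupp.single v 1) = coneOp (bary v) (m + 1)
        (Finsupp.single v 1 - sdHtpy n m ((Tup (Simp n)).bd m (Finsupp.single v 1))) := by
  simp [sdHtpy]

/-- Linear maps on a free abelian group agree if they agree on the basis. -/
lemma finsupp_hom_ext {I : Type u} {M : Type v} [AddCommGroup M] {f g : (I →₀ ℤ) →ₗ[ℤ] M}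
    (h : ∀ i, f (Finsupp.single i 1) = g (Finsupp.single i 1)) (c : I →₀ ℤ) : f c = g c :=
  LinearMap.congr_fun (Finsupp.lhom_ext' fun i => LinearMap.ext_ring (h i)) c

/-- The cone formula gives `∂ b (sd ∂v) = sd ∂v - b ∂ (sd ∂v)`, and by induction the last term is
the cone on `sd ∂∂v = 0`. In the lowest degree it vanishes because a boundary has degree zero. -/
lemma bd_sd : ∀ (m : ℕ) (c : (Fin (m + 2) → Simp n) →₀ ℤ),
    (Tup (Simp n)).bd m (sd n (m + 1) c) = sd n m ((Tup (Simp n)).bd m c)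
  | 0, c => finsupp_hom_ext (f := (Tup (Simp n)).bd 0 ∘ₗ sd n 1)
      (g := sd n 0 ∘ₗ (Tup (Simp n)).bd 0) (fun v => by
        simp only [LinearMap.comp_apply, sd_single]
        rw [bd_coneOp_zero, sd, LinearMap.id_apply, SemiSimp.deg_bd (A := Tup (Simp n)),
          Finsupp.single_zero, sub_zero]) c
  | m + 1, c => finsupp_hom_ext (f := (Tup (Simp n)).bd (m + 1) ∘ₗ sd n (m + 2))
      (g := sd n (m + 1) ∘ₗ (Tup (Simp n)).bd (m + 1)) (fun v => by
        simp only [LinearMap.comp_apply]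
        rw [sd_single, bd_coneOp, bd_sd m, SemiSimp.bd_bd, map_zero, map_zero, sub_zero]) c

/-- Write `T` for the homotopy. Then `∂ b (v - T∂v) = v - T∂v - b (∂v - ∂T∂v)`, and by induction `∂v
- ∂T∂v = sd ∂v`, whose cone is `sd v`. -/
lemma bd_sdHtpy : ∀ (m : ℕ) (c : (Fin (m + 2) → Simp n) →₀ ℤ),
    (Tup (Simp n)).bd (m + 1) (sdHtpy n (m + 1) c) =
      c - sd n (m + 1) c - sdHtpy n m ((Tup (Simp n)).bd m c)
  | 0, c => finsupp_hom_ext (f := (Tup (Simp n)).bd 1 ∘ₗ sdHtpy n 1)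
      (g := LinearMap.id - sd n 1 - sdHtpy n 0 ∘ₗ (Tup (Simp n)).bd 0) (fun v => by
        simp only [LinearMap.comp_apply, LinearMap.sub_apply, LinearMap.id_apply]
        rw [sdHtpy_single, bd_coneOp, sd_single]
        simp [sdHtpy, sd]) c
  | m + 1, c => finsupp_hom_ext (f := (Tup (Simp n)).bd (m + 2) ∘ₗ sdHtpy n (m + 2))
      (g := LinearMap.id - sd n (m + 2) - sdHtpy n (m + 1) ∘ₗ (Tup (Simp n)).bd (m + 1))
      (fun v => by
        simp only [LinearMap.comp_apply, LinearMap.sub_apply, LinearMap.id_apply]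
        rw [sdHtpy_single, bd_coneOp, sd_single, map_sub, bd_sdHtpy m, SemiSimp.bd_bd, map_zero,
          sub_zero, sub_sub_cancel]
        abel) c

/-- Affine maps preserve barycenters and cones. This naturality is what carries the operator over to
singular chains. -/
lemma sd_mapDomain (w : Fin (n + 1) → Simp k) : ∀ (m : ℕ) (c : (Fin (m + 1) → Simp n) →₀ ℤ),
    sd k m (Finsupp.mapDomain (aff w ∘ ·) c) = Finsupp.mapDomain (aff w ∘ ·) (sd n m c)
  | 0, c => rfl
  | m + 1, c => finsupp_hom_ext (f := sd k (m + 1) ∘ₗ Finsupp.lmapDomain ℤ ℤ (aff w ∘ ·))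
      (g := Finsupp.lmapDomain ℤ ℤ (aff w ∘ ·) ∘ₗ sd n (m + 1)) (fun v => by
        simp only [LinearMap.comp_apply, Finsupp.lmapDomain_apply]
        rw [sd_single, ← coneOp_mapDomain, ← sd_mapDomain w m, ← bd_tup_mapDomain,
          Finsupp.mapDomain_single, sd_single, bary_aff]) c

lemma sdHtpy_mapDomain (w : Fin (n + 1) → Simp k) : ∀ (m : ℕ) (c : (Fin (m + 1) → Simp n) →₀ ℤ),
    sdHtpy k m (Finsupp.mapDomain (aff w ∘ ·) c) = Finsupp.mapDomain (aff w ∘ ·) (sdHtpy n m c)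
  | 0, c => by simp [sdHtpy]
  | m + 1, c => finsupp_hom_ext (f := sdHtpy k (m + 1) ∘ₗ Finsupp.lmapDomain ℤ ℤ (aff w ∘ ·))
      (g := Finsupp.lmapDomain ℤ ℤ (aff w ∘ ·) ∘ₗ sdHtpy n (m + 1)) (fun v => by
        simp only [LinearMap.comp_apply, Finsupp.lmapDomain_apply]
        have h (x y : (Fin (m + 2) → Simp n) →₀ ℤ) : Finsupp.mapDomain (aff w ∘ ·) (x - y) =
            Finsupp.mapDomain (aff w ∘ ·) x - Finsupp.mapDomain (aff w ∘ ·) y :=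
          map_sub (Finsupp.lmapDomain ℤ ℤ (aff w ∘ ·)) x y
        rw [sdHtpy_single, ← coneOp_mapDomain, h, ← sdHtpy_mapDomain w m,
          ← bd_tup_mapDomain, Finsupp.mapDomain_single, sdHtpy_single, bary_aff]) c

/-- The simplices of the subdivision of a simplex are contained in every ball containing the
simplex, and are smaller by a definite factor. -/
lemma sd_single_mem_supported (D : ℝ) (hD : 0 ≤ D) : ∀ (m : ℕ) (v : Fin (m + 1) → Simp n),
    (∀ i j, dist (v i) (v j) ≤ D) → sd n m (Finsupp.single v 1) ∈ Finsupp.supported ℤ ℤ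
      {w : Fin (m + 1) → Simp n | (∀ z r, (∀ j, dist z (v j) ≤ r) → ∀ i, dist z (w i) ≤ r) ∧
        ∀ i j, dist (w i) (w j) ≤ m / (m + 1) * D}
  | 0, v, _ => by
    refine Finsupp.single_mem_supported ℤ _ ⟨fun z r h i => h i, fun i j => ?_⟩
    rw [Subsingleton.elim (α := Fin 1) i j, dist_self]
    simp
  | m + 1, v, hv => by
    rw [sd_single, SemiSimp.bd_single, map_sum, map_sum]
    refine Submodule.sum_mem _ fun i _ => ?_
    rw [map_smul, map_smul]
    refine Submodule.smul_mem _ _ ?_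
    have ih := sd_single_mem_supported D hD m (v ∘ i.succAbove) fun _ _ => hv _ _
    -- The ball clause of the induction hypothesis is needed here: the vertices of `v` lie in this
    -- ball about the barycenter, hence so do all vertices of the subdivided face.
    have hb := dist_bary_le hv
    have hr : (m : ℝ) / (m + 1) * D ≤ ((m + 1 : ℕ) : ℝ) / ((m + 1 : ℕ) + 1) * D := by
      refine mul_le_mul_of_nonneg_right ?_ hD
      rw [div_le_div_iff₀ (by positivity) (by positivity)]
      push_cast
      nlinarith
    rw [Finsupp.mem_supported] at ih ⊢
    intro w hw
    rw [coneOp, Finsupp.lmapDomain_apply] at hw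
    obtain ⟨w', hw', rfl⟩ := Finset.mem_image.1 (Finsupp.mapDomain_support (Finset.mem_coe.1 hw))
    obtain ⟨h1, h2⟩ := ih hw'
    have h3 : ∀ z r, (∀ j, dist z (v j) ≤ r) → ∀ i, dist z (w' i) ≤ r :=
      fun z r h => h1 z r fun j => h _
    refine ⟨fun z r h j => ?_, fun j l => ?_⟩
    · refine Fin.cases ?_ (fun j => ?_) j
      · exact dist_aff_le_of_forall h _
      · exact h3 z r h j
    · refine Fin.cases ?_ (fun j => ?_) j <;> refine Fin.cases ?_ (fun l => ?_) l
      · rw [dist_self]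
        positivity
      · exact h3 _ _ hb l
      · rw [dist_comm]
        exact h3 _ _ hb j
      · exact (h2 j l).trans hr

lemma iterate_sd_mem_supported (m : ℕ) (q : ℕ) (c : (Fin (m + 1) → Simp n) →₀ ℤ) (D : ℝ)
    (hD : 0 ≤ D) (hc : c ∈ Finsupp.supported ℤ ℤ
      {w : Fin (m + 1) → Simp n | ∀ i j, dist (w i) (w j) ≤ D}) :
    (sd n m)^[q] c ∈ Finsupp.supported ℤ ℤ
      {w : Fin (m + 1) → Simp n | ∀ i j, dist (w i) (w j) ≤ (m / (m + 1) : ℝ) ^ q * D} := by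
  induction q generalizing c D with
  | zero => simpa using hc
  | succ q ih =>
    rw [Function.iterate_succ_apply]
    have h := ih (sd n m c) (m / (m + 1) * D) (by positivity) (by
      rw [← c.sum_single, Finsupp.sum, map_sum]
      refine Submodule.sum_mem _ fun v hv => ?_
      rw [← Finsupp.smul_single_one, map_smul]
      refine Submodule.smul_mem _ _ ?_
      have := sd_single_mem_supported D hD m v (hc hv)
      exact Finsupp.supported_mono (fun w hw => hw.2) this)
    rwa [← mul_assoc, ← pow_succ] at h

end Affine

/-! ### Relative chain complexes -/

section Relative

open Limits

variable {A B A' B' A'' B'' : SemiSimp.{u}}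

/-- The relative chain complex of a morphism of semisimplicial sets. -/
abbrev relChains (i : A ⟶ B) : ChainComplex (ModuleCat.{u} ℤ) ℕ :=
  cokernel (SemiSimp.chainsFunctor.map i)

/-- The map of relative chain complexes induced by a commutative square. -/
abbrev relChainsMap (i : A ⟶ B) (i' : A' ⟶ B') (f : A ⟶ A') (g : B ⟶ B') (h : i ≫ g = f ≫ i') :
    relChains i ⟶ relChains i' :=
  cokernel.map _ _ (SemiSimp.chainsFunctor.map f) (SemiSimp.chainsFunctor.map g) (by
    rw [← Functor.map_comp, ← Functor.map_comp, h])

/-- The class of a chain in the relative chain complex. -/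
def relMk (i : A ⟶ B) (n : ℕ) : (B.X n →₀ ℤ) →ₗ[ℤ] (relChains i).X n :=
  ((cokernel.π (SemiSimp.chainsFunctor.map i)).f n).hom

lemma relMk_surjective (i : A ⟶ B) (n : ℕ) : Function.Surjective (relMk i n) :=
  (ModuleCat.epi_iff_surjective ((cokernel.π (SemiSimp.chainsFunctor.map i)).f n)).1
    (inferInstanceAs (Epi ((HomologicalComplex.eval _ _ n).map
      (cokernel.π (SemiSimp.chainsFunctor.map i)))))

lemma relMk_eq_zero_iff (i : A ⟶ B) {n : ℕ} (x : B.X n →₀ ℤ) :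
    relMk i n x = 0 ↔ ∃ y : A.X n →₀ ℤ, Finsupp.mapDomain (i.f n) y = x := by
  have h : (ShortComplex.mk _ _ (cokernel.condition (SemiSimp.chainsFunctor.map i))).Exact :=
    ShortComplex.exact_cokernel _
  have h' := (ShortComplex.moduleCat_exact_iff _).1 (h.map (HomologicalComplex.eval _ _ n))
  refine ⟨fun hx => h' x hx, ?_⟩
  rintro ⟨y, rfl⟩
  exact ConcreteCategory.congr_hom (HomologicalComplex.congr_hom
    (cokernel.condition (SemiSimp.chainsFunctor.map i)) n) y

lemma relMk_mapDomain (i : A ⟶ B) {n : ℕ} (y : A.X n →₀ ℤ) :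
    relMk i n (Finsupp.mapDomain (i.f n) y) = 0 :=
  (relMk_eq_zero_iff i _).2 ⟨y, rfl⟩

lemma d_relMk (i : A ⟶ B) {n : ℕ} (x : B.X (n + 1) →₀ ℤ) :
    (relChains i).d (n + 1) n (relMk i (n + 1) x) = relMk i n (B.bd n x) := by
  refine (f_d (cokernel.π (SemiSimp.chainsFunctor.map i)) (i := n + 1) (j := n) x).symm.trans ?_
  exact congrArg (relMk i n) (B.chains_d_apply n x)

lemma relChainsMap_relMk (i : A ⟶ B) (i' : A' ⟶ B') (f : A ⟶ A') (g : B ⟶ B')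
    (h : i ≫ g = f ≫ i') {n : ℕ} (x : B.X n →₀ ℤ) :
    (relChainsMap i i' f g h).f n (relMk i n x) = relMk i' n (Finsupp.mapDomain (g.f n) x) := by
  have := cokernel.π_desc (SemiSimp.chainsFunctor.map i)
    (SemiSimp.chainsFunctor.map g ≫ cokernel.π (SemiSimp.chainsFunctor.map i')) (by
      rw [← Category.assoc, ← Functor.map_comp, h, Functor.map_comp, Category.assoc,
        cokernel.condition, comp_zero])
  exact ConcreteCategory.congr_hom (HomologicalComplex.congr_hom this n) x

lemma relChainsMap_comp (i : A ⟶ B) (i' : A' ⟶ B') (i'' : A'' ⟶ B'') (f : A ⟶ A') (g : B ⟶ B')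
    (h : i ≫ g = f ≫ i') (f' : A' ⟶ A'') (g' : B' ⟶ B'') (h' : i' ≫ g' = f' ≫ i'') :
    relChainsMap i i' f g h ≫ relChainsMap i' i'' f' g' h' =
      relChainsMap i i'' (f ≫ f') (g ≫ g') (by
        rw [← Category.assoc, h, Category.assoc, h', Category.assoc]) := by
  refine HomologicalComplex.Hom.ext (funext fun n => ModuleCat.hom_ext (LinearMap.ext fun x => ?_))
  obtain ⟨x, rfl⟩ := relMk_surjective i n x
  change (relChainsMap i' i'' f' g' h').f n ((relChainsMap i i' f g h).f n (relMk i n x)) =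
    (relChainsMap i i'' (f ≫ f') (g ≫ g') _).f n (relMk i n x)
  rw [relChainsMap_relMk, relChainsMap_relMk, relChainsMap_relMk, ← Finsupp.mapDomain_comp]
  rfl

/-- The short exact sequence of a pair. -/
abbrev relSES (i : A ⟶ B) : ShortComplex (ChainComplex (ModuleCat.{u} ℤ) ℕ) :=
  ShortComplex.mk _ _ (cokernel.condition (SemiSimp.chainsFunctor.map i))

lemma relSES_shortExact (i : A ⟶ B) (hi : ∀ n, Function.Injective (i.f n)) :
    (relSES i).ShortExact := by
  have (n : ℕ) : Mono ((SemiSimp.chainsFunctor.map i).f n) :=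
    (ModuleCat.mono_iff_injective _).2 (Finsupp.mapDomain_injective (hi n))
  have : Mono (SemiSimp.chainsFunctor.map i) := HomologicalComplex.mono_of_mono_f _ this
  exact
    { exact := ShortComplex.exact_cokernel _
      mono_f := this
      epi_g := inferInstanceAs (Epi (cokernel.π _)) }

/-- Five lemma on the long exact homology sequences of the two pairs; the injectivity hypotheses
make the defining sequences short exact. -/
lemma relChainsMap_quasiIso (i : A ⟶ B) (i' : A' ⟶ B') (f : A ⟶ A') (g : B ⟶ B')
    (h : i ≫ g = f ≫ i') (hi : ∀ n, Function.Injective (i.f n))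
    (hi' : ∀ n, Function.Injective (i'.f n)) (hf : QuasiIso (SemiSimp.chainsFunctor.map f))
    (hg : QuasiIso (SemiSimp.chainsFunctor.map g)) : QuasiIso (relChainsMap i i' f g h) :=
  HomologicalComplex.HomologySequence.quasiIso_τ₃ (S₁ := relSES i) (S₂ := relSES i')
    { τ₁ := SemiSimp.chainsFunctor.map f
      τ₂ := SemiSimp.chainsFunctor.map g
      τ₃ := relChainsMap i i' f g h
      comm₁₂ := by
        change SemiSimp.chainsFunctor.map f ≫ SemiSimp.chainsFunctor.map i' =
          SemiSimp.chainsFunctor.map i ≫ SemiSimp.chainsFunctor.map g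
        rw [← Functor.map_comp, ← Functor.map_comp, h]
      comm₂₃ := (cokernel.π_desc _ _ _).symm }
    (relSES_shortExact i hi) (relSES_shortExact i' hi') hf hg

end Relative

/-! ### Subdivision of singular chains -/

section Subdivision

variable (X : TopCat.{u})

/-- The affine singular chain of a singular simplex. -/
def push {X : TopCat.{u}} {n : ℕ} (σ : C(Simp n, X)) (m : ℕ) :
    ((Fin (m + 1) → Simp n) →₀ ℤ) →ₗ[ℤ] (C(Simp m, X) →₀ ℤ) :=
  Finsupp.lmapDomain ℤ ℤ fun v => σ.comp (aff v)

variable {X}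

lemma push_single {n m : ℕ} (σ : C(Simp n, X)) (v : Fin (m + 1) → Simp n) (a : ℤ) :
    push σ m (Finsupp.single v a) = Finsupp.single (σ.comp (aff v)) a :=
  Finsupp.mapDomain_single

lemma push_verts {n : ℕ} (σ : C(Simp n, X)) (a : ℤ) :
    push σ n (Finsupp.single (verts n) a) = Finsupp.single σ a := by
  rw [push_single]
  congr 1
  ext t
  exact congrArg σ (aff_verts t)

lemma bd_push {n m : ℕ} (σ : C(Simp n, X)) (c : (Fin (m + 2) → Simp n) →₀ ℤ) :
    (sing.obj X).bd m (push σ (m + 1) c) = push σ m ((Tup (Simp n)).bd m c) :=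
  SemiSimp.bd_mapDomain_of_comm (A := Tup (Simp n)) (B := sing.obj X)
    (fun _ v => σ.comp (aff v)) (fun i v => by
      change σ.comp (aff (v ∘ i.succAbove)) = (σ.comp (aff v)).comp (faceIncl i)
      rw [aff_face, ContinuousMap.comp_assoc]) c

lemma push_comp_aff {n k m : ℕ} (σ : C(Simp k, X)) (w : Fin (n + 1) → Simp k)
    (c : (Fin (m + 1) → Simp n) →₀ ℤ) :
    push (σ.comp (aff w)) m c = push σ m (Finsupp.mapDomain (aff w ∘ ·) c) := by
  simp only [push, Finsupp.lmapDomain_apply, ← Finsupp.mapDomain_comp]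
  congr 1
  funext v
  ext t
  exact congrArg σ (aff_aff w v t).symm

/-- The operator on singular chains given by an operator on affine chains. -/
def singOp {m l : ℕ} (θ : ((Fin (m + 1) → Simp m) →₀ ℤ) →ₗ[ℤ] ((Fin (l + 1) → Simp m) →₀ ℤ))
    (X : TopCat.{u}) : (C(Simp m, X) →₀ ℤ) →ₗ[ℤ] (C(Simp l, X) →₀ ℤ) :=
  Finsupp.linearCombination ℤ fun σ => push σ l (θ (Finsupp.single (verts m) 1))

lemma singOp_single {m l : ℕ}
    (θ : ((Fin (m + 1) → Simp m) →₀ ℤ) →ₗ[ℤ] ((Fin (l + 1) → Simp m) →₀ ℤ)) (σ : C(Simp m, X)) :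
    singOp θ X (Finsupp.single σ 1) = push σ l (θ (Finsupp.single (verts m) 1)) := by
  rw [singOp, Finsupp.linearCombination_single, one_smul]

/-- An affine simplex `v` is the image of the tuple of vertices under the map `aff v`, so naturality
reduces the value of `θ` at `v` to its value at the vertices. Through this, identities between
operators on affine chains become identities on singular chains. -/
lemma singOp_push {m l n : ℕ}
    (θ : ∀ n, ((Fin (m + 1) → Simp n) →₀ ℤ) →ₗ[ℤ] ((Fin (l + 1) → Simp n) →₀ ℤ))
    (hθ : ∀ {n k : ℕ} (w : Fin (n + 1) → Simp k) (c : (Fin (m + 1) → Simp n) →₀ ℤ),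
      θ k (Finsupp.mapDomain (aff w ∘ ·) c) = Finsupp.mapDomain (aff w ∘ ·) (θ n c))
    (σ : C(Simp n, X)) (c : (Fin (m + 1) → Simp n) →₀ ℤ) :
    singOp (θ m) X (push σ m c) = push σ l (θ n c) :=
  finsupp_hom_ext (f := singOp (θ m) X ∘ₗ push σ m) (g := push σ l ∘ₗ θ n) (fun v => by
    simp only [LinearMap.comp_apply]
    rw [push_single, singOp_single, push_comp_aff, ← hθ, Finsupp.mapDomain_single]
    congr 3
    funext i
    exact aff_vertex v i) c

/-- Each new simplex is an old one composed with an affine map, so its image does not grow. -/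
lemma singOp_mem_supported {m l : ℕ}
    (θ : ((Fin (m + 1) → Simp m) →₀ ℤ) →ₗ[ℤ] ((Fin (l + 1) → Simp m) →₀ ℤ)) {U : Set X}
    {c : C(Simp m, X) →₀ ℤ} (hc : c ∈ Finsupp.supported ℤ ℤ {σ : C(Simp m, X) | ∀ t, σ t ∈ U}) :
    singOp θ X c ∈ Finsupp.supported ℤ ℤ {σ : C(Simp l, X) | ∀ t, σ t ∈ U} := by
  rw [singOp, Finsupp.linearCombination_apply]
  refine Submodule.sum_mem _ fun σ hσ => Submodule.smul_mem _ _ ?_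
  rw [Finsupp.mem_supported]
  intro τ hτ
  rw [push, Finsupp.lmapDomain_apply] at hτ
  classical
  obtain ⟨v, -, rfl⟩ := Finset.mem_image.1 (Finsupp.mapDomain_support (Finset.mem_coe.1 hτ))
  exact fun t => hc hσ _

lemma bd_mem_supported {m : ℕ} {U : Set X} {c : C(Simp (m + 1), X) →₀ ℤ}
    (hc : c ∈ Finsupp.supported ℤ ℤ {σ : C(Simp (m + 1), X) | ∀ t, σ t ∈ U}) :
    (sing.obj X).bd m c ∈ Finsupp.supported ℤ ℤ {σ : C(Simp m, X) | ∀ t, σ t ∈ U} := by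
  rw [SemiSimp.bd_apply]
  refine Submodule.sum_mem _ fun i _ => Submodule.smul_mem _ _ ?_
  rw [Finsupp.mem_supported]
  intro τ hτ
  classical
  obtain ⟨σ, hσ, rfl⟩ := Finset.mem_image.1 (Finsupp.mapDomain_support (Finset.mem_coe.1 hτ))
  exact fun t => hc hσ _

variable (X) in
/-- The subdivision of singular chains. -/
def singSd (m : ℕ) : Module.End ℤ (C(Simp m, X) →₀ ℤ) := singOp (sd m m) X

variable (X) in
/-- The chain homotopy from the identity to the subdivision. -/
def singSdHtpy (m : ℕ) : (C(Simp m, X) →₀ ℤ) →ₗ[ℤ] (C(Simp (m + 1), X) →₀ ℤ) :=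
  singOp (sdHtpy m m) X

lemma singSd_push {m n : ℕ} (σ : C(Simp n, X)) (c : (Fin (m + 1) → Simp n) →₀ ℤ) :
    singSd X m (push σ m c) = push σ m (sd n m c) :=
  singOp_push (fun n => sd n m) (fun w => sd_mapDomain w m) σ c

lemma singSdHtpy_push {m n : ℕ} (σ : C(Simp n, X)) (c : (Fin (m + 1) → Simp n) →₀ ℤ) :
    singSdHtpy X m (push σ m c) = push σ (m + 1) (sdHtpy n m c) :=
  singOp_push (fun n => sdHtpy n m) (fun w => sdHtpy_mapDomain w m) σ c

lemma bd_singSd {m : ℕ} (c : C(Simp (m + 1), X) →₀ ℤ) :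
    (sing.obj X).bd m (singSd X (m + 1) c) = singSd X m ((sing.obj X).bd m c) :=
  finsupp_hom_ext (f := (sing.obj X).bd m ∘ₗ singSd X (m + 1))
    (g := singSd X m ∘ₗ (sing.obj X).bd m) (fun σ => by
      simp only [LinearMap.comp_apply]
      rw [← push_verts σ, singSd_push, bd_push, bd_push, singSd_push, bd_sd]) c

lemma bd_singSdHtpy {m : ℕ} (c : C(Simp (m + 1), X) →₀ ℤ) :
    (sing.obj X).bd (m + 1) (singSdHtpy X (m + 1) c) =
      c - singSd X (m + 1) c - singSdHtpy X m ((sing.obj X).bd m c) :=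
  finsupp_hom_ext (f := (sing.obj X).bd (m + 1) ∘ₗ singSdHtpy X (m + 1))
    (g := LinearMap.id - singSd X (m + 1) - singSdHtpy X m ∘ₗ (sing.obj X).bd m) (fun σ => by
      simp only [LinearMap.comp_apply, LinearMap.sub_apply, LinearMap.id_apply]
      rw [← push_verts σ, singSd_push, singSdHtpy_push, bd_push, bd_push, singSdHtpy_push,
        bd_sdHtpy, map_sub, map_sub]) c

lemma bd_singSd_pow {m : ℕ} (q : ℕ) (c : C(Simp (m + 1), X) →₀ ℤ) :
    (sing.obj X).bd m ((singSd X (m + 1) ^ q) c) = (singSd X m ^ q) ((sing.obj X).bd m c) := by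
  induction q generalizing c with
  | zero => rfl
  | succ q ih => rw [pow_succ, Module.End.mul_apply, ih, bd_singSd, pow_succ, Module.End.mul_apply]

variable (X) in
/-- The chain homotopy from the identity to the iterated subdivision. -/
def singSdPowHtpy (q m : ℕ) : (C(Simp m, X) →₀ ℤ) →ₗ[ℤ] (C(Simp (m + 1), X) →₀ ℤ) :=
  ∑ i ∈ Finset.range q, singSdHtpy X m ∘ₗ (singSd X m ^ i)

/-- The sum `∑ T sd^i` telescopes, since `∂T + T∂ = 1 - sd` and subdivision commutes with the
boundary. -/
lemma bd_singSdPowHtpy {m : ℕ} (q : ℕ) (c : C(Simp (m + 1), X) →₀ ℤ) :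
    (sing.obj X).bd (m + 1) (singSdPowHtpy X q (m + 1) c) =
      c - (singSd X (m + 1) ^ q) c - singSdPowHtpy X q m ((sing.obj X).bd m c) := by
  induction q with
  | zero => simp [singSdPowHtpy]
  | succ q ih =>
    have h (l : ℕ) : singSdPowHtpy X (q + 1) l =
        singSdPowHtpy X q l + singSdHtpy X l ∘ₗ (singSd X l ^ q) := Finset.sum_range_succ _ _
    rw [h, h, LinearMap.add_apply, LinearMap.add_apply, map_add, ih, LinearMap.comp_apply,
      LinearMap.comp_apply, bd_singSdHtpy, bd_singSd_pow, pow_succ' _ q, Module.End.mul_apply]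
    abel

lemma singSd_pow_mem_supported {m : ℕ} (q : ℕ) {U : Set X}
    {c : C(Simp m, X) →₀ ℤ} (hc : c ∈ Finsupp.supported ℤ ℤ {σ : C(Simp m, X) | ∀ t, σ t ∈ U}) :
    (singSd X m ^ q) c ∈ Finsupp.supported ℤ ℤ {σ : C(Simp m, X) | ∀ t, σ t ∈ U} := by
  induction q with
  | zero => exact hc
  | succ q ih =>
    rw [pow_succ', Module.End.mul_apply]
    exact singOp_mem_supported _ ih

lemma singSdPowHtpy_mem_supported {m : ℕ} (q : ℕ) {U : Set X}
    {c : C(Simp m, X) →₀ ℤ} (hc : c ∈ Finsupp.supported ℤ ℤ {σ : C(Simp m, X) | ∀ t, σ t ∈ U}) :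
    singSdPowHtpy X q m c ∈ Finsupp.supported ℤ ℤ {σ : C(Simp (m + 1), X) | ∀ t, σ t ∈ U} := by
  rw [singSdPowHtpy, LinearMap.sum_apply]
  exact Submodule.sum_mem _ fun i _ => singOp_mem_supported _ (singSd_pow_mem_supported i hc)

lemma singSd_pow_push {m n : ℕ} (q : ℕ) (σ : C(Simp n, X)) (c : (Fin (m + 1) → Simp n) →₀ ℤ) :
    (singSd X m ^ q) (push σ m c) = push σ m ((sd n m)^[q] c) := by
  induction q generalizing c with
  | zero => rfl
  | succ q ih =>
    rw [pow_succ, Module.End.mul_apply, singSd_push, ih, Function.iterate_succ_apply]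

/-- Iterated subdivision makes singular chains small. -/
lemma exists_singSd_pow_mem {U V : Set X} (hU : IsOpen U) (hV : IsOpen V) (hUV : U ∪ V = Set.univ)
    {m : ℕ} (c : C(Simp m, X) →₀ ℤ) :
    ∃ q, ∀ q' ≥ q, (singSd X m ^ q') c ∈ Finsupp.supported ℤ ℤ {σ : C(Simp m, X) | ∀ t, σ t ∈ U} ⊔
      Finsupp.supported ℤ ℤ {σ : C(Simp m, X) | ∀ t, σ t ∈ V} := by
  induction c using Finsupp.induction_linear with
  | zero => exact ⟨0, fun q' _ => by rw [map_zero]; exact Submodule.zero_mem _⟩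
  | add c c' h h' =>
    obtain ⟨q, hq⟩ := h
    obtain ⟨q', hq'⟩ := h'
    refine ⟨max q q', fun r hr => ?_⟩
    rw [map_add]
    exact Submodule.add_mem _ (hq r (le_of_max_le_left hr)) (hq' r (le_of_max_le_right hr))
  | single σ a =>
    obtain ⟨δ, hδ, hball⟩ := lebesgue_number_lemma_of_metric (s := (Set.univ : Set (Simp m)))
      (c := fun b : Bool => σ ⁻¹' (if b then U else V)) isCompact_univ
      (fun b => by cases b <;> exact IsOpen.preimage σ.continuous (by assumption))
      (fun t _ => by
        have : σ t ∈ U ∪ V := hUV ▸ Set.mem_univ _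
        rcases this with h | h
        · exact Set.mem_iUnion.2 ⟨true, h⟩
        · exact Set.mem_iUnion.2 ⟨false, h⟩)
    let D := Metric.diam (Set.univ : Set (Simp m))
    have hD : 0 ≤ D := Metric.diam_nonneg
    obtain ⟨q, hq⟩ : ∃ q, ∀ q' ≥ q, (m / (m + 1) : ℝ) ^ q' * D < δ := by
      have h1 : (m / (m + 1) : ℝ) < 1 := (div_lt_one (by positivity)).2 (by linarith)
      -- Dividing by `D + 1` instead of `D` covers the case of a point, whose diameter is zero.
      obtain ⟨q, hq⟩ := exists_pow_lt_of_lt_one (show (0 : ℝ) < δ / (D + 1) by positivity) h1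
      refine ⟨q, fun q' hq' => ?_⟩
      have h2 := (pow_le_pow_of_le_one (by positivity) h1.le hq').trans_lt hq
      rw [lt_div_iff₀ (by positivity)] at h2
      have : (0 : ℝ) ≤ (m / (m + 1) : ℝ) ^ q' := by positivity
      linarith
    refine ⟨q, fun q' hq' => ?_⟩
    rw [← Finsupp.smul_single_one, map_smul]
    refine Submodule.smul_mem _ _ ?_
    rw [← push_verts, singSd_pow_push, ← Finsupp.supported_union, Finsupp.mem_supported]
    intro τ hτ
    rw [push, Finsupp.lmapDomain_apply] at hτ
    classical
    obtain ⟨w, hw, rfl⟩ := Finset.mem_image.1 (Finsupp.mapDomain_support (Finset.mem_coe.1 hτ))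
    have hw' := iterate_sd_mem_supported m q' (Finsupp.single (verts m) 1) D hD
      (Finsupp.single_mem_supported ℤ _ fun i j => Metric.dist_le_diam_of_mem
        isCompact_univ.isBounded (Set.mem_univ _) (Set.mem_univ _)) hw
    -- All vertices of `w` are closer to `w 0` than the Lebesgue number, so by convexity the whole
    -- affine simplex lies in one ball about `w 0`.
    obtain ⟨b, hb⟩ := hball (w 0) (Set.mem_univ _)
    have key (t : Simp m) : σ (aff w t) ∈ if b then U else V := by
      refine hb (Metric.mem_ball.2 ?_)
      rw [dist_comm]
      exact (dist_aff_le_of_forall (hw' 0) t).trans_lt (hq q' hq')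
    cases b
    · exact Or.inr key
    · exact Or.inl key

end Subdivision

/-! ### Excision -/

section Excision

variable {X : TopCat.{u}}

/-- The inclusion of a smaller subspace in a larger one. -/
def inclMap {U V : Set X} (h : U ⊆ V) : TopCat.of U ⟶ TopCat.of V :=
  TopCat.ofHom ⟨Set.inclusion h, continuous_inclusion h⟩

/-- The inclusion of a subspace. -/
def subMap (U : Set X) : TopCat.of U ⟶ X := TopCat.ofHom ⟨Subtype.val, continuous_subtype_val⟩

lemma sing_map_injective {Y Z : TopCat.{u}} (f : Y ⟶ Z) (hf : Function.Injective f) (n : ℕ) :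
    Function.Injective ((sing.map f).f n) := fun σ τ h => by
  ext t
  exact hf (DFunLike.congr_fun h t)

lemma exists_mapDomain_subMap {U : Set X} {n : ℕ} {c : C(Simp n, X) →₀ ℤ}
    (hc : c ∈ Finsupp.supported ℤ ℤ {σ : C(Simp n, X) | ∀ t, σ t ∈ U}) :
    ∃ c' : C(Simp n, U) →₀ ℤ, Finsupp.mapDomain ((sing.map (subMap U)).f n) c' = c := by
  have h := Finsupp.lmapDomain_supported (M := ℤ) (R := ℤ) ((sing.map (subMap U)).f n) Set.univ
  have h2 : {σ : C(Simp n, X) | ∀ t, σ t ∈ U} ⊆ (sing.map (subMap U)).f n '' Set.univ :=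
    fun σ hσ => ⟨⟨fun t => ⟨σ t, hσ t⟩, σ.continuous.subtype_mk _⟩, trivial, rfl⟩
  have h3 := Finsupp.supported_mono (R := ℤ) (M := ℤ) h2 hc
  rw [← h] at h3
  obtain ⟨c', -, hc'⟩ := h3
  exact ⟨c', hc'⟩

lemma mapDomain_subMap_mem {U : Set X} {n : ℕ} (c : C(Simp n, U) →₀ ℤ) :
    Finsupp.mapDomain ((sing.map (subMap U)).f n) c ∈
      Finsupp.supported ℤ ℤ {σ : C(Simp n, X) | ∀ t, σ t ∈ U} := by
  rw [Finsupp.mem_supported]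
  intro τ hτ
  classical
  obtain ⟨σ, -, rfl⟩ := Finset.mem_image.1 (Finsupp.mapDomain_support (Finset.mem_coe.1 hτ))
  exact fun t => (σ t).2

lemma mapDomain_subMap_injective (U : Set X) (n : ℕ) :
    Function.Injective (Finsupp.mapDomain (M := ℤ) ((sing.map (subMap U)).f n)) :=
  Finsupp.mapDomain_injective (sing_map_injective (subMap U) Subtype.val_injective n)

lemma mapDomain_inclMap_subMap {U V : Set X} (h : U ⊆ V) {n : ℕ} (c : C(Simp n, U) →₀ ℤ) :
    Finsupp.mapDomain ((sing.map (subMap V)).f n)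
      (Finsupp.mapDomain ((sing.map (inclMap h)).f n) c) =
      Finsupp.mapDomain ((sing.map (subMap U)).f n) c :=
  Finsupp.mapDomain_comp.symm

lemma supported_inter_mem {U V : Set X} {n : ℕ} {c : C(Simp n, X) →₀ ℤ}
    (hU : c ∈ Finsupp.supported ℤ ℤ {σ : C(Simp n, X) | ∀ t, σ t ∈ U})
    (hV : c ∈ Finsupp.supported ℤ ℤ {σ : C(Simp n, X) | ∀ t, σ t ∈ V}) :
    c ∈ Finsupp.supported ℤ ℤ {σ : C(Simp n, X) | ∀ t, σ t ∈ U ∩ V} :=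
  fun _ hσ t => ⟨hU hσ t, hV hσ t⟩

lemma excision_comm (U V : Set X) :
    sing.map (inclMap (Set.inter_subset_right : U ∩ V ⊆ V)) ≫ sing.map (subMap V) =
      sing.map (inclMap (Set.inter_subset_left : U ∩ V ⊆ U)) ≫ sing.map (subMap U) :=
  rfl

/-- The excision map for an open cover by two sets. -/
abbrev excisionMap (U V : Set X) :
    relChains (sing.map (inclMap (Set.inter_subset_right : U ∩ V ⊆ V))) ⟶
      relChains (sing.map (subMap U)) :=
  relChainsMap _ _ (sing.map (inclMap (Set.inter_subset_left : U ∩ V ⊆ U)))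
    (sing.map (subMap V)) (excision_comm U V)

/-- A cycle of the cone of the excision map is given by a chain `α` of `V`, relative to `U ∩ V`, and
a chain `β` of `X` with `∂β = α + u`, where `u` is a chain of `U`. Subdivide until `sd^q β = βU +
βV`, and let `T` be the homotopy from the identity to `sd^q`. Then `a' = T α + βV` lies in `V`, and
`(a', -T β)` bounds the cycle: `∂a' - α` lies in `U ∩ V`, and `∂(-T β) - (a' - β) = βU + T u` lies
in `U`. -/
lemma excisionMap_quasiIso {U V : Set X} (hU : IsOpen U) (hV : IsOpen V)
    (hUV : U ∪ V = Set.univ) : QuasiIso (excisionMap U V) := by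
  have hR (n : ℕ) (x : C(Simp n, X) →₀ ℤ)
      (hx : x ∈ Finsupp.supported ℤ ℤ {σ : C(Simp n, X) | ∀ t, σ t ∈ U}) :
      relMk (sing.map (subMap U)) n x = 0 := by
    obtain ⟨y, rfl⟩ := exists_mapDomain_subMap hx
    exact relMk_mapDomain (sing.map (subMap U)) y
  refine quasiIso_of_forall _ (fun b => ?_) (fun n a b ha hb => ?_)
  · obtain ⟨x, rfl⟩ := relMk_surjective _ 0 b
    -- A point lies in `U` or in `V`, so 0-chains split without subdivision.
    have hx : x ∈ Finsupp.supported ℤ ℤ {σ : C(Simp 0, X) | ∀ t, σ t ∈ U} ⊔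
        Finsupp.supported ℤ ℤ {σ : C(Simp 0, X) | ∀ t, σ t ∈ V} := by
      rw [← Finsupp.supported_union, Finsupp.mem_supported]
      intro σ _
      rcases (hUV ▸ Set.mem_univ (σ default) : σ default ∈ U ∪ V) with h | h
      · exact Or.inl fun t => (Subsingleton.elim default t) ▸ h
      · exact Or.inr fun t => (Subsingleton.elim default t) ▸ h
    obtain ⟨xU, hxU, xV, hxV, rfl⟩ := Submodule.mem_sup.1 hx
    obtain ⟨y, rfl⟩ := exists_mapDomain_subMap hxV
    refine ⟨relMk _ 0 y, 0, ?_⟩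
    rw [map_zero, relChainsMap_relMk (h := excision_comm U V), map_add, hR 0 xU hxU, zero_add, sub_self]
  · obtain ⟨α, rfl⟩ := relMk_surjective _ n a
    obtain ⟨β, rfl⟩ := relMk_surjective _ (n + 1) b
    rw [relChainsMap_relMk (h := excision_comm U V), d_relMk, ← sub_eq_zero, ← map_sub, relMk_eq_zero_iff] at hb
    obtain ⟨u, hu⟩ := hb
    set αX := Finsupp.mapDomain ((sing.map (subMap V)).f n) α with hαX
    set uX := Finsupp.mapDomain ((sing.map (subMap U)).f n) u with huX
    have huU : uX ∈ Finsupp.supported ℤ ℤ {σ : C(Simp n, X) | ∀ t, σ t ∈ U} :=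
      mapDomain_subMap_mem u
    have hαV : αX ∈ Finsupp.supported ℤ ℤ {σ : C(Simp n, X) | ∀ t, σ t ∈ V} :=
      mapDomain_subMap_mem α
    have hβ : (sing.obj X).bd n β = αX + uX := by rw [hu]; abel
    obtain ⟨q, hq⟩ := exists_singSd_pow_mem hU hV hUV β
    obtain ⟨βU, hβU, βV, hβV, hβ'⟩ := Submodule.mem_sup.1 (hq q le_rfl)
    -- the chain homotopy applied to `α`, corrected by the part of the subdivision of `β` in `V`
    have hT : singSdPowHtpy X q n αX + βV ∈
        Finsupp.supported ℤ ℤ {σ : C(Simp (n + 1), X) | ∀ t, σ t ∈ V} :=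
      Submodule.add_mem _ (singSdPowHtpy_mem_supported q hαV) hβV
    obtain ⟨a', ha'⟩ := exists_mapDomain_subMap hT
    -- The error `w` is `T ∂α`, which lies in `U` because `α` is a relative cycle. In degree 0 there
    -- is no boundary to take; there `T` vanishes and the subdivision is the identity.
    have hda : ∃ w ∈ Finsupp.supported ℤ ℤ {σ : C(Simp n, X) | ∀ t, σ t ∈ U},
        (sing.obj X).bd n (singSdPowHtpy X q n αX) = αX - (singSd X n ^ q) αX - w := by
      cases n with
      | zero =>
        refine ⟨0, Submodule.zero_mem _, ?_⟩
        have h1 : singSdPowHtpy X q 0 αX = 0 := by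
          rw [singSdPowHtpy, LinearMap.sum_apply]
          refine Finset.sum_eq_zero fun i _ => ?_
          have : singSdHtpy X 0 = 0 := by
            refine Finsupp.lhom_ext' fun σ => LinearMap.ext_ring ?_
            exact (singOp_single _ _).trans (map_zero _)
          rw [this]
          rfl
        have h2 : singSd X 0 = 1 := by
          refine Finsupp.lhom_ext' fun σ => LinearMap.ext_ring ?_
          exact (singOp_single _ _).trans (push_verts σ 1)
        rw [h1, h2, one_pow, map_zero, Module.End.one_apply, sub_self, sub_zero]
      | succ n =>
        refine ⟨_, ?_, bd_singSdPowHtpy q αX⟩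
        refine singSdPowHtpy_mem_supported q ?_
        have h1 := ha n
        rw [d_relMk, relMk_eq_zero_iff] at h1
        obtain ⟨w, hw⟩ := h1
        rw [hαX, SemiSimp.bd_mapDomain, ← hw]
        refine (mapDomain_inclMap_subMap (U := U ∩ V) _ w).symm ▸ ?_
        exact Finsupp.supported_mono (fun σ hσ t => (hσ t).1) (mapDomain_subMap_mem w)
    obtain ⟨w, hw, hda⟩ := hda
    refine ⟨relMk _ (n + 1) a', relMk _ (n + 2) (-singSdPowHtpy X q (n + 1) β), ?_, ?_⟩
    · rw [d_relMk, ← sub_eq_zero, ← map_sub, relMk_eq_zero_iff]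
      have h1 : Finsupp.mapDomain ((sing.map (subMap V)).f n)
          ((sing.obj (TopCat.of V)).bd n a' - α) =
          (singSd X n ^ q) uX - (sing.obj X).bd n βU - w := by
        have h2 (x y : C(Simp n, V) →₀ ℤ) : Finsupp.mapDomain ((sing.map (subMap V)).f n) (x - y) =
            Finsupp.mapDomain ((sing.map (subMap V)).f n) x -
              Finsupp.mapDomain ((sing.map (subMap V)).f n) y :=
          map_sub (Finsupp.lmapDomain ℤ ℤ ((sing.map (subMap V)).f n)) x y
        have h3 : (sing.obj X).bd n βV = (singSd X n ^ q) αX + (singSd X n ^ q) uX -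
            (sing.obj X).bd n βU := by
          rw [← map_add, ← hβ, ← bd_singSd_pow, ← hβ', map_add, add_sub_cancel_left]
        rw [h2, ← SemiSimp.bd_mapDomain, ha', map_add, hda, h3, ← hαX]
        abel
      -- The explicit formula places the chain in `U`, and its being a chain of the subspace places
      -- it in `V`.
      have h4 : Finsupp.mapDomain ((sing.map (subMap V)).f n)
          ((sing.obj (TopCat.of V)).bd n a' - α) ∈
            Finsupp.supported ℤ ℤ {σ : C(Simp n, X) | ∀ t, σ t ∈ U ∩ V} := by
        refine supported_inter_mem ?_ (mapDomain_subMap_mem _)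
        rw [h1]
        exact Submodule.sub_mem _ (Submodule.sub_mem _ (singSd_pow_mem_supported q huU)
          (bd_mem_supported hβU)) hw
      obtain ⟨y, hy⟩ := exists_mapDomain_subMap h4
      refine ⟨y, mapDomain_subMap_injective V n ?_⟩
      exact (mapDomain_inclMap_subMap _ y).trans hy
    · rw [d_relMk, relChainsMap_relMk (h := excision_comm U V), ha', map_neg, bd_singSdPowHtpy, ← sub_eq_zero, ← map_sub,
        ← map_sub, hβ, ← hβ', map_add (singSdPowHtpy X q n)]
      have h5 : -(β - (βU + βV) - (singSdPowHtpy X q n αX + singSdPowHtpy X q n uX)) -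
          (singSdPowHtpy X q n αX + βV - β) = βU + singSdPowHtpy X q n uX := by
        abel
      rw [h5]
      exact hR _ _ (Submodule.add_mem _ hβU (singSdPowHtpy_mem_supported q huU))

end Excision

/-! ### Acyclic semisimplicial sets -/

section Acyclic

/-- A semisimplicial set is acyclic if its reduced homology vanishes. -/
structure SemiSimp.Acyclic (A : SemiSimp.{u}) : Prop where
  exists_bd_eq : ∀ (n : ℕ) (c : A.X (n + 1) →₀ ℤ), A.bd n c = 0 → ∃ b, A.bd (n + 1) b = c
  exists_bd_eq_zero : ∀ c : A.X 0 →₀ ℤ, SemiSimp.deg _ c = 0 → ∃ b, A.bd 0 b = c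

lemma SemiSimp.chains_d_eq_zero {A : SemiSimp.{u}} {n : ℕ} {c : A.X (n + 1) →₀ ℤ}
    (hc : A.bd n c = 0) (j : ℕ) : A.chains.d (n + 1) j c = 0 := by
  by_cases h : n = j
  · subst h
    exact (A.chains_d_apply n c).trans hc
  · rw [A.chains.shape _ _ (by simpa using fun e => h e.symm)]
    rfl

lemma sing_acyclic (X : TopCat.{u}) [ContractibleSpace X] : (sing.obj X).Acyclic where
  exists_bd_eq n c hc := by
    obtain ⟨x₀, ⟨H⟩⟩ := id_nullhomotopic X
    have : TotallyDisconnectedSpace (TopCat.of PUnit.{u + 1}) :=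
      inferInstanceAs (TotallyDisconnectedSpace PUnit)
    let j : TopCat.of PUnit.{u + 1} ⟶ X := TopCat.ofHom (ContinuousMap.const _ x₀)
    have hq : QuasiIso (singChains.map (toPoint X)) :=
      singChains_quasiIso (f := toPoint X) (g := j) H.symm (ContinuousMap.Homotopy.refl _)
    have hz : Limits.IsZero ((singChains.obj X).homology (n + 1)) :=
      (isZero_homology_singChains_of_totallyDisconnectedSpace (TopCat.of PUnit.{u + 1}) (n + 1)
        (by simp)).of_iso
        (asIso (HomologicalComplex.homologyMap (singChains.map (toPoint X)) (n + 1)))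
    obtain ⟨b, hb⟩ := exists_d_eq_of_isZero hz c (SemiSimp.chains_d_eq_zero hc)
    exact ⟨b, (SemiSimp.chains_d_apply _ (n + 1) b).symm.trans hb⟩
  exists_bd_eq_zero c hc := exists_bd_eq_of_pathConnectedSpace X c hc

/-- The homology of a pair whose smaller part is acyclic. -/
lemma isIso_homologyMap_cokernel_π {A B : SemiSimp.{u}} (i : A ⟶ B)
    (hi : ∀ n, Function.Injective (i.f n)) (hA : A.Acyclic) (n : ℕ) :
    IsIso (HomologicalComplex.homologyMap
      (Limits.cokernel.π (SemiSimp.chainsFunctor.map i)) (n + 1)) := by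
  have hinj (n : ℕ) := Finsupp.mapDomain_injective (M := ℤ) (hi n)
  have hsub (n : ℕ) (x y : B.X n →₀ ℤ) (h : relMk i n x = relMk i n y) :
      ∃ u, Finsupp.mapDomain (i.f n) u = x - y :=
    (relMk_eq_zero_iff i _).1 (by rw [map_sub, h, sub_self])
  have : Mono (HomologicalComplex.homologyMap
      (Limits.cokernel.π (SemiSimp.chainsFunctor.map i)) (n + 1)) := by
    refine mono_homologyMap _ _ fun x hx y hy => ?_
    obtain ⟨β, rfl⟩ := relMk_surjective i (n + 2) y
    have hx' : B.bd n x = 0 := (B.chains_d_apply n x).symm.trans (hx n)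
    obtain ⟨u, hu⟩ := hsub (n + 1) (B.bd (n + 1) β) x ((d_relMk i β).symm.trans hy)
    obtain ⟨w, hw⟩ := hA.exists_bd_eq n u (hinj n (by
      rw [← SemiSimp.bd_mapDomain, hu, map_sub, SemiSimp.bd_bd, hx', sub_zero,
        Finsupp.mapDomain_zero]))
    refine ⟨β - Finsupp.mapDomain (i.f (n + 2)) w, (B.chains_d_apply (n + 1) _).trans ?_⟩
    rw [map_sub, SemiSimp.bd_mapDomain, hw, hu, sub_sub_cancel]
  have : Epi (HomologicalComplex.homologyMap
      (Limits.cokernel.π (SemiSimp.chainsFunctor.map i)) (n + 1)) := by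
    refine epi_homologyMap _ _ fun y hy => ?_
    obtain ⟨β, rfl⟩ := relMk_surjective i (n + 1) y
    have h := hy n
    rw [d_relMk, relMk_eq_zero_iff] at h
    obtain ⟨u, hu⟩ := h
    -- In the lowest degree acyclicity only concerns chains of degree zero. The chain `u` qualifies,
    -- because its image is a boundary.
    obtain ⟨w, hw⟩ : ∃ w, A.bd n w = u := by
      cases n with
      | zero =>
        refine hA.exists_bd_eq_zero u ?_
        rw [← SemiSimp.deg_mapDomain (i.f 0), hu, SemiSimp.deg_bd]
      | succ n =>
        refine hA.exists_bd_eq n u (hinj n ?_)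
        rw [← SemiSimp.bd_mapDomain, hu, SemiSimp.bd_bd, Finsupp.mapDomain_zero]
    refine ⟨β - Finsupp.mapDomain (i.f (n + 1)) w, SemiSimp.chains_d_eq_zero ?_, 0, ?_⟩
    · rw [map_sub, SemiSimp.bd_mapDomain, hw, hu, sub_self]
    · have h1 : relMk i (n + 1) (β - Finsupp.mapDomain (i.f (n + 1)) w) = relMk i (n + 1) β := by
        rw [map_sub, relMk_mapDomain, sub_zero]
      rw [map_zero, eq_comm, sub_eq_zero]
      exact h1
  exact isIso_of_mono_of_epi _

end Acyclic

/-! ### The homology of a mapping cone -/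

section ConeHomology

variable {X Y X' Y' : Type u} [TopologicalSpace X] [TopologicalSpace Y] [TopologicalSpace X']
  [TopologicalSpace Y']

open scoped unitInterval

namespace Cof

/-- The classes of the points of `Y ⊔ (X × [0,1]) ⊔ {*}` in the mapping cone. -/
def mk (f : C(X, Y)) (p : Y ⊕ ((X × I) ⊕ PUnit.{u + 1})) : Cof f := Quot.mk _ p

lemma isQuotientMap_mk (f : C(X, Y)) : Topology.IsQuotientMap (mk f) := isQuotientMap_quot_mk

lemma mk_apex (f : C(X, Y)) (x : X) :
    mk f (Sum.inr (Sum.inl (x, 0))) = mk f (Sum.inr (Sum.inr PUnit.unit)) :=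
  Quot.sound (ConeRel.apex x)

lemma mk_base (f : C(X, Y)) (x : X) : mk f (Sum.inr (Sum.inl (x, 1))) = mk f (Sum.inl (f x)) :=
  Quot.sound (ConeRel.base x)

/-- The height function on a mapping cone. -/
def height (f : C(X, Y)) : C(Cof f, I) where
  toFun := Quot.lift (Sum.elim (fun _ => 1) (Sum.elim Prod.snd fun _ => 0)) (by
    rintro _ _ (x | x) <;> rfl)
  continuous_toFun := continuous_quot_lift _
    (continuous_const.sumElim (continuous_snd.sumElim continuous_const))

/-- The convex combination of two points of the unit interval. -/
def mix (τ s r : I) : I :=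
  ⟨(1 - τ) * s + τ * r, by
    have := τ.2.1; have := τ.2.2; have := s.2.1; have := s.2.2; have := r.2.1; have := r.2.2
    constructor <;> nlinarith⟩

lemma coe_mix (τ s r : I) : (mix τ s r : ℝ) = (1 - τ) * s + τ * r := rfl

lemma mix_zero (s r : I) : mix 0 s r = s := Subtype.ext (by simp [coe_mix])

lemma mix_one (s r : I) : mix 1 s r = r := Subtype.ext (by simp [coe_mix])

lemma mix_self (τ s : I) : mix τ s s = s := Subtype.ext (by rw [coe_mix]; ring)

@[fun_prop]
lemma continuous_mix {T : Type*} [TopologicalSpace T] {a b c : T → I} (ha : Continuous a)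
    (hb : Continuous b) (hc : Continuous c) : Continuous fun t => mix (a t) (b t) (c t) := by
  unfold mix
  fun_prop

/-! ### Deformations of the cone through its height function. -/

/-- The deformation of a mapping cone changing the heights by a given function, curried. -/
def deformCurried (f : C(X, Y)) (c : C(I, I)) (h0 : c 0 = 0) (h1 : c 1 = 1) :
    C(Cof f, C(I, Cof f)) where
  toFun := Quot.lift (Sum.elim (fun y => ContinuousMap.const _ (mk f (Sum.inl y)))
    (Sum.elim (fun p => ⟨fun τ => mk f (Sum.inr (Sum.inl (p.1, mix τ p.2 (c p.2)))),
      (isQuotientMap_mk f).continuous.comp (by fun_prop)⟩)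
      fun _ => ContinuousMap.const _ (mk f (Sum.inr (Sum.inr PUnit.unit))))) (by
    rintro _ _ (x | x) <;> ext τ
    · change mk f (Sum.inr (Sum.inl (x, mix τ 0 (c 0)))) = mk f (Sum.inr (Sum.inr PUnit.unit))
      rw [h0, mix_self, mk_apex]
    · change mk f (Sum.inr (Sum.inl (x, mix τ 1 (c 1)))) = mk f (Sum.inl (f x))
      rw [h1, mix_self, mk_base])
  -- Taking values in the function space lets continuity be checked on the three pieces of the
  -- quotient, which avoids the product of a quotient map with `I`. Local compactness of `I` then
  -- makes the uncurried map continuous.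
  continuous_toFun := by
    refine continuous_quot_lift _ (Continuous.sumElim ?_ (Continuous.sumElim ?_ ?_))
    · exact ContinuousMap.continuous_const'.comp
        ((isQuotientMap_mk f).continuous.comp continuous_inl)
    · exact (ContinuousMap.curry (X := X × I) (Y := I) ⟨fun q => mk f (Sum.inr (Sum.inl (q.1.1,
        mix q.2 q.1.2 (c q.1.2)))), (isQuotientMap_mk f).continuous.comp (by fun_prop)⟩).continuous
    · exact continuous_const

/-- The deformation of a mapping cone changing the heights by a given function. -/
def deform (f : C(X, Y)) (c : C(I, I)) (h0 : c 0 = 0) (h1 : c 1 = 1) : C(Cof f × I, Cof f) :=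
  (deformCurried f c h0 h1).uncurry

variable (f : C(X, Y)) (c : C(I, I)) (h0 : c 0 = 0) (h1 : c 1 = 1)

lemma deform_inr_inl (x : X) (s τ : I) : deform f c h0 h1 (mk f (Sum.inr (Sum.inl (x, s))), τ) =
    mk f (Sum.inr (Sum.inl (x, mix τ s (c s)))) := rfl

lemma deform_zero (z : Cof f) : deform f c h0 h1 (z, 0) = z := by
  obtain ⟨y | ⟨x, s⟩ | _, rfl⟩ := (isQuotientMap_mk f).surjective z
  · rfl
  · rw [deform_inr_inl, mix_zero]
  · rfl

lemma height_deform (z : Cof f) (τ : I) :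
    height f (deform f c h0 h1 (z, τ)) = mix τ (height f z) (c (height f z)) := by
  obtain ⟨y | ⟨x, s⟩ | _, rfl⟩ := (isQuotientMap_mk f).surjective z
  · change 1 = mix τ 1 (c 1)
    rw [h1, mix_self]
  · rfl
  · change 0 = mix τ 0 (c 0)
    rw [h0, mix_self]

/-- The part of a mapping cone lying over a set of heights. -/
def region (A : Set I) : Set (Cof f) := height f ⁻¹' A

/-- A deformation retraction given by a deformation of the heights induces a quasi-isomorphism. -/
lemma singChains_quasiIso_of_deform {A : Set I} (hA : ∀ s ∈ A, ∀ τ, mix τ s (c s) ∈ A)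
    {T : TopCat.{u}} (r : TopCat.of (region f A) ⟶ T) (j : T ⟶ TopCat.of (region f A))
    (hrj : j ≫ r = 𝟙 T)
    (hjr : ∀ z : region f A, deform f c h0 h1 (z, 1) = (j (r z) : region f A)) :
    QuasiIso (singChains.map r) := by
  refine singChains_quasiIso (f := r) (g := j) (ContinuousMap.Homotopy.symm ?_)
    (hrj ▸ ContinuousMap.Homotopy.refl _)
  exact
    { toFun := fun p => ⟨deform f c h0 h1 (p.2.1, p.1), by
        change height f _ ∈ A
        rw [height_deform]
        exact hA _ p.2.2 _⟩
      continuous_toFun := by fun_prop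
      map_zero_left := fun z => Subtype.ext (deform_zero f c h0 h1 z)
      map_one_left := fun z => Subtype.ext (hjr z) }

/-! ### Coordinates on the cone defined away from the apex or the ends. -/

/-- The base point of a point of a mapping cone other than the apex. -/
def toBase : Cof f → Option Y :=
  Quot.lift (Sum.elim some (Sum.elim (fun p => if p.2 = 0 then none else some (f p.1))
    fun _ => none)) (by rintro _ _ (x | x) <;> simp)

/-- The position in `X` of a point strictly between the apex and the base. -/
def toFib : Cof f → Option X :=
  Quot.lift (Sum.elim (fun _ => none)
    (Sum.elim (fun p => if p.2 = 0 ∨ p.2 = 1 then none else some p.1) fun _ => none)) (by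
    rintro _ _ (x | x) <;> simp)

/-- A partially defined continuous map. -/
def partialMap {S T : Type*} [TopologicalSpace S] [TopologicalSpace T] (ρ : S → Option T)
    (hρ : ∀ O : Set T, IsOpen O → IsOpen {z | ∃ y ∈ O, ρ z = some y}) (D : Set S)
    (hD : ∀ z ∈ D, (ρ z).isSome) : C(D, T) where
  toFun z := (ρ z).get (hD z z.2)
  continuous_toFun := by
    refine continuous_def.2 fun O hO => ?_
    convert (hρ O hO).preimage (continuous_subtype_val (p := (· ∈ D))) using 1
    ext z
    constructor
    · exact fun h => ⟨_, h, (Option.some_get _).symm⟩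
    · rintro ⟨y, hy, h⟩
      change (ρ z).get _ ∈ O
      simpa [h] using hy

lemma some_partialMap {S T : Type*} [TopologicalSpace S] [TopologicalSpace T] (ρ : S → Option T)
    (hρ : ∀ O : Set T, IsOpen O → IsOpen {z | ∃ y ∈ O, ρ z = some y}) (D : Set S)
    (hD : ∀ z ∈ D, (ρ z).isSome) (z : D) : some (partialMap ρ hρ D hD z) = ρ z :=
  Option.some_get _

/-- Openness is tested on the three pieces before identification. Using a partially defined function
on the whole cone avoids restricting the quotient map to a subspace. -/
lemma isOpen_toBase (O : Set Y) (hO : IsOpen O) : IsOpen {z | ∃ y ∈ O, toBase f z = some y} := by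
  rw [← (isQuotientMap_mk f).isOpen_preimage, isOpen_sum_iff, isOpen_sum_iff]
  refine ⟨?_, ?_, ?_⟩
  · convert hO using 1
    ext y
    simp [toBase, mk]
  · convert (isOpen_compl_singleton (x := (0 : I))).preimage continuous_snd |>.inter
      (hO.preimage (f.continuous.comp continuous_fst)) using 1
    ext ⟨x, s⟩
    by_cases hs : s = 0 <;> simp [toBase, mk, hs]
  · convert isOpen_empty using 1
    ext
    simp [toBase, mk]

lemma isOpen_toFib (O : Set X) (hO : IsOpen O) : IsOpen {z | ∃ y ∈ O, toFib f z = some y} := by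
  rw [← (isQuotientMap_mk f).isOpen_preimage, isOpen_sum_iff, isOpen_sum_iff]
  refine ⟨?_, ?_, ?_⟩
  · convert isOpen_empty using 1
    ext
    simp [toFib, mk]
  · convert (((isOpen_compl_singleton (x := (0 : I))).inter
      (isOpen_compl_singleton (x := (1 : I)))).preimage continuous_snd).inter
      (hO.preimage continuous_fst) using 1
    ext ⟨x, s⟩
    by_cases hs : s = 0 <;> by_cases hs' : s = 1 <;> simp [toFib, mk, hs, hs']
  · convert isOpen_empty using 1
    ext
    simp [toFib, mk]

/-! ### The open cover of the cone and the retractions of its pieces. -/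

/-- The heights of a neighbourhood of the apex. -/
def lowI : Set I := {s | (s : ℝ) < 2 / 3}

/-- The heights of a neighbourhood of the base. -/
def highI : Set I := {s | 1 / 3 < (s : ℝ)}

/-- A neighbourhood of the apex of a mapping cone. -/
abbrev low : Set (Cof f) := region f lowI

/-- A neighbourhood of the base of a mapping cone. -/
abbrev high : Set (Cof f) := region f highI

lemma isOpen_low : IsOpen (low f) :=
  (isOpen_lt continuous_subtype_val continuous_const).preimage (height f).continuous

lemma isOpen_high : IsOpen (high f) :=
  (isOpen_lt continuous_const continuous_subtype_val).preimage (height f).continuous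

lemma low_union_high : low f ∪ high f = Set.univ := by
  refine Set.eq_univ_of_forall fun z => ?_
  by_cases h : (height f z : ℝ) < 2 / 3
  · exact Or.inl h
  · exact Or.inr (show (1 / 3 : ℝ) < height f z by linarith)

lemma isSome_toBase (z : Cof f) (hz : z ∈ high f) : (toBase f z).isSome := by
  obtain ⟨y | ⟨x, s⟩ | _, rfl⟩ := (isQuotientMap_mk f).surjective z
  · rfl
  · have hs : s ≠ 0 := by
      rintro rfl
      have : (1 / 3 : ℝ) < (0 : I) := hz
      norm_num at this
    simp [toBase, mk, hs]
  · have : (1 / 3 : ℝ) < (0 : I) := hz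
    norm_num at this

lemma isSome_toFib (z : Cof f) (hz : z ∈ low f ∩ high f) : (toFib f z).isSome := by
  obtain ⟨h2, h1⟩ := hz
  obtain ⟨y | ⟨x, s⟩ | _, rfl⟩ := (isQuotientMap_mk f).surjective z
  · have : ((1 : I) : ℝ) < 2 / 3 := h2
    norm_num at this
  · have hs : s ≠ 0 := by
      rintro rfl
      have : (1 / 3 : ℝ) < (0 : I) := h1
      norm_num at this
    have hs' : s ≠ 1 := by
      rintro rfl
      have : ((1 : I) : ℝ) < 2 / 3 := h2
      norm_num at this
    simp [toFib, mk, hs, hs']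
  · have : (1 / 3 : ℝ) < (0 : I) := h1
    norm_num at this

/-- The retraction of the neighbourhood of the base to the base. -/
def retrBase : TopCat.of (high f) ⟶ TopCat.of Y :=
  TopCat.ofHom (partialMap (toBase f) (isOpen_toBase f) (high f) (isSome_toBase f))

/-- The projection of the middle part of a mapping cone. -/
def retrFib : TopCat.of (low f ∩ high f : Set (Cof f)) ⟶ TopCat.of X :=
  TopCat.ofHom (partialMap (toFib f) (isOpen_toFib f) _ (isSome_toFib f))

lemma some_retrBase (z : high f) : some (retrBase f z : Y) = toBase f z :=
  some_partialMap (toBase f) (isOpen_toBase f) (high f) (isSome_toBase f) z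

lemma some_retrFib (z : (low f ∩ high f : Set (Cof f))) : some (retrFib f z : X) = toFib f z :=
  some_partialMap (toFib f) (isOpen_toFib f) _ (isSome_toFib f) z

/-- The function on the unit interval moving the neighbourhood of `1` to `1`. -/
def upFun : C(I, I) where
  toFun s := ⟨min 1 (3 * s), le_min zero_le_one (by have := s.2.1; positivity), min_le_left _ _⟩
  continuous_toFun := by fun_prop

/-- The function on the unit interval moving the neighbourhood of `0` to `0`. -/
def downFun : C(I, I) where
  toFun s := ⟨max 0 (3 * s - 2), le_max_left _ _, max_le zero_le_one (by linarith [s.2.2])⟩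
  continuous_toFun := by fun_prop

/-- The function on the unit interval moving the middle part to `1 / 2`. -/
def midFun : C(I, I) where
  toFun s := mix ⟨1 / 2, by norm_num, by norm_num⟩ (upFun s) (downFun s)
  continuous_toFun := by fun_prop

lemma upFun_zero : upFun 0 = 0 := Subtype.ext (by simp [upFun])
lemma upFun_one : upFun 1 = 1 := Subtype.ext (by simp [upFun])
lemma downFun_zero : downFun 0 = 0 := Subtype.ext (by simp [downFun])
lemma downFun_one : downFun 1 = 1 := Subtype.ext (by simp [downFun]; norm_num)
lemma midFun_zero : midFun 0 = 0 := by
  change mix _ (upFun 0) (downFun 0) = 0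
  rw [upFun_zero, downFun_zero, mix_self]
lemma midFun_one : midFun 1 = 1 := by
  change mix _ (upFun 1) (downFun 1) = 1
  rw [upFun_one, downFun_one, mix_self]

lemma upFun_of_mem {s : I} (hs : s ∈ highI) : upFun s = 1 :=
  Subtype.ext (min_eq_left (by have : (1 / 3 : ℝ) < s := hs; linarith))

lemma downFun_of_mem {s : I} (hs : s ∈ lowI) : downFun s = 0 :=
  Subtype.ext (max_eq_left (by have : (s : ℝ) < 2 / 3 := hs; linarith))

/-- The midpoint of the unit interval. -/
def half : I := ⟨1 / 2, by norm_num, by norm_num⟩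

lemma midFun_of_mem {s : I} (hs : s ∈ lowI ∩ highI) : midFun s = half := by
  change mix _ (upFun s) (downFun s) = _
  rw [upFun_of_mem hs.2, downFun_of_mem hs.1]
  exact Subtype.ext (by rw [coe_mix]; norm_num [half])

lemma mix_mem_lowI {s r : I} (hs : s ∈ lowI) (hr : r ∈ lowI) (τ : I) : mix τ s r ∈ lowI :=
  (convex_Iio (2 / 3 : ℝ)) hs hr (sub_nonneg.2 τ.2.2) τ.2.1 (by ring)

lemma mix_mem_highI {s r : I} (hs : s ∈ highI) (hr : r ∈ highI) (τ : I) : mix τ s r ∈ highI :=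
  (convex_Ioi (1 / 3 : ℝ)) hs hr (sub_nonneg.2 τ.2.2) τ.2.1 (by ring)

lemma zero_mem_lowI : (0 : I) ∈ lowI := show ((0 : I) : ℝ) < 2 / 3 by norm_num
lemma one_mem_highI : (1 : I) ∈ highI := show (1 / 3 : ℝ) < (1 : I) by norm_num
lemma half_mem : half ∈ lowI ∩ highI :=
  ⟨show (1 / 2 : ℝ) < 2 / 3 by norm_num, show (1 / 3 : ℝ) < 1 / 2 by norm_num⟩

/-- The function `upFun` has reached the value 1 at height 1/3, so deforming the heights along it
pushes this whole neighbourhood to the base. -/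
lemma quasiIso_retrBase : QuasiIso (singChains.map (retrBase f)) := by
  let j : TopCat.of Y ⟶ TopCat.of (high f) := TopCat.ofHom
    ⟨fun y => ⟨mk f (Sum.inl y), one_mem_highI⟩, by
      exact ((isQuotientMap_mk f).continuous.comp continuous_inl).subtype_mk _⟩
  refine singChains_quasiIso_of_deform f upFun upFun_zero upFun_one (fun s hs τ => ?_)
    (retrBase f) j ?_ ?_
  · rw [upFun_of_mem hs]
    exact mix_mem_highI hs one_mem_highI τ
  · ext y
    exact Option.some_injective _ (some_retrBase f (j y))
  · suffices key : ∀ z ∈ high f, ∀ y', some y' = toBase f z →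
        deform f upFun upFun_zero upFun_one (z, 1) = mk f (Sum.inl y') from
      fun z => key z z.2 _ (some_retrBase f z)
    intro z hz y' h
    obtain ⟨y | ⟨x, s⟩ | _, rfl⟩ := (isQuotientMap_mk f).surjective z
    · obtain rfl : y' = y := Option.some_injective _ h
      rfl
    · have hs : s ≠ 0 := by
        rintro rfl
        simp [toBase, mk] at h
      obtain rfl : y' = f x := by simpa [toBase, mk, hs] using h
      rw [deform_inr_inl, mix_one, upFun_of_mem (s := s) hz, mk_base]
    · simp [toBase, mk] at h

/-- At heights between 1/3 and 2/3 both `upFun` and `downFun` are constant, with values 1 and 0.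
Their mean `midFun` therefore collapses the middle part to the slice of `X` at height 1/2, while
still fixing 0 and 1 so that it deforms the whole cone. -/
lemma quasiIso_retrFib : QuasiIso (singChains.map (retrFib f)) := by
  let j : TopCat.of X ⟶ TopCat.of (region f (lowI ∩ highI)) := TopCat.ofHom
    ⟨fun x => ⟨mk f (Sum.inr (Sum.inl (x, half))), half_mem⟩, by
      exact ((isQuotientMap_mk f).continuous.comp (by fun_prop)).subtype_mk _⟩
  refine singChains_quasiIso_of_deform f midFun midFun_zero midFun_one (A := lowI ∩ highI)
    (fun s hs τ => ?_) (retrFib f) j ?_ ?_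
  · rw [midFun_of_mem hs]
    exact ⟨mix_mem_lowI hs.1 half_mem.1 τ, mix_mem_highI hs.2 half_mem.2 τ⟩
  · ext x
    refine Option.some_injective _ ((some_retrFib f (j x)).trans ?_)
    have h0 : half ≠ 0 := fun h => by simpa [half] using congrArg Subtype.val h
    have h1 : half ≠ 1 := fun h => by
      have := congrArg Subtype.val h
      norm_num [half] at this
    change (if half = 0 ∨ half = 1 then none else some x) = _
    simp [h0, h1]
  · suffices key : ∀ z ∈ low f ∩ high f, ∀ x', some x' = toFib f z →
        deform f midFun midFun_zero midFun_one (z, 1) = mk f (Sum.inr (Sum.inl (x', half))) from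
      fun z => key z z.2 _ (some_retrFib f z)
    intro z hz x' h
    obtain ⟨y | ⟨x, s⟩ | _, rfl⟩ := (isQuotientMap_mk f).surjective z
    · simp [toFib, mk] at h
    · have hs : ¬ (s = 0 ∨ s = 1) := by
        rintro hs
        simp [toFib, mk, hs] at h
      obtain rfl : x' = x := by simpa [toFib, mk, hs] using h
      rw [deform_inr_inl, mix_one, midFun_of_mem (s := s) hz]
    · simp [toFib, mk] at h

/-- Heights below 2/3 are sent to 0 by `downFun`, so the deformation ends at the apex, which exists
even if `X` is empty. -/
instance : ContractibleSpace (low f) := by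
  rw [contractible_iff_id_nullhomotopic]
  refine ⟨⟨mk f (Sum.inr (Sum.inr PUnit.unit)), zero_mem_lowI⟩, ⟨?_⟩⟩
  exact
    { toFun := fun p => ⟨deform f downFun downFun_zero downFun_one (p.2.1, p.1), by
        change height f _ ∈ lowI
        have hp : height f p.2.1 ∈ lowI := p.2.2
        rw [height_deform, downFun_of_mem hp]
        exact mix_mem_lowI hp zero_mem_lowI _⟩
      continuous_toFun := by fun_prop
      map_zero_left := fun z => Subtype.ext (deform_zero f _ _ _ z)
      map_one_left := fun z => Subtype.ext (by
        obtain ⟨z, hz⟩ := z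
        change deform f _ _ _ (z, 1) = mk f (Sum.inr (Sum.inr PUnit.unit))
        obtain ⟨y | ⟨x, s⟩ | _, rfl⟩ := (isQuotientMap_mk f).surjective z
        · have : ((1 : I) : ℝ) < 2 / 3 := hz
          norm_num at this
        · rw [deform_inr_inl, mix_one, downFun_of_mem (s := s) hz, mk_apex]
        · rfl) }

/-- The segment over a point of `X` joins the apex to the base; this is the use of nonemptiness. -/
instance [Nonempty X] [PathConnectedSpace Y] : PathConnectedSpace (Cof f) := by
  have hj : Continuous fun y => mk f (Sum.inl y) :=
    (isQuotientMap_mk f).continuous.comp continuous_inl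
  have hpath (x : X) (s s' : I) : Joined (mk f (Sum.inr (Sum.inl (x, s))))
      (mk f (Sum.inr (Sum.inl (x, s')))) := by
    have hc : Continuous fun s => mk f (Sum.inr (Sum.inl (x, s))) :=
      (isQuotientMap_mk f).continuous.comp (by fun_prop)
    have : PathConnectedSpace I := isPathConnected_iff_pathConnectedSpace.1
      ((convex_Icc 0 1).isPathConnected ⟨0, unitInterval.zero_mem⟩)
    exact (PathConnectedSpace.joined s s').map hc
  let y₀ : Y := Classical.arbitrary Y
  have hbase (y : Y) : Joined (mk f (Sum.inl y)) (mk f (Sum.inl y₀)) :=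
    (PathConnectedSpace.joined y y₀).map hj
  have key (z : Cof f) : Joined z (mk f (Sum.inl y₀)) := by
    obtain ⟨y | ⟨x, s⟩ | _, rfl⟩ := (isQuotientMap_mk f).surjective z
    · exact hbase y
    · have := hpath x s 1
      rw [mk_base] at this
      exact this.trans (hbase _)
    · have := hpath (Classical.arbitrary X) 0 1
      rw [mk_base, mk_apex] at this
      exact this.trans (hbase _)
  exact ⟨⟨mk f (Sum.inl y₀)⟩, fun z z' => (key z).trans (key z').symm⟩

/-! ### Compatibility of heights and coordinates with maps of cones. -/

section Map

variable {f} {f' : C(X', Y')} (a : C(X, X')) (b : C(Y, Y')) (h : b.comp f = f'.comp a)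

lemma height_map (z : Cof f) : height f' (Cof.map a b h z) = height f z := by
  obtain ⟨y | ⟨x, s⟩ | _, rfl⟩ := (isQuotientMap_mk f).surjective z <;> rfl

lemma toBase_map (z : Cof f) : toBase f' (Cof.map a b h z) = (toBase f z).map b := by
  obtain ⟨y | ⟨x, s⟩ | _, rfl⟩ := (isQuotientMap_mk f).surjective z
  · rfl
  · change (if s = 0 then none else some (f' (a x))) =
      (if s = 0 then none else some (f x)).map b
    split_ifs
    · rfl
    · exact congrArg some (DFunLike.congr_fun h x).symm
  · rfl

lemma toFib_map (z : Cof f) : toFib f' (Cof.map a b h z) = (toFib f z).map a := by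
  obtain ⟨y | ⟨x, s⟩ | _, rfl⟩ := (isQuotientMap_mk f).surjective z
  · rfl
  · change (if s = 0 ∨ s = 1 then none else some (a x)) =
      (if s = 0 ∨ s = 1 then none else some x).map a
    split_ifs <;> rfl
  · rfl

lemma map_mem_low {z : Cof f} (hz : z ∈ low f) : Cof.map a b h z ∈ low f' := by
  change height f' _ ∈ lowI
  rw [height_map]
  exact hz

lemma map_mem_high {z : Cof f} (hz : z ∈ high f) : Cof.map a b h z ∈ high f' := by
  change height f' _ ∈ highI
  rw [height_map]
  exact hz

end Map

end Cof

/-! ### Relative singular chains of a map. -/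

section Pairs

variable {A B A' B' A'' B'' : TopCat.{u}}

/-- The relative singular chain complex of a map. -/
abbrev relSing (i : A ⟶ B) : ChainComplex (ModuleCat.{u} ℤ) ℕ := relChains (sing.map i)

/-- The map of relative singular chain complexes induced by a commutative square. -/
abbrev relSingMap (i : A ⟶ B) (i' : A' ⟶ B') (f : A ⟶ A') (g : B ⟶ B') (h : i ≫ g = f ≫ i') :
    relSing i ⟶ relSing i' :=
  relChainsMap _ _ (sing.map f) (sing.map g) (by rw [← Functor.map_comp, ← Functor.map_comp, h])

lemma relSingMap_comp (i : A ⟶ B) (i' : A' ⟶ B') (i'' : A'' ⟶ B'') (f : A ⟶ A') (g : B ⟶ B')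
    (h : i ≫ g = f ≫ i') (f' : A' ⟶ A'') (g' : B' ⟶ B'') (h' : i' ≫ g' = f' ≫ i'') :
    relSingMap i i' f g h ≫ relSingMap i' i'' f' g' h' =
      relSingMap i i'' (f ≫ f') (g ≫ g') (by
        rw [← Category.assoc, h, Category.assoc, h', Category.assoc]) :=
  relChainsMap_comp _ _ _ _ _ _ _ _ _

/-- The restriction of a map to subspaces. -/
def resMap (F : A ⟶ B) {D : Set A} {D' : Set B} (h : ∀ z ∈ D, F z ∈ D') :
    TopCat.of D ⟶ TopCat.of D' :=
  TopCat.ofHom ⟨fun z => ⟨F z, h z z.2⟩, (F.hom.continuous.comp continuous_subtype_val).subtype_mk _⟩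

end Pairs

/-! ### The cone of an injective map and relative homology. -/

namespace Cof

variable (f : C(X, Y))

/-- The inclusion of the middle part of a mapping cone in the neighbourhood of the base. -/
abbrev midIncl : TopCat.of (low f ∩ high f : Set (TopCat.of (Cof f))) ⟶ TopCat.of (high f) :=
  inclMap (X := TopCat.of (Cof f)) (Set.inter_subset_right : low f ∩ high f ⊆ high f)

/-- The inclusion of the neighbourhood of the apex of a mapping cone. -/
abbrev lowIncl : TopCat.of (low f) ⟶ TopCat.of (Cof f) := subMap (X := TopCat.of (Cof f)) (low f)

lemma midIncl_retrBase : midIncl f ≫ retrBase f = retrFib f ≫ TopCat.ofHom f := by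
  suffices key : ∀ z ∈ low f ∩ high f, ∀ y x, some y = toBase f z → some x = toFib f z →
      y = f x by
    ext z
    exact key z.1 z.2 _ _ (some_retrBase f (midIncl f z)) (some_retrFib f z)
  intro z hz y x h h'
  obtain ⟨y' | ⟨x', s⟩ | _, rfl⟩ := (isQuotientMap_mk f).surjective z
  · simp [toFib, mk] at h'
  · have hs : ¬ (s = 0 ∨ s = 1) := by
      rintro hs
      simp [toFib, mk, hs] at h'
    have hs0 : s ≠ 0 := fun hs0 => hs (Or.inl hs0)
    obtain rfl : x = x' := by simpa [toFib, mk, hs] using h'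
    simpa [toBase, mk, hs0] using h
  · simp [toFib, mk] at h'

/-- The comparison of the pair given by the middle part of a mapping cone with the original
map. -/
abbrev retrMap : relSing (midIncl f) ⟶ relSing (TopCat.ofHom f) :=
  relSingMap _ _ (retrFib f) (retrBase f) (midIncl_retrBase f)

/-- The excision map of a mapping cone. -/
abbrev excMap : relSing (midIncl f) ⟶ relSing (lowIncl f) :=
  excisionMap (X := TopCat.of (Cof f)) (low f) (high f)

/-- The map from the absolute to the relative singular chains of a mapping cone. -/
abbrev toRel : singChains.obj (TopCat.of (Cof f)) ⟶ relSing (lowIncl f) :=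
  Limits.cokernel.π (singChains.map (lowIncl f))

/-- The inclusion of the middle part models `f` up to homotopy equivalence at both ends. Injectivity
of `f` is needed for the cokernel of its chain map to fit in a short exact sequence. -/
lemma quasiIso_retrMap (hf : Function.Injective f) : QuasiIso (retrMap f) :=
  relChainsMap_quasiIso _ _ _ _ (by
      rw [← Functor.map_comp, ← Functor.map_comp, midIncl_retrBase])
    (sing_map_injective (midIncl f) (Set.inclusion_injective Set.inter_subset_right))
    (sing_map_injective _ hf) (quasiIso_retrFib f) (quasiIso_retrBase f)

lemma quasiIso_excMap : QuasiIso (excMap f) :=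
  excisionMap_quasiIso (X := TopCat.of (Cof f)) (isOpen_low f) (isOpen_high f) (low_union_high f)

instance (n : ℕ) : IsIso (HomologicalComplex.homologyMap (toRel f) (n + 1)) :=
  isIso_homologyMap_cokernel_π _ (sing_map_injective _ Subtype.val_injective)
    (sing_acyclic (TopCat.of (low f))) n

/-- The reduced homology of the mapping cone of an injective map is the relative homology. -/
def relIso (hf : Function.Injective f) (n : ℕ) :
    (relSing (TopCat.ofHom f)).homology (n + 1) ≅ reducedH (n + 1) (TopCat.of (Cof f)) :=
  have := quasiIso_retrMap f hf
  have := quasiIso_excMap f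
  (asIso (HomologicalComplex.homologyMap (retrMap f) (n + 1))).symm ≪≫
    asIso (HomologicalComplex.homologyMap (excMap f) (n + 1)) ≪≫
    (asIso (HomologicalComplex.homologyMap (toRel f) (n + 1))).symm ≪≫
    (reducedHIso n (TopCat.of (Cof f))).symm

/-- A description of `relIso` free of inverses. The outer maps are isomorphisms, so the equation
determines it, and naturality can be verified after composing with them. -/
lemma relIso_spec (hf : Function.Injective f) (n : ℕ) :
    HomologicalComplex.homologyMap (retrMap f) (n + 1) ≫ (relIso f hf n).hom ≫
      (reducedHIso n (TopCat.of (Cof f))).hom ≫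
        HomologicalComplex.homologyMap (toRel f) (n + 1) =
      HomologicalComplex.homologyMap (excMap f) (n + 1) := by
  have := quasiIso_retrMap f hf
  simp only [relIso, Iso.trans_hom, Iso.symm_hom, asIso_hom, asIso_inv, Category.assoc,
    Iso.inv_hom_id_assoc, IsIso.inv_hom_id, Category.comp_id, IsIso.hom_inv_id_assoc]

variable {f} {f' : C(X', Y')} (a : C(X, X')) (b : C(Y, Y'))

lemma ofHom_comm (h : b.comp f = f'.comp a) : TopCat.ofHom f ≫ TopCat.ofHom b = TopCat.ofHom a ≫ TopCat.ofHom f' := by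
  rw [← TopCat.ofHom_comp, h, TopCat.ofHom_comp]

/-- The map of cones preserves heights, so it restricts to the pieces of the cover and commutes
strictly with retractions and inclusions. On homology the first map of the zigzag is epi and the
last two are mono, so they can be cancelled to reach squares of chain maps. -/
lemma relIso_naturality (h : b.comp f = f'.comp a) (hf : Function.Injective f) (hf' : Function.Injective f') (n : ℕ) :
    HomologicalComplex.homologyMap (relSingMap (TopCat.ofHom f) (TopCat.ofHom f') (TopCat.ofHom a)
      (TopCat.ofHom b) (ofHom_comm a b h)) (n + 1) ≫ (relIso f' hf' n).hom =
      (relIso f hf n).hom ≫ reducedHMap (n + 1) (TopCat.ofHom (Cof.map a b h)) := by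
  let F : TopCat.of (Cof f) ⟶ TopCat.of (Cof f') := TopCat.ofHom (Cof.map a b h)
  let FU : TopCat.of (low f) ⟶ TopCat.of (low f') := resMap F fun z => map_mem_low a b h
  let FV : TopCat.of (high f) ⟶ TopCat.of (high f') := resMap F fun z => map_mem_high a b h
  let FW : TopCat.of (low f ∩ high f : Set (TopCat.of (Cof f))) ⟶
      TopCat.of (low f' ∩ high f' : Set (TopCat.of (Cof f'))) :=
    resMap F fun z hz => ⟨map_mem_low a b h hz.1, map_mem_high a b h hz.2⟩
  have hX : FW ≫ retrFib f' = retrFib f ≫ TopCat.ofHom a := by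
    ext z
    refine Option.some_injective _ ((some_retrFib f' (FW z)).trans ((toFib_map a b h z.1).trans ?_))
    rw [← some_retrFib f z]
    rfl
  have hY : FV ≫ retrBase f' = retrBase f ≫ TopCat.ofHom b := by
    ext z
    refine Option.some_injective _ ((some_retrBase f' (FV z)).trans
      ((toBase_map a b h z.1).trans ?_))
    rw [← some_retrBase f z]
    rfl
  have hW : midIncl f ≫ FV = FW ≫ midIncl f' := rfl
  let mW : relSing (midIncl f) ⟶ relSing (midIncl f') := relSingMap _ _ FW FV hW
  let mU : relSing (lowIncl f) ⟶ relSing (lowIncl f') := relSingMap _ _ FU F rfl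
  have h1 : mW ≫ retrMap f' = retrMap f ≫ relSingMap (TopCat.ofHom f) (TopCat.ofHom f')
      (TopCat.ofHom a) (TopCat.ofHom b) (ofHom_comm a b h) := by
    rw [relSingMap_comp (h := hW), relSingMap_comp]
    congr 1
  have h2 : mW ≫ excMap f' = excMap f ≫ mU := by
    have hE : midIncl f ≫ subMap (X := TopCat.of (Cof f)) (high f) =
      inclMap (X := TopCat.of (Cof f)) Set.inter_subset_left ≫ lowIncl f := rfl
    have hE' : midIncl f' ≫ subMap (X := TopCat.of (Cof f')) (high f') =
      inclMap (X := TopCat.of (Cof f')) Set.inter_subset_left ≫ lowIncl f' := rfl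
    have hU : lowIncl f ≫ F = FU ≫ lowIncl f' := rfl
    exact (relSingMap_comp (h := hW) (h' := hE')).trans
      (relSingMap_comp (h := hE) (h' := hU)).symm
  have h3 : singChains.map F ≫ toRel f' = toRel f ≫ mU := (Limits.cokernel.π_desc _ _ _).symm
  have h4 : reducedHMap (n + 1) F ≫ (reducedHIso n (TopCat.of (Cof f'))).hom ≫
      HomologicalComplex.homologyMap (toRel f') (n + 1) =
      (reducedHIso n (TopCat.of (Cof f))).hom ≫ HomologicalComplex.homologyMap (toRel f) (n + 1) ≫
        HomologicalComplex.homologyMap mU (n + 1) := by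
    rw [← Category.assoc, reducedHIso_naturality, Category.assoc,
      ← HomologicalComplex.homologyMap_comp, h3, HomologicalComplex.homologyMap_comp]
  have := quasiIso_retrMap f hf
  rw [← cancel_epi (HomologicalComplex.homologyMap (retrMap f) (n + 1)),
    ← HomologicalComplex.homologyMap_comp_assoc, ← h1, HomologicalComplex.homologyMap_comp_assoc,
    ← cancel_mono (reducedHIso n (TopCat.of (Cof f'))).hom,
    ← cancel_mono (HomologicalComplex.homologyMap (toRel f') (n + 1))]
  simp only [Category.assoc]
  rw [relIso_spec, h4, ← HomologicalComplex.homologyMap_comp, h2,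
    HomologicalComplex.homologyMap_comp, ← relIso_spec f hf n]
  simp only [Category.assoc]

end Cof

end ConeHomology

/-! ### The universal bundle -/

section Universal

/-- The disjoint union of the spaces `Δ^n × S^(n+1)`, for a discrete set `S`. -/
abbrev PreEG (S : Type u) : Type u :=
  Σ x : (Σ n : ℕ, (Fin (n + 1) → S)), stdSimplex ℝ (Fin (x.1 + 1))

/-- The face relation between simplices with vertices in a set. -/
inductive EGRel (S : Type u) : PreEG S → PreEG S → Prop
  | face (n : ℕ) (i : Fin (n + 2)) (v : Fin (n + 2) → S) (t : Simp n) :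
      EGRel S ⟨⟨n + 1, v⟩, faceIncl i t⟩ ⟨⟨n, v ∘ i.succAbove⟩, t⟩

/-- The geometric realization of the semisimplicial set of tuples of elements of a set. -/
def EG (S : Type u) : Type u := Quot (EGRel S)

namespace EG

variable {S S' : Type u} {G G' : Type u} [Group G] [Group G']

instance : TopologicalSpace (EG S) := inferInstanceAs (TopologicalSpace (Quot (EGRel S)))

/-- The point of a simplex with given vertices. -/
def mk {n : ℕ} (v : Fin (n + 1) → S) (t : Simp n) : EG S := Quot.mk _ ⟨⟨n, v⟩, t⟩

lemma mk_face {n : ℕ} (i : Fin (n + 2)) (v : Fin (n + 2) → S) (t : Simp n) :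
    mk v (faceIncl i t) = mk (v ∘ i.succAbove) t :=
  Quot.sound (EGRel.face n i v t)

lemma exists_mk (x : EG S) : ∃ (n : ℕ) (v : Fin (n + 1) → S) (t : Simp n), mk v t = x := by
  obtain ⟨⟨⟨n, v⟩, t⟩, rfl⟩ := Quot.exists_rep x
  exact ⟨n, v, t, rfl⟩

lemma continuous_mk {n : ℕ} (v : Fin (n + 1) → S) : Continuous (mk v) :=
  continuous_quot_mk.comp (continuous_sigmaMk (σ := fun x : (Σ n : ℕ, (Fin (n + 1) → S)) =>
    stdSimplex ℝ (Fin (x.1 + 1))) (i := ⟨n, v⟩))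

/-- A function on `EG S` given on each simplex, compatibly with the faces. -/
def lift {T : Type v} (F : ∀ (n : ℕ), (Fin (n + 1) → S) → Simp n → T)
    (hF : ∀ (n : ℕ) (i : Fin (n + 2)) (v : Fin (n + 2) → S) (t : Simp n),
      F (n + 1) v (faceIncl i t) = F n (v ∘ i.succAbove) t) : EG S → T :=
  Quot.lift (fun p => F p.1.1 p.1.2 p.2) (by
    rintro _ _ ⟨n, i, v, t⟩
    exact hF n i v t)

lemma continuous_lift {T : Type v} [TopologicalSpace T]
    (F : ∀ (n : ℕ), (Fin (n + 1) → S) → Simp n → T)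
    (hF : ∀ (n : ℕ) (i : Fin (n + 2)) (v : Fin (n + 2) → S) (t : Simp n),
      F (n + 1) v (faceIncl i t) = F n (v ∘ i.succAbove) t)
    (hc : ∀ (n : ℕ) (v : Fin (n + 1) → S), Continuous (F n v)) : Continuous (lift F hF) :=
  continuous_quot_lift _ (continuous_sigma fun x => hc x.1 x.2)

/-- The map induced by a map of vertices. -/
def map (g : S → S') : C(EG S, EG S') where
  toFun := lift (fun _ v t => mk (g ∘ v) t) fun _ i v t => mk_face i (g ∘ v) t
  continuous_toFun := continuous_lift _ _ fun _ v => continuous_mk (g ∘ v)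

lemma map_mk (g : S → S') {n : ℕ} (v : Fin (n + 1) → S) (t : Simp n) :
    map g (mk v t) = mk (g ∘ v) t := rfl

/-- The vertices of the face spanned by a point. -/
def supp : EG S → Set S :=
  lift (fun _ v t => {s | ∃ j, v j = s ∧ t j ≠ 0}) fun n i v t => by
    ext s
    constructor
    · rintro ⟨j, rfl, hj⟩
      obtain rfl | ⟨k, rfl⟩ := Fin.eq_self_or_eq_succAbove i j
      · exact absurd (faceIncl_self _ t) hj
      · exact ⟨k, rfl, by rwa [faceIncl_succAbove] at hj⟩
    · rintro ⟨k, rfl, hk⟩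
      exact ⟨i.succAbove k, rfl, by rwa [faceIncl_succAbove]⟩

lemma supp_nonempty (x : EG S) : (supp x).Nonempty := by
  obtain ⟨n, v, t, rfl⟩ := exists_mk x
  have h : ∃ j, t j ≠ 0 := by
    by_contra! h
    have := stdSimplex.sum_eq_one t
    simp [h] at this
  obtain ⟨j, hj⟩ := h
  exact ⟨v j, j, rfl, hj⟩

lemma supp_map (g : S → S') (x : EG S) : supp (map g x) = g '' supp x := by
  obtain ⟨n, v, t, rfl⟩ := exists_mk x
  ext s
  constructor
  · rintro ⟨j, rfl, hj⟩
    exact ⟨v j, ⟨j, rfl, hj⟩, rfl⟩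
  · rintro ⟨_, ⟨j, rfl, hj⟩, rfl⟩
    exact ⟨j, rfl, hj⟩

/-! #### Contractibility -/

/-- The point `(τ, (1 - τ) t)` of the cone over a simplex. -/
def coneSimp {n : ℕ} : C(Simp n × unitInterval, Simp (n + 1)) where
  toFun p := ⟨Fin.cons (p.2 : ℝ) fun k => (1 - p.2) * p.1 k, by
    refine ⟨fun j => ?_, ?_⟩
    · refine Fin.cases ?_ (fun j => ?_) j
      · exact p.2.2.1
      · exact mul_nonneg (sub_nonneg.2 p.2.2.2) (p.1.2.1 j)
    · rw [Fin.sum_univ_succ]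
      simp only [Fin.cons_zero, Fin.cons_succ]
      rw [← Finset.mul_sum, stdSimplex.sum_eq_one]
      ring⟩
  continuous_toFun := by
    refine Continuous.subtype_mk (continuous_pi fun j => ?_) _
    refine Fin.cases ?_ (fun j => ?_) j
    · simp only [Fin.cons_zero]
      fun_prop
    · simp only [Fin.cons_succ]
      have : Continuous fun p : Simp n × unitInterval => p.1 j :=
        (continuous_apply j).comp (continuous_subtype_val.comp continuous_fst)
      fun_prop

@[simp]
lemma coneSimp_zero {n : ℕ} (t : Simp n) (τ : unitInterval) : coneSimp (t, τ) 0 = τ := rfl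

@[simp]
lemma coneSimp_succ {n : ℕ} (t : Simp n) (τ : unitInterval) (k : Fin (n + 1)) :
    coneSimp (t, τ) k.succ = (1 - τ) * t k := rfl

lemma coneSimp_face {n : ℕ} (i : Fin (n + 2)) (t : Simp n) (τ : unitInterval) :
    coneSimp (faceIncl i t, τ) = faceIncl i.succ (coneSimp (t, τ)) := by
  ext j
  obtain rfl | ⟨k, rfl⟩ := Fin.eq_self_or_eq_succAbove i.succ j
  · rw [coneSimp_succ, faceIncl_self, faceIncl_self, mul_zero]
  · rw [faceIncl_succAbove]
    refine Fin.cases ?_ (fun k => ?_) k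
    · rw [Fin.succ_succAbove_zero, coneSimp_zero, coneSimp_zero]
    · rw [Fin.succ_succAbove_succ, coneSimp_succ, coneSimp_succ, faceIncl_succAbove]

lemma coneSimp_at_zero {n : ℕ} (t : Simp n) : coneSimp (t, 0) = faceIncl 0 t := by
  ext j
  refine Fin.cases ?_ (fun j => ?_) j
  · simp
  · rw [coneSimp_succ, ← Fin.zero_succAbove, faceIncl_succAbove]
    simp

lemma coneSimp_at_one {n : ℕ} (t : Simp n) : coneSimp (t, 1) = verts (n + 1) 0 := by
  ext j
  refine Fin.cases ?_ (fun j => ?_) j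
  · simp [verts]
  · simp [verts]

lemma mk_vertex_zero : ∀ {n : ℕ} (v : Fin (n + 1) → S),
    mk v (verts n 0) = mk (n := 0) (fun _ => v 0) default
  | 0, v => by
    have h : verts 0 0 = default := Subsingleton.elim _ _
    rw [h]
    congr 1
    funext j
    rw [Subsingleton.elim (α := Fin 1) j 0]
  | n + 1, v => by
    have h : verts (n + 1) 0 = faceIncl (Fin.last (n + 1)) (verts n 0) := by
      ext j
      refine Fin.lastCases ?_ (fun j => ?_) j
      · simp [verts]
      · rw [← Fin.succAbove_last_apply, faceIncl_succAbove]
        change (Pi.single 0 1 : Fin (n + 2) → ℝ) ((Fin.last (n + 1)).succAbove j) =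
          (Pi.single 0 1 : Fin (n + 1) → ℝ) j
        rw [Pi.single_apply, Pi.single_apply, Fin.succAbove_last_apply]
        exact if_congr (by rw [Fin.ext_iff, Fin.ext_iff]; rfl) rfl rfl
    rw [h, mk_face, mk_vertex_zero]
    congr 1

/-- The contraction to a vertex, curried. -/
def contractCurried (b : S) : C(EG S, C(unitInterval, EG S)) where
  toFun := lift (fun n v t => ⟨fun τ => mk (Fin.cons b v : Fin (n + 2) → S) (coneSimp (t, τ)),
      (continuous_mk _).comp (by fun_prop)⟩) (by
    intro n i v t
    ext τ
    change mk _ _ = mk _ _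
    rw [coneSimp_face, mk_face, cons_comp_succ_succAbove])
  continuous_toFun := continuous_lift _ _ fun n v =>
    (ContinuousMap.curry (X := Simp n) (Y := unitInterval) ⟨fun q =>
      mk (Fin.cons b v : Fin (n + 2) → S) (coneSimp q), (continuous_mk _).comp (by fun_prop)⟩).continuous

/-- Repeated entries are allowed in a simplex, so a fixed vertex `b` can be prepended to every
tuple. Raising its coordinate from 0 to 1 contracts the space to `b`, compatibly with all faces. -/
instance [Nonempty S] : ContractibleSpace (EG S) := by
  rw [contractible_iff_id_nullhomotopic]
  let b : S := Classical.arbitrary S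
  refine ⟨mk (n := 0) (fun _ => b) default, ⟨?_⟩⟩
  exact
    { toFun := fun p => (contractCurried b).uncurry (p.2, p.1)
      continuous_toFun := by fun_prop
      map_zero_left := fun x => by
        obtain ⟨n, v, t, rfl⟩ := exists_mk x
        change mk (Fin.cons b v : Fin (n + 2) → S) (coneSimp (t, 0)) = mk v t
        rw [coneSimp_at_zero, mk_face]
        congr 1
      map_one_left := fun x => by
        obtain ⟨n, v, t, rfl⟩ := exists_mk x
        change mk (Fin.cons b v : Fin (n + 2) → S) (coneSimp (t, 1)) = _
        rw [coneSimp_at_one, mk_vertex_zero]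
        rfl }

/-! #### The group action -/

instance : MulAction G (EG G) where
  smul g := map (g * ·)
  one_smul x := by
    obtain ⟨n, v, t, rfl⟩ := exists_mk x
    change mk _ _ = mk _ _
    congr 1
    funext j
    exact one_mul _
  mul_smul g h x := by
    obtain ⟨n, v, t, rfl⟩ := exists_mk x
    change mk _ _ = mk _ _
    congr 1
    funext j
    exact mul_assoc _ _ _

lemma smul_mk (g : G) {n : ℕ} (v : Fin (n + 1) → G) (t : Simp n) :
    g • mk v t = mk (fun j => g * v j) t := rfl

lemma map_smul (φ : G →* G') (g : G) (x : EG G) : map φ (g • x) = φ g • map φ x := by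
  obtain ⟨n, v, t, rfl⟩ := exists_mk x
  rw [smul_mk, map_mk, map_mk, smul_mk]
  congr 1
  funext j
  exact _root_.map_mul φ _ _

/-- The quotients of successive entries of a tuple. -/
def quots {n : ℕ} (v : Fin (n + 1) → G) : Fin n → G := fun k => (v k.castSucc)⁻¹ * v k.succ

/-- Omitting an inner entry multiplies the adjacent quotients, as `(a⁻¹ b)(b⁻¹ c) = a⁻¹ c`. So the
bar faces are just omission of entries in homogeneous coordinates. -/
lemma barFace_quots {n : ℕ} (i : Fin (n + 2)) (v : Fin (n + 2) → G) :
    barFace i (quots v) = quots (v ∘ i.succAbove) := by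
  funext k
  simp only [barFace, quots, Function.comp_apply]
  split_ifs with h1 h2
  · congr 3 <;> simp only [Fin.ext_iff, Fin.succAbove, Fin.lt_def] <;> split_ifs <;>
      simp_all <;> lia
  · rw [Fin.succ_castSucc, mul_assoc, mul_inv_cancel_left]
    congr 3 <;> simp only [Fin.ext_iff, Fin.succAbove, Fin.lt_def] <;> split_ifs <;>
      simp_all <;> lia
  · congr 3 <;> simp only [Fin.ext_iff, Fin.succAbove, Fin.lt_def] <;> split_ifs <;>
      simp_all <;> lia

lemma quots_comp (φ : G →* G') {n : ℕ} (v : Fin (n + 1) → G) : quots (φ ∘ v) = φ ∘ quots v := by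
  funext k
  simp [quots]

lemma quots_partialProd {n : ℕ} (x : Fin n → G) : quots (Fin.partialProd x) = x :=
  funext fun k => Fin.partialProd_right_inv x k

lemma exists_mul_of_quots_eq {n : ℕ} {v w : Fin (n + 1) → G} (h : quots v = quots w) :
    ∃ g : G, w = fun j => g * v j := by
  refine ⟨w 0 * (v 0)⁻¹, funext fun j => ?_⟩
  induction j using Fin.induction with
  | zero => rw [inv_mul_cancel_right]
  | succ k ih =>
    have hk := congrFun h k
    simp only [quots] at hk
    rw [inv_mul_eq_iff_eq_mul] at hk
    rw [hk, ← mul_assoc, ← ih, mul_inv_cancel_left]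

lemma quots_mul {n : ℕ} (g : G) (v : Fin (n + 1) → G) : quots (fun j => g * v j) = quots v := by
  funext k
  simp [quots, mul_assoc]

/-- The point of `BG` in a given simplex. -/
def mkBG {n : ℕ} (x : Fin n → G) (t : Simp n) : BG G := Quot.mk _ ⟨⟨n, x⟩, t⟩

lemma mkBG_face {n : ℕ} (i : Fin (n + 2)) (x : Fin (n + 1) → G) (t : Simp n) :
    mkBG x (faceIncl i t) = mkBG (barFace i x) t :=
  Quot.sound (BGRel.face n i x t)

lemma continuous_mkBG {n : ℕ} (x : Fin n → G) : Continuous (mkBG x) :=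
  continuous_quot_mk.comp (continuous_sigmaMk (σ := fun x : (Σ n : ℕ, (Fin n → G)) =>
    stdSimplex ℝ (Fin (x.1 + 1))) (i := ⟨n, x⟩))

lemma bgMap_mkBG (φ : G →* G') {n : ℕ} (x : Fin n → G) (t : Simp n) :
    BG.map φ (mkBG x t) = mkBG (φ ∘ x) t := rfl

variable (G) in
/-- The projection `EG → BG`. -/
def proj : C(EG G, BG G) where
  toFun := lift (fun _ v t => mkBG (quots v) t) fun _ i v t => by rw [mkBG_face, barFace_quots]
  continuous_toFun := continuous_lift _ _ fun _ v => continuous_mkBG (quots v)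

lemma proj_mk {n : ℕ} (v : Fin (n + 1) → G) (t : Simp n) : proj G (mk v t) = mkBG (quots v) t := rfl

lemma proj_map (φ : G →* G') (x : EG G) : proj G' (map φ x) = BG.map φ (proj G x) := by
  obtain ⟨n, v, t, rfl⟩ := exists_mk x
  rw [map_mk, proj_mk, proj_mk, bgMap_mkBG, quots_comp]

lemma proj_smul (g : G) (x : EG G) : proj G (g • x) = proj G x := by
  obtain ⟨n, v, t, rfl⟩ := exists_mk x
  rw [smul_mk, proj_mk, proj_mk, quots_mul]

variable (G) in
-- Partial products give a continuous section of the projection between the disjoint unions of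
-- simplices. They do not respect face 0, so the section does not descend, but a quotient map before
-- identification is enough.
lemma isQuotientMap_proj : Topology.IsQuotientMap (proj G) := by
  let pre : PreEG G → PreBG G := fun p => ⟨⟨p.1.1, quots p.1.2⟩, p.2⟩
  let sec : PreBG G → PreEG G := fun p => ⟨⟨p.1.1, Fin.partialProd p.1.2⟩, p.2⟩
  have h1 : Continuous pre := continuous_sigma fun x =>
    continuous_sigmaMk (σ := fun x : (Σ n : ℕ, (Fin n → G)) => stdSimplex ℝ (Fin (x.1 + 1)))
      (i := ⟨x.1, quots x.2⟩)
  have h2 : Continuous sec := continuous_sigma fun x =>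
    continuous_sigmaMk (σ := fun x : (Σ n : ℕ, (Fin (n + 1) → G)) =>
      stdSimplex ℝ (Fin (x.1 + 1))) (i := ⟨x.1, Fin.partialProd x.2⟩)
  have h3 : Topology.IsQuotientMap pre := Topology.IsQuotientMap.of_inverse h2 h1 (by
    rintro ⟨⟨n, x⟩, t⟩
    simp only [pre, sec]
    rw [quots_partialProd])
  have h4 : Topology.IsQuotientMap (proj G ∘ (Quot.mk (EGRel G))) :=
    (isQuotientMap_quot_mk (r := BGRel G)).comp h3
  exact Topology.IsQuotientMap.of_comp continuous_quot_mk (proj G).continuous h4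

variable (G) in
/-- The inverse of the bijection between orbits and points of `BG`. -/
def orbitOf : BG G → MulAction.orbitRel.Quotient G (EG G) :=
  Quot.lift (fun p => Quotient.mk'' (mk (Fin.partialProd p.1.2) p.2)) (by
    rintro _ _ ⟨n, i, x, t⟩
    change Quotient.mk'' (mk (Fin.partialProd x) (faceIncl i t)) =
      Quotient.mk'' (mk (Fin.partialProd (barFace i x)) t)
    rw [mk_face]
    refine _root_.Quotient.sound' ?_
    obtain ⟨g, hg⟩ := exists_mul_of_quots_eq (v := Fin.partialProd (barFace i x))
      (w := Fin.partialProd x ∘ i.succAbove)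
      (by rw [quots_partialProd, ← barFace_quots, quots_partialProd])
    exact ⟨g, by rw [hg]; rfl⟩)

lemma orbitOf_proj (x : EG G) : orbitOf G (proj G x) = Quotient.mk'' x := by
  obtain ⟨n, v, t, rfl⟩ := exists_mk x
  refine _root_.Quotient.sound' ?_
  obtain ⟨g, hg⟩ := exists_mul_of_quots_eq (v := v) (w := Fin.partialProd (quots v))
    (quots_partialProd _).symm
  refine ⟨g, ?_⟩
  change g • mk v t = mk (Fin.partialProd (quots v)) t
  rw [hg]
  rfl

lemma exists_smul_of_proj_eq {x y : EG G} (h : proj G x = proj G y) : ∃ g : G, g • y = x := by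
  have h' := congrArg (orbitOf G) h
  rw [orbitOf_proj, orbitOf_proj] at h'
  exact _root_.Quotient.exact' h'

/-- The map `BH → BG` is injective. -/
lemma bgMap_subtype_injective (H : Subgroup G) : Function.Injective (BG.map H.subtype) := by
  classical
  intro p q hpq
  obtain ⟨x, rfl⟩ := (isQuotientMap_proj H).surjective p
  obtain ⟨y, rfl⟩ := (isQuotientMap_proj H).surjective q
  rw [← proj_map, ← proj_map] at hpq
  obtain ⟨g, hg⟩ := exists_smul_of_proj_eq hpq
  -- Some vertex of `x` is `g` times a vertex of `y`, and both vertices lie in `H`.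
  have hgH : g ∈ H := by
    obtain ⟨h, hh⟩ := supp_nonempty x
    have h1 : (h : G) ∈ supp (map H.subtype x) := by
      rw [supp_map]
      exact ⟨h, hh, rfl⟩
    rw [← hg] at h1
    change _ ∈ supp (map (g * ·) (map H.subtype y)) at h1
    rw [supp_map, supp_map] at h1
    obtain ⟨_, ⟨h', -, rfl⟩, e⟩ := h1
    change g * (h' : G) = h at e
    rw [eq_mul_inv_of_mul_eq e]
    exact H.mul_mem h.2 (H.inv_mem h'.2)
  have h2 : map H.subtype ((⟨g, hgH⟩ : H) • y) = map H.subtype x := by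
    rw [map_smul]
    exact hg
  have h3 : (⟨g, hgH⟩ : H) • y = x := by
    -- Any retraction of sets `G → H` induces a retraction of `EG` onto `EH`, so `EH → EG` is
    -- injective. No multiplicativity is needed.
    let ρ : G → H := fun a => if ha : a ∈ H then ⟨a, ha⟩ else 1
    have h4 (z : EG H) : map ρ (map H.subtype z) = z := by
      obtain ⟨n, v, t, rfl⟩ := exists_mk z
      rw [map_mk, map_mk]
      congr 1
      funext j
      simp [ρ]
    rw [← h4 x, ← h2, h4]
  rw [← h3, proj_smul]

/-! #### The covering -/

/-- The sum of the first coordinates of a point of the standard simplex. -/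
def cum {n : ℕ} (t : Simp n) (m : ℕ) : ℝ := ∑ k : Fin (n + 1), if (k : ℕ) < m then t k else 0

lemma continuous_cum {n : ℕ} (m : ℕ) : Continuous fun t : Simp n => cum t m := by
  unfold cum
  refine continuous_finsetSum _ fun k _ => ?_
  split_ifs
  · exact (continuous_apply k).comp continuous_subtype_val
  · exact continuous_const

lemma cum_mono {n : ℕ} (t : Simp n) : Monotone (cum t) := fun m m' h => by
  refine Finset.sum_le_sum fun k _ => ?_
  have : 0 ≤ t k := t.2.1 k
  split_ifs <;> first | exact le_rfl | assumption | lia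

lemma cum_zero {n : ℕ} (t : Simp n) : cum t 0 = 0 := by simp [cum]

lemma cum_last {n : ℕ} (t : Simp n) : cum t (n + 1) = 1 := by
  rw [← stdSimplex.sum_eq_one t]
  exact Finset.sum_congr rfl fun k _ => if_pos k.2

lemma cum_succ {n : ℕ} (t : Simp n) (j : Fin (n + 1)) : cum t (j + 1) = cum t j + t j := by
  have h : t j = ∑ k : Fin (n + 1), if k = j then t k else 0 := by simp
  rw [h, cum, cum, ← Finset.sum_add_distrib]
  refine Finset.sum_congr rfl fun k _ => ?_
  have : k = j ↔ (k : ℕ) = j := Fin.ext_iff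
  by_cases h1 : (k : ℕ) < j
  · rw [if_pos h1, if_pos (by lia), if_neg (by lia), add_zero]
  · by_cases h2 : k = j
    · rw [if_neg h1, if_pos (by lia), if_pos h2, zero_add]
    · rw [if_neg h1, if_neg (by lia), if_neg h2, zero_add]

lemma cum_face {n : ℕ} (i : Fin (n + 2)) (t : Simp n) (k : Fin (n + 1)) :
    cum (faceIncl i t) (i.succAbove k) = cum t k := by
  rw [cum, Fin.sum_univ_succAbove _ i, faceIncl_self, ite_self, zero_add]
  refine Finset.sum_congr rfl fun l _ => ?_
  rw [faceIncl_succAbove]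
  refine if_congr ?_ rfl rfl
  exact Fin.succAbove_lt_succAbove_iff

lemma cum_face_succ {n : ℕ} (i : Fin (n + 2)) (t : Simp n) (k : Fin (n + 1)) :
    cum (faceIncl i t) (i.succAbove k + 1) = cum t (k + 1) := by
  rw [cum_succ, cum_succ, cum_face, faceIncl_succAbove]

open Classical in
/-- The total variation of a function over the intervals labelled by a given vertex, when the
barycentric coordinates of a point are laid out in the unit interval. -/
def weight (F : ℝ → ℝ) (a : S) : EG S → ℝ :=
  lift (fun n v t => ∑ j : Fin (n + 1), if v j = a then F (cum t (j + 1)) - F (cum t j) else 0)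
    fun n i v t => by
      rw [Fin.sum_univ_succAbove _ i]
      -- The inserted zero coordinate gives an interval of length zero, which contributes nothing
      -- whatever its label.
      have h : F (cum (faceIncl i t) (i + 1)) - F (cum (faceIncl i t) i) = 0 := by
        rw [cum_succ, faceIncl_self, add_zero, sub_self]
      rw [h, ite_self, zero_add]
      refine Finset.sum_congr rfl fun k _ => ?_
      rw [cum_face, cum_face_succ]
      rfl

open Classical in
lemma weight_mk (F : ℝ → ℝ) (a : S) {n : ℕ} (v : Fin (n + 1) → S) (t : Simp n) :
    weight F a (mk v t) =
      ∑ j : Fin (n + 1), if v j = a then F (cum t (j + 1)) - F (cum t j) else 0 := rfl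

lemma continuous_weight {F : ℝ → ℝ} (hF : Continuous F) (a : S) : Continuous (weight F a) := by
  refine continuous_lift _ _ fun n v => continuous_finsetSum _ fun j _ => ?_
  split_ifs
  · exact (hF.comp (continuous_cum _)).sub (hF.comp (continuous_cum _))
  · exact continuous_const

/-- An interval carries one label, so the two weights add up increments of `F` over disjoint sets of
intervals. -/
lemma weight_add_weight_le {F : ℝ → ℝ} (hF : Monotone F) {a b : S} (hab : a ≠ b) (x : EG S) :
    weight F a x + weight F b x ≤ F 1 - F 0 := by
  obtain ⟨n, v, t, rfl⟩ := exists_mk x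
  have h : F 1 - F 0 = ∑ j : Fin (n + 1), (F (cum t (j + 1)) - F (cum t j)) := by
    rw [Fin.sum_univ_eq_sum_range (fun j => F (cum t (j + 1)) - F (cum t j)) (n + 1),
      Finset.sum_range_sub (fun j => F (cum t j)), cum_zero, cum_last]
  rw [h, weight_mk, weight_mk, ← Finset.sum_add_distrib]
  refine Finset.sum_le_sum fun j _ => ?_
  have hj : 0 ≤ F (cum t (j + 1)) - F (cum t j) := sub_nonneg.2 (hF (cum_mono t (Nat.le_succ _)))
  by_cases h1 : v j = a
  · rw [if_pos h1, if_neg (fun h2 => hab (h1.symm.trans h2)), add_zero]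
  · rw [if_neg h1, zero_add]
    split_ifs
    · exact le_rfl
    · exact hj

lemma le_weight {F : ℝ → ℝ} (hF : Monotone F) {n : ℕ} (v : Fin (n + 1) → S) (t : Simp n)
    (j : Fin (n + 1)) : F (cum t (j + 1)) - F (cum t j) ≤ weight F (v j) (mk v t) := by
  classical
  rw [weight_mk]
  refine (if_pos rfl).symm.trans_le (Finset.single_le_sum (f := fun k : Fin (n + 1) =>
    if v k = v j then F (cum t (k + 1)) - F (cum t k) else 0) (fun k _ => ?_) (Finset.mem_univ j))
  have hk : 0 ≤ F (cum t (k + 1)) - F (cum t k) := sub_nonneg.2 (hF (cum_mono t (Nat.le_succ _)))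
  split_ifs
  · exact hk
  · exact le_rfl

lemma weight_smul (F : ℝ → ℝ) (g a : G) (x : EG G) :
    weight F a (g • x) = weight F (g⁻¹ * a) x := by
  obtain ⟨n, v, t, rfl⟩ := exists_mk x
  classical
  rw [smul_mk, weight_mk, weight_mk]
  refine Finset.sum_congr rfl fun j _ => if_congr ?_ rfl rfl
  rw [eq_inv_mul_iff_mul_eq]

variable (G) in
-- A neighbourhood disjoint from its translates is needed. Lay out the barycentric coordinates of
-- the given point in `[0, 1]`, pick the interval `[α, β]` of a nonzero coordinate `t j`, and let
-- `F` clamp to it. The weights of two distinct labels then add up to at most `β - α = t j`, while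
-- at the given point the label `v j` has weight at least `t j`. The neighbourhood where the label
-- `v j` has more than half of `t j` is disjoint from its translate by `g ≠ 1`: a common point would
-- give two distinct labels more than half each. Without clamping, the total would be 1 and could
-- not separate labels of small weight.
lemma isQuotientCoveringMap_proj : IsQuotientCoveringMap (proj G) G where
  toIsQuotientMap := isQuotientMap_proj G
  continuous_const_smul g := (map (g * ·)).continuous
  apply_eq_iff_mem_orbit {x y} := by
    refine ⟨fun h => exists_smul_of_proj_eq h, ?_⟩
    rintro ⟨g, rfl⟩
    exact proj_smul g y
  disjoint e := by
    obtain ⟨n, v, t, rfl⟩ := exists_mk e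
    obtain ⟨j, hj⟩ : ∃ j, t j ≠ 0 := by
      by_contra! h
      have := stdSimplex.sum_eq_one t
      simp [h] at this
    have hj0 : 0 < t j := lt_of_le_of_ne (t.2.1 j) hj.symm
    let α := cum t j
    let β := cum t (j + 1)
    have hαβ : β - α = t j := by rw [show β = α + t j from cum_succ t j, add_sub_cancel_left]
    have hα : 0 ≤ α := (cum_zero t).symm.trans_le (cum_mono t (Nat.zero_le _))
    have hβ : β ≤ 1 := (cum_mono t (show (j : ℕ) + 1 ≤ n + 1 by lia)).trans_eq (cum_last t)
    let F : ℝ → ℝ := fun r => max α (min β r)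
    have hF : Monotone F := fun r s h => max_le_max le_rfl (min_le_min le_rfl h)
    have hFc : Continuous F := by fun_prop
    have h0 : F 0 = α := max_eq_left ((min_le_right _ _).trans hα)
    have h1 : F 1 = β := by
      change max α (min β 1) = β
      rw [min_eq_left hβ, max_eq_right (by linarith)]
    have hFα : F α = α := max_eq_left (min_le_right _ _)
    have hFβ : F β = β := by
      change max α (min β β) = β
      rw [min_self, max_eq_right (by linarith)]
    refine ⟨{x | t j / 2 < weight F (v j) x}, ?_, fun g => ?_⟩
    · refine (isOpen_lt continuous_const (continuous_weight hFc _)).mem_nhds ?_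
      have h := le_weight hF v t j
      change F β - F α ≤ _ at h
      rw [hFα, hFβ, hαβ] at h
      change t j / 2 < weight F (v j) (mk v t)
      linarith
    · rintro ⟨_, ⟨x, hx, rfl⟩, hx'⟩
      by_contra hg
      change t j / 2 < weight F (v j) (g • x) at hx'
      change t j / 2 < weight F (v j) x at hx
      rw [weight_smul] at hx'
      have := weight_add_weight_le hF (a := v j) (b := g⁻¹ * v j) (by
        intro h
        rw [eq_inv_mul_iff_mul_eq, mul_eq_right] at h
        exact hg h) x
      rw [h0, h1, hαβ] at this
      linarith

instance (n : ℕ) : ContractibleSpace (Simp n) :=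
  (convex_stdSimplex ℝ _).contractibleSpace ⟨_, (verts n 0).2⟩

instance (n : ℕ) : LocallyPathConnectedSpace (Simp n) :=
  (convex_stdSimplex ℝ _).locallyPathConnectedSpace

/-- Standard simplices are contractible and locally path connected, so maps from them lift through a
covering. -/
lemma exists_lift {n : ℕ} (σ : C(Simp n, BG G)) : ∃ τ : C(Simp n, EG G), (proj G).comp τ = σ := by
  obtain ⟨e, he⟩ := (isQuotientMap_proj G).surjective (σ (verts n 0))
  obtain ⟨τ, ⟨-, hτ⟩, -⟩ := (isQuotientCoveringMap_proj G).isCoveringMap.existsUnique_continuousMap_lifts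
    σ (verts n 0) e he
  exact ⟨τ, ContinuousMap.ext fun t => congrFun hτ t⟩

lemma exists_smul_of_comp_eq {n : ℕ} {τ τ' : C(Simp n, EG G)}
    (h : (proj G).comp τ = (proj G).comp τ') : ∃ g : G, (map (g * ·)).comp τ' = τ := by
  obtain ⟨g, hg⟩ := exists_smul_of_proj_eq (DFunLike.congr_fun h (verts n 0))
  refine ⟨g, ?_⟩
  obtain ⟨_, -, huniq⟩ := (isQuotientCoveringMap_proj G).isCoveringMap.existsUnique_continuousMap_lifts
    ((proj G).comp τ) (verts n 0) (τ (verts n 0)) rfl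
  refine (huniq _ ⟨hg, ?_⟩).trans (huniq τ ⟨rfl, rfl⟩).symm
  funext t
  exact (proj_smul g (τ' t)).trans (DFunLike.congr_fun h t).symm

lemma smul_left_injective {g g' : G} {x : EG G} (h : g • x = g' • x) : g = g' :=
  (isQuotientCoveringMap_proj G).isCancelSMul.right_cancel' _ _ _ h

instance : PathConnectedSpace (BG G) :=
  (isQuotientMap_proj G).surjective.pathConnectedSpace (proj G).continuous

end EG

end Universal

/-! ### Elements of the tensor product with `ℤ` -/

section TensorElements

variable {G G' : Type u} [Group G] [Group G']

/-- The class of `m ⊗ 1` in the tensor product with `ℤ`. -/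
def tmk (M : ModuleCat.{u} (GroupRing G)) : M →+ TensorZ M where
  toFun m := Submodule.Quotient.mk (p := balanceRel (G := G) M) (m ⊗ₜ[ℤ] (1 : ℤ))
  map_zero' := by
    rw [TensorProduct.zero_tmul]
    rfl
  map_add' m m' := by
    rw [TensorProduct.add_tmul]
    rfl

lemma tmk_surjective (M : ModuleCat.{u} (GroupRing G)) : Function.Surjective (tmk M) := by
  intro y
  obtain ⟨z, rfl⟩ := Submodule.Quotient.mk_surjective (balanceRel (G := G) M) y
  induction z using TensorProduct.induction_on with
  | zero => exact ⟨0, map_zero _⟩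
  | tmul m a =>
    refine ⟨a • m, ?_⟩
    change Submodule.Quotient.mk ((a • m) ⊗ₜ[ℤ] (1 : ℤ)) = _
    rw [TensorProduct.smul_tmul, smul_eq_mul, mul_one]
  | add z z' h h' =>
    obtain ⟨m, hm⟩ := h
    obtain ⟨m', hm'⟩ := h'
    exact ⟨m + m', by rw [map_add, hm, hm']; rfl⟩

lemma tmk_smul (M : ModuleCat.{u} (GroupRing G)) (g : G) (m : M) :
    tmk M ((MonoidAlgebra.single g (1 : ℤ) : GroupRing G) • m) = tmk M m :=
  (Submodule.Quotient.eq _).2 (Submodule.subset_span ⟨g, m, 1, rfl⟩)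

/-- Homomorphisms out of the tensor product with `ℤ`. -/
def tdesc {M : ModuleCat.{u} (GroupRing G)} {A : Type v} [AddCommGroup A] (ψ : M →+ A)
    (hψ : ∀ (g : G) (m : M), ψ ((MonoidAlgebra.single g (1 : ℤ) : GroupRing G) • m) = ψ m) :
    TensorZ M →ₗ[ℤ] A :=
  Submodule.liftQ (balanceRel (G := G) M)
    (ψ.toIntLinearMap ∘ₗ (TensorProduct.rid ℤ M).toLinearMap) (by
      refine Submodule.span_le.2 ?_
      rintro _ ⟨g, m, a, rfl⟩
      change ψ.toIntLinearMap (TensorProduct.rid ℤ M (_ - _)) = 0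
      rw [map_sub, TensorProduct.rid_tmul, TensorProduct.rid_tmul, map_sub]
      change ψ (a • _) - ψ (a • m) = 0
      rw [map_zsmul ψ a, map_zsmul ψ a, hψ, sub_self])

lemma tdesc_tmk {M : ModuleCat.{u} (GroupRing G)} {A : Type v} [AddCommGroup A] (ψ : M →+ A)
    (hψ : ∀ (g : G) (m : M), ψ ((MonoidAlgebra.single g (1 : ℤ) : GroupRing G) • m) = ψ m)
    (m : M) : tdesc ψ hψ (tmk M m) = ψ m := by
  change ψ.toIntLinearMap (TensorProduct.rid ℤ M (m ⊗ₜ[ℤ] (1 : ℤ))) = ψ m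
  rw [TensorProduct.rid_tmul, one_smul]
  rfl

lemma tensorZMap_tmk (φ : G →* G') {M : ModuleCat.{u} (GroupRing G)}
    {M' : ModuleCat.{u} (GroupRing G')} (f : M →+ M')
    (hf : ∀ (g : G) (m : M), f ((MonoidAlgebra.single g (1 : ℤ) : GroupRing G) • m) =
      (MonoidAlgebra.single (φ g) (1 : ℤ) : GroupRing G') • f m) (m : M) :
    TensorZ.map φ f hf (tmk M m) = tmk M' (f m) := rfl

/-! ### Equivariant maps out of projective modules -/

/-- An additive map is equivariant along a homomorphism of groups. -/
def IsEquivariant (φ : G →* G') {M M' : Type*} [AddCommGroup M] [Module (GroupRing G) M]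
    [AddCommGroup M'] [Module (GroupRing G') M'] (f : M →+ M') : Prop :=
  ∀ (g : G) (m : M), f ((MonoidAlgebra.single g (1 : ℤ) : GroupRing G) • m) =
    (MonoidAlgebra.single (φ g) (1 : ℤ) : GroupRing G') • f m

/-- An equivariant additive map as a linear map over the group ring. -/
def equivariantLin {M M' : Type*} [AddCommGroup M] [Module (GroupRing G) M]
    [AddCommGroup M'] [Module (GroupRing G) M'] (f : M →+ M')
    (hf : IsEquivariant (MonoidHom.id G) f) : M →ₗ[GroupRing G] M' :=
  MonoidAlgebra.equivariantOfLinearOfComm f.toIntLinearMap hf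

lemma exists_equivariant_lift (φ : G →* G') {P N M : Type*} [AddCommGroup P]
    [Module (GroupRing G) P] [Module.Projective (GroupRing G) P] [AddCommGroup N]
    [Module (GroupRing G') N] [AddCommGroup M] [Module (GroupRing G') M]
    (d : N →ₗ[GroupRing G'] M) (f : P →+ M) (hf : IsEquivariant φ f)
    (h : ∀ x, ∃ y, d y = f x) :
    ∃ s : P →+ N, IsEquivariant φ s ∧ ∀ x, d (s x) = f x := by
  let ψ : GroupRing G →+* GroupRing G' := MonoidAlgebra.mapDomainRingHom ℤ φ
  have hψ (g : G) : ψ (MonoidAlgebra.single g 1) = MonoidAlgebra.single (φ g) 1 :=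
    MonoidAlgebra.mapDomain_single
  let _ : Module (GroupRing G) N := Module.compHom N ψ
  let _ : Module (GroupRing G) M := Module.compHom M ψ
  have hN (g : G) (y : N) : (MonoidAlgebra.single g (1 : ℤ) : GroupRing G) • y =
      (MonoidAlgebra.single (φ g) (1 : ℤ) : GroupRing G') • y := by
    rw [← hψ]
    rfl
  have hM (g : G) (y : M) : (MonoidAlgebra.single g (1 : ℤ) : GroupRing G) • y =
      (MonoidAlgebra.single (φ g) (1 : ℤ) : GroupRing G') • y := by
    rw [← hψ]
    rfl
  let d' : N →ₗ[GroupRing G] M :=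
    { toFun := d
      map_add' := d.map_add
      map_smul' := fun r x => d.map_smul (ψ r) x }
  let f' : P →ₗ[GroupRing G] M := equivariantLin f fun g m => (hf g m).trans (hM g _).symm
  obtain ⟨s, hs⟩ := Module.projective_lifting_property d'.rangeRestrict
    (f'.codRestrict (LinearMap.range d') fun x => h x) d'.surjective_rangeRestrict
  refine ⟨s.toAddMonoidHom, fun g m => ?_, fun x => ?_⟩
  · exact (s.map_smul _ m).trans (hN g _)
  · exact congrArg Subtype.val (LinearMap.congr_fun hs x)

/-- Equivariant chain maps from projective modules to a complex that is exact in positive degrees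
which vanish on the zeroth homology are null-homotopic, in each degree. -/
lemma exists_equivariant_nullhomotopy (φ : G →* G') {P : ChainComplex (ModuleCat.{u} (GroupRing G)) ℕ}
    (hP : ∀ n, Module.Projective (GroupRing G) (P.X n))
    {Q : ChainComplex (ModuleCat.{u} (GroupRing G')) ℕ}
    (hQ : ∀ n (x : Q.X (n + 1)), Q.d (n + 1) n x = 0 → ∃ y, Q.d (n + 2) (n + 1) y = x)
    (f : ∀ n, P.X n →+ Q.X n) (hf : ∀ n, IsEquivariant φ (f n))
    (hfd : ∀ n x, f n (P.d (n + 1) n x) = Q.d (n + 1) n (f (n + 1) x))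
    (h0 : ∀ x, ∃ y, Q.d 1 0 y = f 0 x) :
    (∃ s : P.X 0 →+ Q.X 1, IsEquivariant φ s ∧ ∀ x, Q.d 1 0 (s x) = f 0 x) ∧
    ∀ n, ∃ (s : P.X (n + 1) →+ Q.X (n + 2)) (r : P.X n →+ Q.X (n + 1)), IsEquivariant φ s ∧
      IsEquivariant φ r ∧ ∀ x, Q.d (n + 2) (n + 1) (s x) = f (n + 1) x - r (P.d (n + 1) n x) := by
  have base : ∃ s : P.X 0 →+ Q.X 1, IsEquivariant φ s ∧ ∀ x, Q.d 1 0 (s x) = f 0 x :=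
    exists_equivariant_lift φ (Q.d 1 0).hom (f 0) (hf 0) h0
  have step (n : ℕ) (r : P.X n →+ Q.X (n + 1)) (hr : IsEquivariant φ r)
      (hrd : ∀ x : P.X (n + 1), Q.d (n + 1) n (r (P.d (n + 1) n x)) = f n (P.d (n + 1) n x)) :
      ∃ s : P.X (n + 1) →+ Q.X (n + 2), IsEquivariant φ s ∧
        ∀ x, Q.d (n + 2) (n + 1) (s x) = f (n + 1) x - r (P.d (n + 1) n x) := by
    refine exists_equivariant_lift φ (Q.d (n + 2) (n + 1)).hom
      (f (n + 1) - r.comp (P.d (n + 1) n).hom.toAddMonoidHom) (fun g m => ?_) fun x => ?_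
    · change f (n + 1) (_ • m) - r ((P.d (n + 1) n).hom (_ • m)) =
        _ • (f (n + 1) m - r ((P.d (n + 1) n).hom m))
      rw [hf, map_smul, hr, smul_sub]
    · refine hQ n _ ?_
      change Q.d (n + 1) n (f (n + 1) x - r (P.d (n + 1) n x)) = 0
      rw [map_sub, ← hfd, hrd, sub_self]
  refine ⟨base, fun n => ?_⟩
  -- The next step uses the homotopy in degree `n` only through its values on boundaries, so the
  -- induction can forget everything else about it.
  suffices ∃ r : P.X n →+ Q.X (n + 1), IsEquivariant φ r ∧
      ∀ x : P.X (n + 1), Q.d (n + 1) n (r (P.d (n + 1) n x)) = f n (P.d (n + 1) n x) by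
    obtain ⟨r, hr, hrd⟩ := this
    obtain ⟨s, hs, hsd⟩ := step n r hr hrd
    exact ⟨s, r, hs, hr, hsd⟩
  induction n with
  | zero =>
    obtain ⟨s, hs, hsd⟩ := base
    exact ⟨s, hs, fun x => hsd _⟩
  | succ n ih =>
    obtain ⟨r, hr, hrd⟩ := ih
    obtain ⟨s, hs, hsd⟩ := step n r hr hrd
    refine ⟨s, hs, fun x => ?_⟩
    rw [hsd, d_d_apply, map_zero, sub_zero]

/-- Equivariant chain maps over the same augmentation induce the same map on the homology of the
tensor products with `ℤ`. -/
lemma homologyMap_eq_of_equivariant (φ : G →* G')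
    {P : ChainComplex (ModuleCat.{u} (GroupRing G)) ℕ}
    (hP : ∀ n, Module.Projective (GroupRing G) (P.X n))
    {Q : ChainComplex (ModuleCat.{u} (GroupRing G')) ℕ}
    (hQ : ∀ n (x : Q.X (n + 1)), Q.d (n + 1) n x = 0 → ∃ y, Q.d (n + 2) (n + 1) y = x)
    (f g : ∀ n, P.X n →+ Q.X n) (hf : ∀ n, IsEquivariant φ (f n))
    (hg : ∀ n, IsEquivariant φ (g n))
    (hfd : ∀ n x, f n (P.d (n + 1) n x) = Q.d (n + 1) n (f (n + 1) x))
    (hgd : ∀ n x, g n (P.d (n + 1) n x) = Q.d (n + 1) n (g (n + 1) x))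
    (h0 : ∀ x, ∃ y, Q.d 1 0 y = f 0 x - g 0 x)
    (a b : ((tensorZ G).mapHomologicalComplex _).obj P ⟶
      ((tensorZ G').mapHomologicalComplex _).obj Q)
    (ha : ∀ n x, a.f n (tmk (P.X n) x) = tmk (Q.X n) (f n x))
    (hb : ∀ n x, b.f n (tmk (P.X n) x) = tmk (Q.X n) (g n x)) (n : ℕ) :
    HomologicalComplex.homologyMap a n = HomologicalComplex.homologyMap b n := by
  obtain ⟨h1, h2⟩ := exists_equivariant_nullhomotopy φ hP hQ (fun n => f n - g n)
    (fun n γ m => by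
      change f n _ - g n _ = _ • (f n m - g n m)
      rw [hf, hg, smul_sub])
    (fun n x => by
      change f n _ - g n _ = Q.d (n + 1) n (f (n + 1) x - g (n + 1) x)
      rw [hfd, hgd, map_sub]) h0
  refine homologyMap_eq_of_forall a b n fun x hx => ?_
  cases n with
  | zero =>
    obtain ⟨s, hs, hsd⟩ := h1
    obtain ⟨x, rfl⟩ := tmk_surjective (P.X 0) x
    refine ⟨tmk (Q.X 1) (s x), ?_⟩
    rw [ha, hb]
    exact (congrArg (tmk (Q.X 0)) (hsd x)).trans (map_sub (tmk (Q.X 0)) _ _)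
  | succ n =>
    obtain ⟨s, r, hs, hr, hsd⟩ := h2 n
    obtain ⟨x, rfl⟩ := tmk_surjective (P.X (n + 1)) x
    refine ⟨tmk (Q.X (n + 2)) (s x), ?_⟩
    -- The representative `x` need not be a cycle: only the class of its boundary in the
    -- coinvariants vanishes. The equivariant map `r` carries this vanishing along.
    have h3 : tmk (P.X n) (P.d (n + 1) n x) = 0 := hx n
    have h4 : tmk (Q.X (n + 1)) (r (P.d (n + 1) n x)) = 0 := by
      rw [← tensorZMap_tmk φ r hr, h3, map_zero]
    rw [ha, hb]
    refine (congrArg (tmk (Q.X (n + 1))) (hsd x)).trans ?_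
    rw [map_sub, h4, sub_zero]
    exact map_sub (tmk (Q.X (n + 1))) _ _

end TensorElements

/-! ### Projective resolutions from exact sequences -/

section Resolution

variable {R : Type u} [Ring R]

lemma quasiIso_toSingle₀ {M : ModuleCat.{u} R} (C : ChainComplex (ModuleCat.{u} R) ℕ)
    (ε : C.X 0 ⟶ M) (hε : C.d 1 0 ≫ ε = 0) (hsurj : Function.Surjective ε)
    (h0 : ∀ x, ε x = 0 → ∃ y, C.d 1 0 y = x)
    (h : ∀ n (x : C.X (n + 1)), C.d (n + 1) n x = 0 → ∃ y, C.d (n + 2) (n + 1) y = x) :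
    QuasiIso ((C.toSingle₀Equiv M).symm ⟨ε, hε⟩) := by
  have hf : ((C.toSingle₀Equiv M).symm ⟨ε, hε⟩).f 0 = ε := ChainComplex.toSingle₀Equiv_symm_apply_f_zero ε hε
  have hz (n : ℕ) (y y' : ((ChainComplex.single₀ (ModuleCat.{u} R)).obj M).X (n + 1)) : y = y' := by
    have := ModuleCat.subsingleton_of_isZero
      (HomologicalComplex.isZero_single_obj_X (ComplexShape.down ℕ) 0 M (n + 1) (by simp))
    exact Subsingleton.elim _ _
  refine quasiIso_of_forall _ (fun b => ?_) fun n a b ha hb => ?_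
  · obtain ⟨a, ha⟩ := hsurj b
    refine ⟨a, 0, ?_⟩
    rw [map_zero, hf, eq_comm, sub_eq_zero]
    exact ha
  · suffices ∃ a', C.d (n + 1) n a' = a by
      obtain ⟨a', ha'⟩ := this
      exact ⟨a', 0, ha', hz n _ _⟩
    cases n with
    | zero =>
      refine h0 a ?_
      rw [hf] at hb
      exact hb.symm.trans ((congrArg _ (hz 0 b 0)).trans (map_zero _))
    | succ n => exact h n a (ha n)

/-- A projective resolution given by an exact sequence. -/
def mkResolution {M : ModuleCat.{u} R} (C : ChainComplex (ModuleCat.{u} R) ℕ)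
    (hC : ∀ n, Module.Projective R (C.X n))
    (ε : C.X 0 ⟶ M) (hε : C.d 1 0 ≫ ε = 0) (hsurj : Function.Surjective ε)
    (h0 : ∀ x, ε x = 0 → ∃ y, C.d 1 0 y = x)
    (h : ∀ n (x : C.X (n + 1)), C.d (n + 1) n x = 0 → ∃ y, C.d (n + 2) (n + 1) y = x) :
    ProjectiveResolution M where
  complex := C
  projective n := (IsProjective.iff_projective (C.X n)).1 (hC n)
  π := (C.toSingle₀Equiv M).symm ⟨ε, hε⟩
  quasiIso := quasiIso_toSingle₀ C ε hε hsurj h0 h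

lemma mkResolution_π_f_zero {M : ModuleCat.{u} R} (C : ChainComplex (ModuleCat.{u} R) ℕ)
    (hC : ∀ n, Module.Projective R (C.X n))
    (ε : C.X 0 ⟶ M) (hε : C.d 1 0 ≫ ε = 0) (hsurj : Function.Surjective ε)
    (h0 : ∀ x, ε x = 0 → ∃ y, C.d 1 0 y = x)
    (h : ∀ n (x : C.X (n + 1)), C.d (n + 1) n x = 0 → ∃ y, C.d (n + 2) (n + 1) y = x) :
    (mkResolution C hC ε hε hsurj h0 h).π.f 0 = ε :=
  ChainComplex.toSingle₀Equiv_symm_apply_f_zero ε hε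

end Resolution

/-! ### Quotients of permutation modules -/

section PermQuot

variable {G : Type u} [Group G] {X : Type u} [MulAction G X]

lemma mapDomain_smul_mem_supported {U : Set X} (hU : ∀ (g : G), ∀ x ∈ U, g • x ∈ U) (g : G)
    {c : X →₀ ℤ} (hc : c ∈ Finsupp.supported ℤ ℤ U) :
    Finsupp.mapDomain (g • ·) c ∈ Finsupp.supported ℤ ℤ U := by
  classical
  rw [Finsupp.mem_supported] at hc ⊢
  intro x hx
  obtain ⟨y, hy, rfl⟩ := Finset.mem_image.1 (Finsupp.mapDomain_support hx)
  exact hU g y (hc hy)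

/-- The representation on the finite formal sums of elements of a `G`-set modulo those of a stable
subset. -/
def permRep (U : Set X) (hU : ∀ (g : G), ∀ x ∈ U, g • x ∈ U) :
    Representation ℤ G ((X →₀ ℤ) ⧸ Finsupp.supported ℤ ℤ U) where
  toFun g := Submodule.mapQ _ _ (Finsupp.lmapDomain ℤ ℤ (g • ·))
    fun _ hc => mapDomain_smul_mem_supported hU g hc
  map_one' := by
    refine Submodule.linearMap_qext _ (LinearMap.ext fun c => ?_)
    refine congrArg (Submodule.mkQ _) ?_
    change Finsupp.mapDomain (fun x : X => (1 : G) • x) c = c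
    simp only [one_smul]
    exact Finsupp.mapDomain_id
  map_mul' g h := by
    refine Submodule.linearMap_qext _ (LinearMap.ext fun c => ?_)
    refine congrArg (Submodule.mkQ _) ?_
    change Finsupp.mapDomain (fun x : X => (g * h) • x) c =
      Finsupp.mapDomain (g • ·) (Finsupp.mapDomain (h • ·) c)
    simp only [mul_smul]
    exact Finsupp.mapDomain_comp

/-- The `ℤ[G]`-module of finite formal sums of elements of a `G`-set modulo those of a stable
subset. -/
abbrev PermQuot (U : Set X) (hU : ∀ (g : G), ∀ x ∈ U, g • x ∈ U) : ModuleCat.{u} (GroupRing G) :=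
  ModuleCat.of _ (permRep U hU).asModule

namespace PermQuot

variable {U : Set X} {hU : ∀ (g : G), ∀ x ∈ U, g • x ∈ U}

variable (U hU) in
/-- The class of a formal sum. -/
def mk : (X →₀ ℤ) →+ PermQuot U hU :=
  (permRep U hU).asModuleEquiv.symm.toLinearMap.toAddMonoidHom.comp
    (Submodule.mkQ (Finsupp.supported ℤ ℤ U)).toAddMonoidHom

lemma mk_surjective : Function.Surjective (mk U hU) :=
  Submodule.mkQ_surjective (Finsupp.supported ℤ ℤ U)

lemma mk_eq_zero_iff {c : X →₀ ℤ} : mk U hU c = 0 ↔ c ∈ Finsupp.supported ℤ ℤ U :=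
  Submodule.Quotient.mk_eq_zero _

lemma smul_mk (g : G) (c : X →₀ ℤ) :
    (MonoidAlgebra.single g (1 : ℤ) : GroupRing G) • mk U hU c =
      mk U hU (Finsupp.mapDomain (g • ·) c) :=
  ((permRep U hU).single_smul 1 g (mk U hU c)).trans (one_smul _ _)

/-- Additive maps out of the quotient. -/
def desc {N : Type v} [AddCommGroup N] (f : (X →₀ ℤ) →+ N)
    (hf : ∀ c ∈ Finsupp.supported ℤ ℤ U, f c = 0) : PermQuot U hU →+ N :=
  ((Finsupp.supported ℤ ℤ U).liftQ f.toIntLinearMap hf).toAddMonoidHom.comp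
    (permRep U hU).asModuleEquiv.toLinearMap.toAddMonoidHom

lemma desc_mk {N : Type v} [AddCommGroup N] (f : (X →₀ ℤ) →+ N)
    (hf : ∀ c ∈ Finsupp.supported ℤ ℤ U, f c = 0) (c : X →₀ ℤ) :
    desc (hU := hU) f hf (mk U hU c) = f c := rfl

/-- Linear maps out of the quotient. -/
def descLin {N : Type v} [AddCommGroup N] [Module (GroupRing G) N] (f : (X →₀ ℤ) →+ N)
    (hf : ∀ c ∈ Finsupp.supported ℤ ℤ U, f c = 0)
    (hfG : ∀ (g : G) (c : X →₀ ℤ), f (Finsupp.mapDomain (g • ·) c) =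
      (MonoidAlgebra.single g (1 : ℤ) : GroupRing G) • f c) :
    PermQuot U hU →ₗ[GroupRing G] N :=
  equivariantLin (desc f hf) fun g m => by
    obtain ⟨c, rfl⟩ := mk_surjective m
    rw [smul_mk, desc_mk, desc_mk]
    exact hfG g c

lemma linearMap_ext {N : Type v} [AddCommGroup N] [Module (GroupRing G) N]
    {f g : PermQuot U hU →ₗ[GroupRing G] N} (h : ∀ c, f (mk U hU c) = g (mk U hU c)) : f = g :=
  LinearMap.ext fun m => by
    obtain ⟨c, rfl⟩ := mk_surjective m
    exact h c

/-- A section of a surjection from a free module is built directly. Choose preimages for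
representatives of the orbits and spread them by the group, sending points of `U` to zero. Because
the action is free, the element `γ x` carrying the representative to `x` is unique, so the choice is
equivariant. -/
lemma projective (hfree : ∀ (g : G) (x : X), g • x = x → g = 1) :
    Module.Projective (GroupRing G) (PermQuot U hU) := by
  classical
  refine Module.Projective.of_lifting_property'' fun f hf => ?_
  choose y hy using fun x : X => hf (mk U hU (Finsupp.single x 1))
  let ρ (x : X) : X := Quotient.out (Quotient.mk'' x : MulAction.orbitRel.Quotient G X)
  have hρ (x : X) : ∃ g : G, g • ρ x = x := by
    have h : (MulAction.orbitRel G X) x (ρ x) := (MulAction.orbitRel G X).symm (Quotient.mk_out x)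
    exact h
  have hρg (g : G) (x : X) : ρ (g • x) = ρ x :=
    congrArg Quotient.out (_root_.Quotient.sound' (s₁ := MulAction.orbitRel G X) ⟨g, rfl⟩)
  choose γ hγ using hρ
  have hγg (g : G) (x : X) : γ (g • x) = g * γ x := by
    have h1 := hγ (g • x)
    rw [hρg] at h1
    have h2 : (γ x)⁻¹ * (g⁻¹ * γ (g • x)) = 1 := hfree _ (ρ x) (by
      rw [mul_smul, mul_smul, h1, inv_smul_smul, inv_smul_eq_iff, hγ])
    rw [inv_mul_eq_one, eq_inv_mul_iff_mul_eq] at h2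
    exact h2.symm
  let s (x : X) : PermQuot U hU →₀ GroupRing G :=
    if x ∈ U then 0 else (MonoidAlgebra.single (γ x) (1 : ℤ) : GroupRing G) • y (ρ x)
  have hs (g : G) (x : X) : s (g • x) = (MonoidAlgebra.single g (1 : ℤ) : GroupRing G) • s x := by
    by_cases hx : x ∈ U
    · simp only [s, if_pos hx, if_pos (hU g x hx), smul_zero]
    · have hx' : g • x ∉ U := fun h => hx (by simpa using hU g⁻¹ _ h)
      simp only [s, if_neg hx, if_neg hx', smul_smul, hρg, hγg, MonoidAlgebra.single_mul_single,
        one_mul]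
  have hfs (x : X) : f (s x) = mk U hU (Finsupp.single x 1) := by
    by_cases hx : x ∈ U
    · simp only [s, if_pos hx, map_zero]
      exact (mk_eq_zero_iff.2 (Finsupp.single_mem_supported ℤ 1 hx)).symm
    · simp only [s, if_neg hx, map_smul, hy]
      refine (smul_mk _ _).trans ?_
      rw [Finsupp.mapDomain_single, hγ]
  let S : (X →₀ ℤ) →ₗ[ℤ] (PermQuot U hU →₀ GroupRing G) := Finsupp.linearCombination ℤ s
  have hS (x : X) (a : ℤ) : S (Finsupp.single x a) = a • s x := Finsupp.linearCombination_single ..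
  refine ⟨descLin S.toAddMonoidHom (fun c hc => ?_) (fun g c => ?_), ?_⟩
  · refine Finset.sum_eq_zero fun x hx => ?_
    have : x ∈ U := hc hx
    simp [s, this]
  · change S _ = _ • S c
    induction c using Finsupp.induction_linear with
    | zero => simp
    | add c c' h h' => rw [Finsupp.mapDomain_add, map_add, map_add, h, h', smul_add]
    | single x a => rw [Finsupp.mapDomain_single, hS, hS, hs, smul_comm]
  · refine linearMap_ext fun c => ?_
    change f (S c) = mk U hU c
    induction c using Finsupp.induction_linear with
    | zero => simp
    | add c c' h h' => rw [map_add, map_add, map_add, h, h']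
    | single x a =>
      rw [hS, map_zsmul f, hfs, ← map_zsmul (mk U hU), Finsupp.smul_single, smul_eq_mul, mul_one]

section Coinvariants

variable {Y : Type u} {L : Type u} [AddCommGroup L] [Module ℤ L]
  (q : X → Y) (hq : ∀ (g : G) (x : X), q (g • x) = q x)
  (π : (Y →₀ ℤ) →ₗ[ℤ] L) (hπ : ∀ c, π c = 0 ↔ c ∈ Finsupp.supported ℤ ℤ (q '' U))

include hq hπ in
/-- The map from the coinvariants to a quotient of the group of formal sums of orbits. -/
lemma exists_coinvariantsMap : ∃ F : TensorZ (PermQuot U hU) →ₗ[ℤ] L,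
    ∀ c, F (tmk _ (mk U hU c)) = π (Finsupp.mapDomain q c) := by
  classical
  obtain rfl : ‹Module ℤ L› = AddCommGroup.toIntModule L := Subsingleton.elim _ _
  have h0 (c) (hc : c ∈ Finsupp.supported ℤ ℤ U) : π (Finsupp.mapDomain q c) = 0 := by
    refine (hπ _).2 fun y hy => ?_
    obtain ⟨x, hx, rfl⟩ := Finset.mem_image.1 (Finsupp.mapDomain_support hy)
    exact ⟨x, hc hx, rfl⟩
  have h1 (g : G) (c : X →₀ ℤ) : π (Finsupp.mapDomain q (Finsupp.mapDomain (g • ·) c)) =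
      π (Finsupp.mapDomain q c) := by
    rw [← Finsupp.mapDomain_comp]
    congr 2
    exact funext (hq g)
  refine ⟨tdesc (desc (π.toAddMonoidHom.comp (Finsupp.lmapDomain ℤ ℤ q).toAddMonoidHom) h0)
    fun g m => ?_, fun c => tdesc_tmk _ _ _⟩
  obtain ⟨c, rfl⟩ := mk_surjective m
  rw [smul_mk]
  exact h1 g c

/-- The map from the coinvariants to a quotient of the group of formal sums of orbits. -/
def coinvariantsMap : TensorZ (PermQuot U hU) →ₗ[ℤ] L :=
  (exists_coinvariantsMap (hU := hU) q hq π hπ).choose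

lemma coinvariantsMap_tmk (c : X →₀ ℤ) :
    coinvariantsMap (hU := hU) q hq π hπ (tmk _ (mk U hU c)) = π (Finsupp.mapDomain q c) :=
  (exists_coinvariantsMap (hU := hU) q hq π hπ).choose_spec c

/-- In the coinvariants every point may be replaced by the chosen representative of its orbit. A sum
in the kernel is thus represented over `q '' U`, and since `U` is stable all representatives that
occur lie in `U`. -/
lemma coinvariantsMap_bijective (hqs : Function.Surjective q)
    (hq' : ∀ x x', q x = q x' → ∃ g : G, g • x = x') (hπs : Function.Surjective π) :
    Function.Bijective (coinvariantsMap (hU := hU) q hq π hπ) := by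
  classical
  obtain ⟨s, hs⟩ := hqs.hasRightInverse
  refine ⟨(injective_iff_map_eq_zero _).2 fun z hz => ?_, fun l => ?_⟩
  · obtain ⟨m, rfl⟩ := tmk_surjective _ z
    obtain ⟨c, rfl⟩ := mk_surjective m
    rw [coinvariantsMap_tmk, hπ] at hz
    have h1 (c : X →₀ ℤ) : tmk _ (mk U hU c) =
        tmk _ (mk U hU (Finsupp.mapDomain s (Finsupp.mapDomain q c))) := by
      induction c using Finsupp.induction_linear with
      | zero => simp
      | add c c' h h' => rw [Finsupp.mapDomain_add, Finsupp.mapDomain_add, map_add, map_add,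
          map_add, map_add, h, h']
      | single x a =>
        obtain ⟨g, hg⟩ := hq' x (s (q x)) (hs (q x)).symm
        rw [Finsupp.mapDomain_single, Finsupp.mapDomain_single, ← hg, ← tmk_smul _ g, smul_mk,
          Finsupp.mapDomain_single]
    rw [h1, mk_eq_zero_iff.2, map_zero]
    intro x hx
    obtain ⟨y, hy, rfl⟩ := Finset.mem_image.1 (Finsupp.mapDomain_support hx)
    obtain ⟨x, hxU, rfl⟩ := hz hy
    obtain ⟨g, hg⟩ := hq' x (s (q x)) (hs (q x)).symm
    rw [← hg]
    exact hU g x hxU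
  · obtain ⟨c, rfl⟩ := hπs l
    refine ⟨tmk _ (mk U hU (Finsupp.mapDomain s c)), ?_⟩
    rw [coinvariantsMap_tmk, ← Finsupp.mapDomain_comp, hs.comp_eq_id, Finsupp.mapDomain_id]

end Coinvariants

end PermQuot

end PermQuot

/-! ### Complexes of permutation modules -/

/-- A complex of quotients of free permutation modules. -/
structure PermComplex (G : Type u) [Group G] where
  X : ℕ → Type u
  act : ∀ n, MulAction G (X n)
  smul_eq : ∀ n (g : G) (x : X n), g • x = x → g = 1
  U : ∀ n, Set (X n)
  smul_mem : ∀ n (g : G), ∀ x ∈ U n, g • x ∈ U n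
  d : ∀ n, (X (n + 1) →₀ ℤ) →ₗ[ℤ] (X n →₀ ℤ)
  d_smul : ∀ n (g : G) (c : X (n + 1) →₀ ℤ),
    d n (Finsupp.mapDomain (g • ·) c) = Finsupp.mapDomain (g • ·) (d n c)
  d_mem : ∀ n, ∀ c ∈ Finsupp.supported ℤ ℤ (U (n + 1)), d n c ∈ Finsupp.supported ℤ ℤ (U n)
  d_d : ∀ n c, d n (d (n + 1) c) = 0

attribute [instance] PermComplex.act

namespace PermComplex

variable {G : Type u} [Group G] (A : PermComplex G)

/-- The modules of the complex. -/
abbrev M (n : ℕ) : ModuleCat.{u} (GroupRing G) := PermQuot (A.U n) (A.smul_mem n)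

/-- The class of a formal sum. -/
abbrev cls (n : ℕ) : (A.X n →₀ ℤ) →+ A.M n := PermQuot.mk (A.U n) (A.smul_mem n)

/-- The differentials of the complex. -/
def dLin (n : ℕ) : A.M (n + 1) →ₗ[GroupRing G] A.M n :=
  PermQuot.descLin ((A.cls n).comp (A.d n).toAddMonoidHom)
    (fun c hc => PermQuot.mk_eq_zero_iff.2 (A.d_mem n c hc)) fun g c =>
      (congrArg (A.cls n) (A.d_smul n g c)).trans (PermQuot.smul_mk g _).symm

/-- The associated complex of modules. -/
abbrev complex : ChainComplex (ModuleCat.{u} (GroupRing G)) ℕ where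
  X := A.M
  d := ChainComplex.of.d _ fun n => ModuleCat.ofHom (A.dLin n)
  shape _ _ h := ChainComplex.of_d_ne _ _ (Ne.symm h)
  d_comp_d' := by
    rintro _ _ n rfl rfl
    rw [ChainComplex.of_d, ChainComplex.of_d]
    refine ModuleCat.hom_ext (PermQuot.linearMap_ext fun c => ?_)
    exact (congrArg (A.cls n) (A.d_d n c)).trans (map_zero _)

lemma complex_d_mk (n : ℕ) (c : A.X (n + 1) →₀ ℤ) :
    A.complex.d (n + 1) n (A.cls (n + 1) c) = A.cls n (A.d n c) := by
  exact ConcreteCategory.congr_hom (ChainComplex.of_d A.M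
    (fun n => ModuleCat.ofHom (A.dLin n)) n) _

lemma projective (n : ℕ) : Module.Projective (GroupRing G) (A.complex.X n) :=
  PermQuot.projective (A.smul_eq n)

lemma exact_of_forall (n : ℕ)
    (h : ∀ c, A.d n c ∈ Finsupp.supported ℤ ℤ (A.U n) →
      ∃ b, A.d (n + 1) b - c ∈ Finsupp.supported ℤ ℤ (A.U (n + 1)))
    (x : A.complex.X (n + 1)) (hx : A.complex.d (n + 1) n x = 0) :
    ∃ y, A.complex.d (n + 2) (n + 1) y = x := by
  obtain ⟨c, rfl⟩ := PermQuot.mk_surjective x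
  obtain ⟨b, hb⟩ := h c (PermQuot.mk_eq_zero_iff.1 ((A.complex_d_mk n c).symm.trans hx))
  refine ⟨A.cls (n + 2) b, (A.complex_d_mk (n + 1) b).trans ?_⟩
  rw [← sub_eq_zero, ← map_sub]
  exact PermQuot.mk_eq_zero_iff.2 hb

end PermComplex

/-! ### Shifting homology -/

section Shift

variable {R : Type*} [Ring R] {K L K' L' : ChainComplex (ModuleCat.{u} R) ℕ}

/-- The maps on homology induced by a family of maps `K_n → L_(n+1)` commuting with the
differentials. -/
lemma exists_shiftHomology (f : ∀ n, K.X n ⟶ L.X (n + 1))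
    (hf : ∀ n x, L.d (n + 2) (n + 1) (f (n + 1) x) = f n (K.d (n + 1) n x))
    (hL : Subsingleton (L.X 0)) (n : ℕ) :
    ∃ F : K.homology n ⟶ L.homology (n + 1), ∀ (c : K.cycles n) (c' : L.cycles (n + 1)),
      L.iCycles (n + 1) c' = f n (K.iCycles n c) → F (K.homologyπ n c) = L.homologyπ (n + 1) c' := by
  have h1 : (K.iCycles n ≫ f n) ≫ L.d (n + 1) n = 0 := by
    refine ModuleCat.hom_ext (LinearMap.ext fun c => ?_)
    -- In degree 0 the image has to be a cycle of degree 1, which holds because `L` vanishes in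
    -- degree 0.
    cases n with
    | zero => exact Subsingleton.elim _ _
    | succ n =>
      refine (hf n _).trans ?_
      exact (congrArg (f n) (d_iCycles c n)).trans (map_zero (f n).hom)
  let g : K.cycles n ⟶ L.cycles (n + 1) := L.liftCycles (K.iCycles n ≫ f n) n (by simp) h1
  have hg (c : K.cycles n) : L.iCycles (n + 1) (g c) = f n (K.iCycles n c) :=
    ConcreteCategory.congr_hom (L.liftCycles_i (K.iCycles n ≫ f n) n (by simp) h1) c
  have h2 : K.toCycles (n + 1) n ≫ g ≫ L.homologyπ (n + 1) = 0 := by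
    refine ModuleCat.hom_ext (LinearMap.ext fun x => ?_)
    refine (homologyπ_eq_zero_iff _).2 ⟨f (n + 1) x, (hf n x).trans ?_⟩
    refine Eq.trans ?_ (hg _).symm
    exact congrArg (f n) (ConcreteCategory.congr_hom (K.toCycles_i (n + 1) n) x).symm
  let F := (K.homologyIsCokernel (n + 1) n (by simp)).desc
    (Limits.CokernelCofork.ofπ (g ≫ L.homologyπ (n + 1)) h2)
  have hF : K.homologyπ n ≫ F = g ≫ L.homologyπ (n + 1) :=
    (K.homologyIsCokernel (n + 1) n (by simp)).fac _ Limits.WalkingParallelPair.one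
  refine ⟨F, fun c c' hc => (ConcreteCategory.congr_hom hF c).trans ?_⟩
  exact congrArg (L.homologyπ (n + 1)) (iCycles_injective (n + 1) ((hg c).trans hc.symm))

/-- The maps on homology induced by a family of maps `K_n → L_(n+1)` commuting with the
differentials. -/
def shiftHomology (f : ∀ n, K.X n ⟶ L.X (n + 1))
    (hf : ∀ n x, L.d (n + 2) (n + 1) (f (n + 1) x) = f n (K.d (n + 1) n x))
    (hL : Subsingleton (L.X 0)) (n : ℕ) : K.homology n ⟶ L.homology (n + 1) :=
  (exists_shiftHomology f hf hL n).choose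

lemma shiftHomology_homologyπ (f : ∀ n, K.X n ⟶ L.X (n + 1))
    (hf : ∀ n x, L.d (n + 2) (n + 1) (f (n + 1) x) = f n (K.d (n + 1) n x))
    (hL : Subsingleton (L.X 0)) (n : ℕ) (c : K.cycles n) (c' : L.cycles (n + 1))
    (h : L.iCycles (n + 1) c' = f n (K.iCycles n c)) :
    shiftHomology f hf hL n (K.homologyπ n c) = L.homologyπ (n + 1) c' :=
  (exists_shiftHomology f hf hL n).choose_spec c c' h

lemma exists_cycles_shift (f : ∀ n, K.X n ⟶ L.X (n + 1))
    (hf : ∀ n x, L.d (n + 2) (n + 1) (f (n + 1) x) = f n (K.d (n + 1) n x))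
    (hL : Subsingleton (L.X 0)) (n : ℕ) (c : K.cycles n) :
    ∃ c' : L.cycles (n + 1), L.iCycles (n + 1) c' = f n (K.iCycles n c) := by
  refine exists_cycles _ fun j => ?_
  by_cases hj : j = n
  · subst hj
    cases j with
    | zero => exact Subsingleton.elim _ _
    | succ n => exact (hf n _).trans ((congrArg (f n) (d_iCycles c n)).trans (map_zero (f n).hom))
  · rw [L.shape _ _ (by simpa using hj)]
    rfl

lemma isIso_shiftHomology (f : ∀ n, K.X n ⟶ L.X (n + 1))
    (hf : ∀ n x, L.d (n + 2) (n + 1) (f (n + 1) x) = f n (K.d (n + 1) n x))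
    (hL : Subsingleton (L.X 0)) (hfb : ∀ n, Function.Bijective (f n)) (n : ℕ) :
    IsIso (shiftHomology f hf hL n) := by
  have : Mono (shiftHomology f hf hL n) := by
    rw [ModuleCat.mono_iff_injective, injective_iff_map_eq_zero]
    intro a ha
    obtain ⟨c, rfl⟩ := exists_homologyπ a
    obtain ⟨c', hc'⟩ := exists_cycles_shift f hf hL n c
    rw [shiftHomology_homologyπ f hf hL n c c' hc', homologyπ_eq_zero_iff] at ha
    obtain ⟨y, hy⟩ := ha
    obtain ⟨x, rfl⟩ := (hfb (n + 1)).2 y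
    rw [homologyπ_eq_zero_iff]
    exact ⟨x, (hfb n).1 ((hf n x).symm.trans (hy.trans hc'))⟩
  have : Epi (shiftHomology f hf hL n) := by
    rw [ModuleCat.epi_iff_surjective]
    intro b
    obtain ⟨c', rfl⟩ := exists_homologyπ b
    obtain ⟨x, hx⟩ := (hfb n).2 (L.iCycles (n + 1) c')
    obtain ⟨c, rfl⟩ := exists_cycles x fun j => by
      by_cases hj : j + 1 = n
      · subst hj
        refine (hfb j).1 ((hf j x).symm.trans ?_)
        rw [hx, d_iCycles]
        exact (map_zero (f j).hom).symm
      · rw [K.shape _ _ (by simpa using hj)]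
        rfl
    exact ⟨K.homologyπ n c, shiftHomology_homologyπ f hf hL n c c' hx.symm⟩
  exact isIso_of_mono_of_epi _

lemma shiftHomology_naturality (f : ∀ n, K.X n ⟶ L.X (n + 1))
    (hf : ∀ n x, L.d (n + 2) (n + 1) (f (n + 1) x) = f n (K.d (n + 1) n x))
    (hL : Subsingleton (L.X 0)) (f' : ∀ n, K'.X n ⟶ L'.X (n + 1))
    (hf' : ∀ n x, L'.d (n + 2) (n + 1) (f' (n + 1) x) = f' n (K'.d (n + 1) n x))
    (hL' : Subsingleton (L'.X 0)) (a : K ⟶ K') (b : L ⟶ L')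
    (h : ∀ n x, f' n (a.f n x) = b.f (n + 1) (f n x)) (n : ℕ) :
    HomologicalComplex.homologyMap a n ≫ shiftHomology f' hf' hL' n =
      shiftHomology f hf hL n ≫ HomologicalComplex.homologyMap b (n + 1) := by
  refine ModuleCat.hom_ext (LinearMap.ext fun x => ?_)
  obtain ⟨c, rfl⟩ := exists_homologyπ x
  obtain ⟨c', hc'⟩ := exists_cycles_shift f hf hL n c
  change shiftHomology f' hf' hL' n (HomologicalComplex.homologyMap a n (K.homologyπ n c)) =
    HomologicalComplex.homologyMap b (n + 1) (shiftHomology f hf hL n (K.homologyπ n c))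
  rw [shiftHomology_homologyπ f hf hL n c c' hc', homologyMap_homologyπ, homologyMap_homologyπ]
  refine shiftHomology_homologyπ f' hf' hL' n _ _ ?_
  rw [iCycles_cyclesMap, iCycles_cyclesMap, hc']
  exact (h n _).symm

end Shift

/-! ### Quotients of free acyclic semisimplicial sets -/

section FreeQuotients

variable {G : Type u} [Group G]

/-- A free action of a group on an acyclic semisimplicial set with given quotient. -/
structure FreeAction (G : Type u) [Group G] {A B : SemiSimp.{u}} [∀ n, MulAction G (A.X n)]
    (q : A ⟶ B) : Prop where
  δ_smul : ∀ {n : ℕ} (i : Fin (n + 2)) (g : G) (x : A.X (n + 1)), A.δ i (g • x) = g • A.δ i x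
  smul_eq : ∀ n (g : G) (x : A.X n), g • x = x → g = 1
  surjective : ∀ n, Function.Surjective (q.f n)
  map_smul : ∀ n (g : G) (x : A.X n), q.f n (g • x) = q.f n x
  exists_smul : ∀ n (x x' : A.X n), q.f n x = q.f n x' → ∃ g : G, g • x = x'
  acyclic : A.Acyclic
  nonempty : Nonempty (A.X 0)

namespace FreeAction

variable {A B A' B' : SemiSimp.{u}} [∀ n, MulAction G (A.X n)] [∀ n, MulAction G (A'.X n)]
  {q : A ⟶ B} {q' : A' ⟶ B'}

section

variable (S : FreeAction G q)

/-- The complex of permutation modules. -/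
abbrev perm : PermComplex G where
  X := A.X
  act := inferInstance
  smul_eq := S.smul_eq
  U _ := ∅
  smul_mem _ _ _ h := h.elim
  d := A.bd
  d_smul n g c := by
    exact SemiSimp.bd_mapDomain (A := A) (B := A) ⟨fun _ => (g • ·), fun i x => (S.δ_smul i g x).symm⟩ c
  d_mem n c hc := by
    rw [Finsupp.supported_empty, Submodule.mem_bot] at hc ⊢
    rw [hc, map_zero]
  d_d n c := A.bd_bd c

include S in
lemma exists_of_bd_eq_zero (n : ℕ) (c : A.X (n + 1) →₀ ℤ)
    (hc : A.bd n c ∈ Finsupp.supported ℤ ℤ (∅ : Set (A.X n))) :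
    ∃ b, A.bd (n + 1) b - c ∈ Finsupp.supported ℤ ℤ (∅ : Set (A.X (n + 1))) := by
  rw [Finsupp.supported_empty, Submodule.mem_bot] at hc
  obtain ⟨b, hb⟩ := S.acyclic.exists_bd_eq n c hc
  exact ⟨b, by rw [hb, sub_self]; exact zero_mem _⟩

end

variable (G) in
/-- The trivial module `ℤ`. -/
abbrev triv : ModuleCat.{u} (GroupRing G) :=
  PermQuot (X := PUnit.{u + 1}) ∅ (fun _ _ h => h.elim)

variable (G) in
/-- The class of a formal sum in the trivial module. -/
abbrev trivMk : (PUnit.{u + 1} →₀ ℤ) →+ triv G :=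
  PermQuot.mk (X := PUnit.{u + 1}) ∅ (fun _ _ h => h.elim)

variable (S : FreeAction G q) (S' : FreeAction G q')

/-- The augmentation. -/
def aug : S.perm.M 0 →ₗ[GroupRing G] triv G :=
  PermQuot.descLin ((trivMk G).comp (Finsupp.lmapDomain ℤ ℤ fun _ => PUnit.unit).toAddMonoidHom)
    (fun c hc => by
      rw [Finsupp.supported_empty, Submodule.mem_bot] at hc
      rw [hc, map_zero]) fun g c => by
      refine Eq.trans ?_ (PermQuot.smul_mk g _).symm
      refine congrArg (trivMk G) (Finsupp.mapDomain_comp.symm.trans (Eq.trans ?_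
        (Finsupp.mapDomain_comp (f := fun _ : A.X 0 => PUnit.unit.{u + 1}))))
      rfl

lemma aug_cls (c : A.X 0 →₀ ℤ) :
    S.aug (S.perm.cls 0 c) = trivMk G (Finsupp.mapDomain (fun _ => PUnit.unit) c) := rfl

lemma aug_cls_eq_zero_iff (c : A.X 0 →₀ ℤ) : S.aug (S.perm.cls 0 c) = 0 ↔ SemiSimp.deg _ c = 0 := by
  rw [aug_cls, PermQuot.mk_eq_zero_iff, Finsupp.supported_empty, Submodule.mem_bot,
    ← SemiSimp.deg_mapDomain (fun _ => PUnit.unit) c]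
  generalize Finsupp.mapDomain (fun _ => PUnit.unit) c = e
  have he : e = Finsupp.single PUnit.unit (e PUnit.unit) := Finsupp.unique_single e
  rw [he, SemiSimp.deg_single, Finsupp.single_eq_zero]

/-- The resolution of the trivial module. -/
def resolution : ProjectiveResolution (triv G) :=
  mkResolution S.perm.complex S.perm.projective (ModuleCat.ofHom S.aug)
    (by
      refine ModuleCat.hom_ext (PermQuot.linearMap_ext fun c => ?_)
      refine (congrArg S.aug (S.perm.complex_d_mk 0 c)).trans ?_
      exact (S.aug_cls_eq_zero_iff _).2 (SemiSimp.deg_bd c))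
    (by
      intro y
      obtain ⟨e, rfl⟩ := PermQuot.mk_surjective y
      obtain ⟨x⟩ := S.nonempty
      refine ⟨S.perm.cls 0 (Finsupp.single x (e PUnit.unit)), ?_⟩
      refine (S.aug_cls _).trans (congrArg (trivMk G) ?_)
      rw [Finsupp.mapDomain_single]
      exact (Finsupp.unique_single e).symm)
    (by
      intro x hx
      obtain ⟨c, rfl⟩ := PermQuot.mk_surjective x
      obtain ⟨b, hb⟩ := S.acyclic.exists_bd_eq_zero c ((S.aug_cls_eq_zero_iff c).1 hx)
      exact ⟨S.perm.cls 1 b, (S.perm.complex_d_mk 0 b).trans (congrArg (S.perm.cls 0) hb)⟩)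
    fun n => S.perm.exact_of_forall n (S.exists_of_bd_eq_zero n)

/-- The linear maps induced by an equivariant map. -/
def mapLin (f : A ⟶ A') (hf : ∀ n (g : G) (x : A.X n), f.f n (g • x) = g • f.f n x) (n : ℕ) :
    S.perm.M n →ₗ[GroupRing G] S'.perm.M n :=
  PermQuot.descLin ((S'.perm.cls n).comp (Finsupp.lmapDomain ℤ ℤ (f.f n)).toAddMonoidHom)
    (fun c hc => by
      rw [Finsupp.supported_empty, Submodule.mem_bot] at hc
      rw [hc, map_zero]) fun g c => by
      refine Eq.trans ?_ (PermQuot.smul_mk g _).symm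
      refine congrArg (S'.perm.cls n) ?_
      refine Finsupp.mapDomain_comp.symm.trans (Eq.trans ?_ Finsupp.mapDomain_comp)
      congr 1
      exact funext (hf n g)

/-- The map of complexes induced by an equivariant map. -/
def map (f : A ⟶ A') (hf : ∀ n (g : G) (x : A.X n), f.f n (g • x) = g • f.f n x) :
    S.perm.complex ⟶ S'.perm.complex where
  f n := ModuleCat.ofHom (S.mapLin S' f hf n)
  comm' := by
    rintro _ n rfl
    refine ModuleCat.hom_ext (PermQuot.linearMap_ext fun c => ?_)
    refine (S'.perm.complex_d_mk n (Finsupp.mapDomain (f.f (n + 1)) c)).trans ?_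
    refine (congrArg (S'.perm.cls n) (SemiSimp.bd_mapDomain f c)).trans ?_
    exact (congrArg (S.mapLin S' f hf n) (S.perm.complex_d_mk n c)).symm

/-- Both complexes are projective resolutions of the trivial module and the map lies over its
identity, so after tensoring it induces the identity of `Tor`. -/
lemma quasiIso_tensor_map (f : A ⟶ A') (hf : ∀ n (g : G) (x : A.X n), f.f n (g • x) = g • f.f n x) :
    QuasiIso (((tensorZ G).mapHomologicalComplex _).map (S.map S' f hf)) := by
  refine ⟨fun n => ?_⟩
  rw [quasiIsoAt_iff_isIso_homologyMap]
  have h := ProjectiveResolution.isoLeftDerivedObj_hom_naturality (𝟙 (triv G)) S.resolution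
    S'.resolution (S.map S' f hf) (by
      refine Eq.trans ?_ (Category.comp_id _).symm
      refine ModuleCat.hom_ext (PermQuot.linearMap_ext fun c => ?_)
      have h1 : S.resolution.π.f 0 = ModuleCat.ofHom S.aug := mkResolution_π_f_zero ..
      have h2 : S'.resolution.π.f 0 = ModuleCat.ofHom S'.aug := mkResolution_π_f_zero ..
      refine (ConcreteCategory.congr_hom h2 _).trans (Eq.trans ?_
        (ConcreteCategory.congr_hom h1 _).symm)
      refine congrArg (trivMk G) ?_
      exact Finsupp.mapDomain_comp.symm) (tensorZ G) n
  rw [CategoryTheory.Functor.map_id, Category.id_comp, ← Iso.inv_comp_eq] at h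
  have h3 : IsIso ((S.resolution.isoLeftDerivedObj (tensorZ G) n).inv ≫
    (S'.resolution.isoLeftDerivedObj (tensorZ G) n).hom) := IsIso.comp_isIso
  rw [h] at h3
  exact h3

/-- The coinvariants of a permutation module are the formal sums of orbits. -/
def coinv (n : ℕ) : TensorZ (S.perm.M n) →ₗ[ℤ] (B.X n →₀ ℤ) :=
  PermQuot.coinvariantsMap (q.f n) (S.map_smul n) LinearMap.id fun c => by
    rw [Set.image_empty, Finsupp.supported_empty, Submodule.mem_bot, LinearMap.id_apply]

lemma coinv_tmk (n : ℕ) (c : A.X n →₀ ℤ) :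
    S.coinv n (tmk _ (S.perm.cls n c)) = Finsupp.mapDomain (q.f n) c :=
  PermQuot.coinvariantsMap_tmk ..

lemma coinv_bijective (n : ℕ) : Function.Bijective (S.coinv n) :=
  PermQuot.coinvariantsMap_bijective _ _ _ _ (S.surjective n) (S.exists_smul n)
    Function.surjective_id

/-- The coinvariants of the complex of permutation modules are the chains of the quotient. -/
def coinvariants : ((tensorZ G).mapHomologicalComplex _).obj S.perm.complex ⟶ B.chains where
  f n := ModuleCat.ofHom (S.coinv n)
  comm' := by
    rintro _ n rfl
    refine ModuleCat.hom_ext (LinearMap.ext fun z => ?_)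
    obtain ⟨m, rfl⟩ := tmk_surjective _ z
    obtain ⟨c, rfl⟩ := PermQuot.mk_surjective m
    refine (congrArg (B.chains.d (n + 1) n) (S.coinv_tmk (n + 1) c)).trans ?_
    refine (B.chains_d_apply n _).trans ((SemiSimp.bd_mapDomain q c).trans ?_)
    refine (S.coinv_tmk n (A.bd n c)).symm.trans ?_
    exact congrArg (fun m => S.coinv n (tmk _ m)) (S.perm.complex_d_mk n c).symm

instance : IsIso S.coinvariants := by
  have (n : ℕ) : IsIso (S.coinvariants.f n) :=
    (ConcreteCategory.isIso_iff_bijective _).2 (S.coinv_bijective n)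
  exact HomologicalComplex.Hom.isIso_of_components _

include S S' in
/-- An equivariant map of acyclic semisimplicial sets with free actions induces a homology
isomorphism of the quotients. -/
lemma quasiIso (f : A ⟶ A') (hf : ∀ n (g : G) (x : A.X n), f.f n (g • x) = g • f.f n x)
    (k : B ⟶ B') (hk : q ≫ k = f ≫ q') : QuasiIso (SemiSimp.chainsFunctor.map k) := by
  have h1 := S.quasiIso_tensor_map S' f hf
  have h2 : S.coinvariants ≫ SemiSimp.chainsFunctor.map k =
      ((tensorZ G).mapHomologicalComplex _).map (S.map S' f hf) ≫ S'.coinvariants := by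
    refine HomologicalComplex.Hom.ext (funext fun n => ModuleCat.hom_ext (LinearMap.ext fun z => ?_))
    obtain ⟨m, rfl⟩ := tmk_surjective _ z
    obtain ⟨c, rfl⟩ := PermQuot.mk_surjective m
    refine (congrArg (Finsupp.mapDomain (k.f n)) (S.coinv_tmk n c)).trans ?_
    refine Eq.trans ?_ (S'.coinv_tmk n (Finsupp.mapDomain (f.f n) c)).symm
    rw [← Finsupp.mapDomain_comp, ← Finsupp.mapDomain_comp]
    exact congrArg (fun φ : A ⟶ B' => Finsupp.mapDomain (φ.f n) c) hk
  rw [← quasiIso_iff_comp_left S.coinvariants, h2]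
  infer_instance

end FreeAction

end FreeQuotients

/-! ### The bar construction and singular chains of classifying spaces -/

section Bar

variable {G G' : Type u} [Group G] [Group G']

open EG

/-- In homogeneous coordinates this is the evident identity for omitting two entries; every tuple is
the tuple of quotients of its partial products. -/
lemma barFace_barFace {n : ℕ} {i j : Fin (n + 2)} (h : i ≤ j) (x : Fin (n + 2) → G) :
    barFace i (barFace j.succ x) = barFace j (barFace i.castSucc x) := by
  rw [← quots_partialProd x, barFace_quots, barFace_quots, barFace_quots, barFace_quots]
  exact congrArg quots ((Tup G).δ_δ h (Fin.partialProd x))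

/-- The semisimplicial set of the bar construction. -/
abbrev Nerve (G : Type u) [Group G] : SemiSimp.{u} where
  X n := Fin n → G
  δ i x := barFace i x
  δ_δ h x := barFace_barFace h x

/-- The map of bar constructions induced by a homomorphism. -/
def Nerve.map (φ : G →* G') : Nerve G ⟶ Nerve G' :=
  ⟨fun _ x => φ ∘ x, fun i x => (barFace_comp φ i x).symm⟩

lemma Nerve.map_f (φ : G →* G') (n : ℕ) (x : Fin n → G) : (Nerve.map φ).f n x = φ ∘ x := rfl

/-- The map from tuples to the bar construction. -/
def quotsHom (G : Type u) [Group G] : Tup G ⟶ Nerve G :=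
  ⟨fun _ v => quots v, fun i v => (barFace_quots i v).symm⟩

/-- The simplices of the bar construction as singular simplices. -/
def nerveToSing (G : Type u) [Group G] : Nerve G ⟶ sing.obj (TopCat.of (BG G)) :=
  ⟨fun _ x => ⟨mkBG x, continuous_mkBG x⟩, fun i x =>
    ContinuousMap.ext fun t => (mkBG_face i x t).symm⟩

/-- Tuples as singular simplices. -/
def tupToSing (S : Type u) : Tup S ⟶ sing.obj (TopCat.of (EG S)) :=
  ⟨fun _ v => ⟨EG.mk v, EG.continuous_mk v⟩, fun i v => ContinuousMap.ext fun t => (EG.mk_face i v t).symm⟩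

lemma nerveToSing_naturality (φ : G →* G') :
    Nerve.map φ ≫ nerveToSing G' = nerveToSing G ≫ sing.map (TopCat.ofHom (BG.map φ)) := rfl

lemma tup_acyclic (S : Type u) [Nonempty S] : (Tup S).Acyclic where
  exists_bd_eq n c hc := by
    let b : S := Classical.arbitrary S
    refine ⟨coneOp b (n + 1) c, ?_⟩
    rw [bd_coneOp, hc, map_zero, sub_zero]
  exists_bd_eq_zero c hc := by
    let b : S := Classical.arbitrary S
    refine ⟨coneOp b 0 c, ?_⟩
    rw [bd_coneOp_zero, hc, Finsupp.single_zero, sub_zero]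

lemma freeAction_tup (G : Type u) [Group G] : FreeAction G (quotsHom G) where
  δ_smul i g v := rfl
  smul_eq n g v h := by
    have := congrFun h 0
    exact mul_eq_right.1 this
  surjective n x := ⟨Fin.partialProd x, quots_partialProd x⟩
  map_smul n g v := quots_mul g v
  exists_smul n v w h := by
    obtain ⟨g, hg⟩ := exists_mul_of_quots_eq h
    exact ⟨g, hg.symm⟩
  acyclic := tup_acyclic G
  nonempty := ⟨fun _ => 1⟩

instance : ContinuousConstSMul G (EG G) := ⟨fun g => (EG.map (g * ·)).continuous⟩

instance (n : ℕ) : MulAction G ((sing.obj (TopCat.of (EG G))).X n) :=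
  inferInstanceAs (MulAction G C(Simp n, EG G))

/-- Covering theory: simplices of `BG` lift to `EG`, two lifts differ by an element of the group,
and the action is free. Acyclicity comes from contractibility of `EG`. -/
lemma freeAction_sing (G : Type u) [Group G] :
    FreeAction G (sing.map (TopCat.ofHom (proj G))) where
  δ_smul i g σ := rfl
  smul_eq n g σ h := smul_left_injective (x := σ (verts n 0))
    ((DFunLike.congr_fun h (verts n 0)).trans (one_smul G _).symm)
  surjective n σ := exists_lift σ
  map_smul n g σ := ContinuousMap.ext fun t => proj_smul g (σ t)
  exists_smul n σ τ h := by
    obtain ⟨g, hg⟩ := exists_smul_of_comp_eq (τ := τ) (τ' := σ) h.symm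
    exact ⟨g, hg⟩
  acyclic := by
    have : ContractibleSpace (TopCat.of (EG G)) := inferInstanceAs (ContractibleSpace (EG G))
    exact sing_acyclic _
  nonempty := ⟨⟨EG.mk fun _ => 1, EG.continuous_mk _⟩⟩

/-- The singular chains of the classifying space are computed by the bar construction. -/
lemma quasiIso_nerveToSing (G : Type u) [Group G] :
    QuasiIso (SemiSimp.chainsFunctor.map (nerveToSing G)) :=
  (freeAction_tup G).quasiIso (freeAction_sing G) (tupToSing G) (fun _ _ _ => rfl) _ rfl

lemma nerveMap_subtype_injective (H : Subgroup G) (n : ℕ) :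
    Function.Injective ((Nerve.map H.subtype).f n) :=
  fun _ _ h => funext fun j => Subtype.ext (congrFun h j)

/-- The comparison of relative chains of the bar construction with relative singular chains. -/
abbrev relNerveToSing (H : Subgroup G) :
    relChains (Nerve.map H.subtype) ⟶ relSing (TopCat.ofHom (BG.map H.subtype)) :=
  relChainsMap (Nerve.map H.subtype) (sing.map (TopCat.ofHom (BG.map H.subtype)))
    (nerveToSing H) (nerveToSing G) (nerveToSing_naturality H.subtype)

lemma quasiIso_relNerveToSing (H : Subgroup G) : QuasiIso (relNerveToSing H) :=
  relChainsMap_quasiIso _ _ _ _ _ (nerveMap_subtype_injective H)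
    (sing_map_injective _ (bgMap_subtype_injective H)) (quasiIso_nerveToSing H)
    (quasiIso_nerveToSing G)

end Bar

/-! ### Lifting elements of the augmentation kernel -/

section AugKer

variable {G G' : Type u} [Group G] [Group G'] {H : Subgroup G} {H' : Subgroup G'}

lemma augKer.val_injective : Function.Injective (augKer.val (G := G) (H := H)) := fun _ _ h =>
  Subtype.ext h

lemma sumCoeff_val (x : augKer G H) : sumCoeff (G ⧸ H) (augKer.val x) = 0 := x.2

lemma sumCoeff_ofCoeff {X : Type u} (c : X →₀ ℤ) :
    sumCoeff X (MonoidAlgebra.ofCoeff c) = SemiSimp.deg X c := by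
  induction c using Finsupp.induction_linear with
  | zero => exact (map_zero _).trans (map_zero _).symm
  | add c c' h h' =>
    rw [map_add, ← h, ← h']
    exact map_add (sumCoeff X) (MonoidAlgebra.ofCoeff c) (MonoidAlgebra.ofCoeff c')
  | single x a =>
    rw [SemiSimp.deg_single]
    exact sumCoeff_single X x a

/-- Additive maps into the augmentation kernel. -/
def augKer.lift {A : Type u} [AddCommGroup A] (ψ : A →+ ((G ⧸ H) →₀ ℤ))
    (hψ : ∀ a, SemiSimp.deg _ (ψ a) = 0) : A →+ augKer G H where
  toFun a := ⟨(Representation.ofMulAction ℤ G (G ⧸ H)).asModuleEquiv.symm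
    (MonoidAlgebra.ofCoeff (ψ a)), (sumCoeff_ofCoeff _).trans (hψ a)⟩
  map_zero' := augKer.val_injective (congrArg MonoidAlgebra.ofCoeff (map_zero ψ))
  map_add' a b := augKer.val_injective (congrArg MonoidAlgebra.ofCoeff (map_add ψ a b))

lemma augKer.val_smul (g : G) (x : augKer G H) :
    augKer.val ((MonoidAlgebra.single g (1 : ℤ) : GroupRing G) • x) =
      MonoidAlgebra.ofCoeff (Finsupp.mapDomain (g • ·) (augKer.val x).coeff) :=
  ((Representation.ofMulAction ℤ G (G ⧸ H)).single_smul 1 g _).trans (one_smul _ _)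

end AugKer

/-! ### The relative bar resolution -/

section RelBar

open EG

variable {G G' : Type u} [Group G] [Group G'] (H : Subgroup G) (H' : Subgroup G')

/-- The tuples whose entries lie in a single coset. -/
def cosetTuples (n : ℕ) : Set (Fin (n + 1) → G) := {v | ∀ j, (v 0)⁻¹ * v j ∈ H}

lemma smul_mem_cosetTuples {n : ℕ} (g : G) (v : Fin (n + 1) → G) (hv : v ∈ cosetTuples H n) :
    g • v ∈ cosetTuples H n := fun j => by
  have := hv j
  rwa [Pi.smul_apply, Pi.smul_apply, smul_eq_mul, smul_eq_mul, mul_inv_rev, mul_assoc,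
    inv_mul_cancel_left]

variable {H} in
lemma inv_mul_mem_of_mem_cosetTuples {n : ℕ} {v : Fin (n + 1) → G} (hv : v ∈ cosetTuples H n)
    (i j : Fin (n + 1)) : (v i)⁻¹ * v j ∈ H := by
  have := H.mul_mem (H.inv_mem (hv i)) (hv j)
  rwa [mul_inv_rev, inv_inv, mul_assoc, mul_inv_cancel_left] at this

lemma mapDomain_mem_supported {X Y : Type*} {f : X → Y} {U : Set X} {V : Set Y}
    (hf : ∀ x ∈ U, f x ∈ V) {c : X →₀ ℤ} (hc : c ∈ Finsupp.supported ℤ ℤ U) :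
    Finsupp.mapDomain f c ∈ Finsupp.supported ℤ ℤ V := by
  classical
  rw [Finsupp.mem_supported] at hc ⊢
  intro x hx
  obtain ⟨y, hy, rfl⟩ := Finset.mem_image.1 (Finsupp.mapDomain_support hx)
  exact hf y (hc hy)

lemma bd_mem_supported_cosetTuples {n : ℕ} {c : (Fin (n + 2) → G) →₀ ℤ}
    (hc : c ∈ Finsupp.supported ℤ ℤ (cosetTuples H (n + 1))) :
    (Tup G).bd n c ∈ Finsupp.supported ℤ ℤ (cosetTuples H n) := by
  rw [SemiSimp.bd_apply]
  refine Submodule.sum_mem _ fun i _ => Submodule.smul_mem _ _ ?_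
  exact mapDomain_mem_supported (f := fun v => v ∘ i.succAbove) (V := cosetTuples H n)
    (fun v hv j => inv_mul_mem_of_mem_cosetTuples hv (i.succAbove 0) (i.succAbove j)) hc

/-- A tuple in a single coset is a translate of a tuple of elements of `H`, so the orbits of coset
tuples are the simplices of the bar construction of `H`. -/
lemma image_quots_cosetTuples (n : ℕ) :
    quots '' cosetTuples H n = Set.range ((Nerve.map H.subtype).f n) := by
  ext x
  constructor
  · rintro ⟨v, hv, rfl⟩
    exact ⟨fun k => ⟨quots v k, inv_mul_mem_of_mem_cosetTuples hv _ _⟩, rfl⟩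
  · rintro ⟨x, rfl⟩
    refine ⟨H.subtype ∘ Fin.partialProd x, fun j => ?_, ?_⟩
    · exact H.mul_mem (H.inv_mem (Subtype.prop _)) (Subtype.prop _)
    · rw [quots_comp, quots_partialProd, Nerve.map_f]

lemma relMk_eq_zero_iff_mem_supported (n : ℕ) (c : (Fin n → G) →₀ ℤ) :
    relMk (Nerve.map H.subtype) n c = 0 ↔
      c ∈ Finsupp.supported ℤ ℤ (quots '' cosetTuples H n) := by
  rw [relMk_eq_zero_iff, image_quots_cosetTuples, ← Set.image_univ, ← Finsupp.lmapDomain_supported,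
    Finsupp.supported_univ, Submodule.map_top]
  rfl

/-- Both bar constructions have a single vertex, so the relative chains begin in degree 1. This
makes the shift of degree possible. -/
lemma subsingleton_relChains_nerve_zero :
    Subsingleton ((relChains (Nerve.map H.subtype)).X 0) := by
  refine subsingleton_of_forall_eq 0 fun x => ?_
  obtain ⟨c, rfl⟩ := relMk_surjective _ _ x
  refine (relMk_eq_zero_iff _ _).2 ⟨Finsupp.mapDomain (fun _ => Fin.elim0) c, ?_⟩
  rw [← Finsupp.mapDomain_comp]
  refine Eq.trans ?_ Finsupp.mapDomain_id
  congr 1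
  exact funext fun x => Subsingleton.elim _ _

/-- The complex of tuples modulo tuples in a single coset. -/
abbrev relPerm : PermComplex G where
  -- The index is lowered by one: every 1-tuple lies in a single coset, so the quotient by coset
  -- tuples begins with pairs.
  X n := Fin (n + 2) → G
  act := inferInstance
  smul_eq n g v h := (freeAction_tup G).smul_eq (n + 1) g v h
  U n := cosetTuples H (n + 1)
  smul_mem _ g v hv := smul_mem_cosetTuples H g v hv
  d n := (Tup G).bd (n + 1)
  d_smul _ g c := bd_tup_mapDomain (g * ·) c
  d_mem _ _ hc := bd_mem_supported_cosetTuples H hc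
  d_d _ c := (Tup G).bd_bd c

/-! ### Exactness of the relative bar resolution. -/

/-- A representative of the coset of an element. -/
def cosetRep (g : G) : G := Quotient.out (g : G ⧸ H)

lemma coe_cosetRep (g : G) : ((cosetRep H g : G) : G ⧸ H) = g := Quotient.out_eq' _

lemma cosetRep_eq {g g' : G} (h : g⁻¹ * g' ∈ H) : cosetRep H g = cosetRep H g' :=
  congrArg Quotient.out (QuotientGroup.eq.2 h)

/-- Prepending the representative of the coset to a tuple. -/
def prependRep (n : ℕ) : ((Fin (n + 1) → G) →₀ ℤ) →ₗ[ℤ] ((Fin (n + 2) → G) →₀ ℤ) :=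
  Finsupp.lmapDomain ℤ ℤ fun v => (Fin.cons (cosetRep H (v 0)) v : Fin (n + 2) → G)

lemma prependRep_single {n : ℕ} (v : Fin (n + 1) → G) (a : ℤ) :
    prependRep H n (Finsupp.single v a) =
      Finsupp.single (Fin.cons (cosetRep H (v 0)) v : Fin (n + 2) → G) a := by
  simp [prependRep]

lemma prependRep_mem_supported {n : ℕ} {c : (Fin (n + 1) → G) →₀ ℤ}
    (hc : c ∈ Finsupp.supported ℤ ℤ (cosetTuples H n)) :
    prependRep H n c ∈ Finsupp.supported ℤ ℤ (cosetTuples H (n + 1)) := by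
  refine mapDomain_mem_supported (fun v hv j => ?_) hc
  rw [Fin.cons_zero]
  refine Fin.cases ?_ (fun j => ?_) j
  · rw [Fin.cons_zero, inv_mul_cancel]
    exact H.one_mem
  · rw [Fin.cons_succ]
    have h1 : (cosetRep H (v 0))⁻¹ * v 0 ∈ H := QuotientGroup.eq.1 (coe_cosetRep H (v 0))
    have := H.mul_mem h1 (hv j)
    rwa [mul_assoc, mul_inv_cancel_left] at this

/-- On a coset tuple all faces have the same coset, so the prepended vertex is constant and the cone
formula holds. This contracts the coset tuples in positive degrees. -/
lemma bd_prependRep {n : ℕ} {c : (Fin (n + 2) → G) →₀ ℤ}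
    (hc : c ∈ Finsupp.supported ℤ ℤ (cosetTuples H (n + 1))) :
    (Tup G).bd (n + 1) (prependRep H (n + 1) c) = c - prependRep H n ((Tup G).bd n c) := by
  rw [Finsupp.supported_eq_span_single] at hc
  refine LinearMap.eqOn_span (f := (Tup G).bd (n + 1) ∘ₗ prependRep H (n + 1))
    (g := LinearMap.id - prependRep H n ∘ₗ (Tup G).bd n) ?_ hc
  rintro _ ⟨v, hv, rfl⟩
  change (Tup G).bd (n + 1) (prependRep H (n + 1) (Finsupp.single v 1)) =
    Finsupp.single v 1 - prependRep H n ((Tup G).bd n (Finsupp.single v 1))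
  rw [prependRep_single, bd_single_cons, SemiSimp.bd_single, map_sum]
  congr 1
  refine Finset.sum_congr rfl fun i _ => ?_
  rw [_root_.map_smul, prependRep_single,
    cosetRep_eq H (inv_mul_mem_of_mem_cosetTuples hv 0 (i.succAbove 0))]
  rfl

lemma bd_prependRep_zero (c : (Fin 1 → G) →₀ ℤ) :
    (Tup G).bd 0 (prependRep H 0 c) =
      c - Finsupp.mapDomain (fun v _ => cosetRep H (v 0)) c := by
  suffices h : (Tup G).bd 0 ∘ₗ prependRep H 0 =
      LinearMap.id - Finsupp.lmapDomain ℤ ℤ (fun v _ => cosetRep H (v 0)) from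
    LinearMap.congr_fun h c
  refine Finsupp.lhom_ext fun v a => ?_
  change (Tup G).bd 0 (prependRep H 0 (Finsupp.single v a)) =
    Finsupp.single v a - Finsupp.mapDomain _ (Finsupp.single v a)
  rw [prependRep_single, SemiSimp.bd_zero_single, Finsupp.mapDomain_single]
  congr 2
  funext j
  rw [Subsingleton.elim (α := Fin 1) j 0]
  rfl

/-- If `∂c` is a sum of coset tuples, it is also the boundary of its own cone, which consists of
coset tuples. Subtracting that cone from `c` leaves a cycle, which bounds among all tuples. -/
lemma relPerm_exact (n : ℕ) (x : (relPerm H).complex.X (n + 1))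
    (hx : (relPerm H).complex.d (n + 1) n x = 0) :
    ∃ y, (relPerm H).complex.d (n + 2) (n + 1) y = x := by
  refine (relPerm H).exact_of_forall n (fun c hc => ?_) x hx
  have h1 := bd_prependRep H hc
  rw [SemiSimp.bd_bd, map_zero, sub_zero] at h1
  obtain ⟨b, hb⟩ := (tup_acyclic G).exists_bd_eq (n + 1)
    (c - prependRep H (n + 1) ((Tup G).bd (n + 1) c)) (by rw [map_sub, h1, sub_self])
  refine ⟨b, ?_⟩
  change (Tup G).bd (n + 2) b - c ∈ _
  rw [hb, sub_sub_cancel_left]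
  exact neg_mem (prependRep_mem_supported H hc)

/-- The formal sum of cosets of a formal sum of elements. -/
def toCosets : ((Fin 1 → G) →₀ ℤ) →ₗ[ℤ] ((G ⧸ H) →₀ ℤ) :=
  Finsupp.lmapDomain ℤ ℤ fun v => (v 0 : G ⧸ H)

lemma toCosets_apply (c : (Fin 1 → G) →₀ ℤ) :
    toCosets H c = Finsupp.mapDomain (fun v : Fin 1 → G => (v 0 : G ⧸ H)) c := rfl

lemma toCosets_bd_eq_zero {c : (Fin 2 → G) →₀ ℤ}
    (hc : c ∈ Finsupp.supported ℤ ℤ (cosetTuples H 1)) : toCosets H ((Tup G).bd 0 c) = 0 := by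
  rw [Finsupp.supported_eq_span_single] at hc
  refine LinearMap.eqOn_span (f := toCosets H ∘ₗ (Tup G).bd 0) (g := 0) ?_ hc
  rintro _ ⟨v, hv, rfl⟩
  change toCosets H ((Tup G).bd 0 (Finsupp.single v 1)) = 0
  rw [SemiSimp.bd_zero_single, map_sub, toCosets_apply, toCosets_apply, Finsupp.mapDomain_single,
    Finsupp.mapDomain_single, sub_eq_zero]
  congr 1
  exact (QuotientGroup.eq.2 (inv_mul_mem_of_mem_cosetTuples hv _ _))

/-- Joining every vertex to the representative of its coset moves `∂c` to a sum of representatives,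
and this sum depends only on the image in `C_0(G/H)`, here zero. So `∂c` bounds a chain of coset
tuples, and the difference of `c` and that chain is a cycle, hence a boundary. -/
lemma mem_supported_of_toCosets_bd_eq_zero {c : (Fin 2 → G) →₀ ℤ}
    (hc : toCosets H ((Tup G).bd 0 c) = 0) :
    ∃ b, (Tup G).bd 1 b - c ∈ Finsupp.supported ℤ ℤ (cosetTuples H 1) := by
  have h1 := bd_prependRep_zero H ((Tup G).bd 0 c)
  have h2 : Finsupp.mapDomain (fun (v : Fin 1 → G) (_ : Fin 1) => cosetRep H (v 0))
      ((Tup G).bd 0 c) = Finsupp.mapDomain (fun x _ => Quotient.out x)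
        (toCosets H ((Tup G).bd 0 c)) := by
    rw [toCosets_apply, ← Finsupp.mapDomain_comp]
    rfl
  rw [h2, hc, Finsupp.mapDomain_zero, sub_zero] at h1
  obtain ⟨b, hb⟩ := (tup_acyclic G).exists_bd_eq 0
    (c - prependRep H 0 ((Tup G).bd 0 c)) (by rw [map_sub, h1, sub_self])
  refine ⟨b, ?_⟩
  rw [hb, sub_sub_cancel_left]
  refine neg_mem (prependRep_mem_supported H fun v _ j => ?_)
  rw [Subsingleton.elim (α := Fin 1) j 0, inv_mul_cancel]
  exact H.one_mem

lemma deg_toCosets_bd (c : (Fin 2 → G) →₀ ℤ) : SemiSimp.deg _ (toCosets H ((Tup G).bd 0 c)) = 0 := by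
  exact (SemiSimp.deg_mapDomain (fun v : Fin 1 → G => (v 0 : G ⧸ H)) _).trans
    (SemiSimp.deg_bd (A := Tup G) c)

/-- The augmentation of the relative bar resolution on formal sums. -/
def relAugSum : ((Fin 2 → G) →₀ ℤ) →+ augKer G H :=
  augKer.lift (toCosets H ∘ₗ (Tup G).bd 0).toAddMonoidHom fun c => deg_toCosets_bd H c

lemma val_relAugSum (c : (Fin 2 → G) →₀ ℤ) :
    augKer.val (relAugSum H c) = MonoidAlgebra.ofCoeff (toCosets H ((Tup G).bd 0 c)) := rfl

lemma relAugSum_eq_zero_iff (c : (Fin 2 → G) →₀ ℤ) :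
    relAugSum H c = 0 ↔ toCosets H ((Tup G).bd 0 c) = 0 := by
  rw [← augKer.val_injective.eq_iff, val_relAugSum]
  exact (MonoidAlgebra.coeffLinearEquiv ℤ).symm.map_eq_zero_iff

/-- The augmentation of the relative bar resolution. -/
def relAug : (relPerm H).M 0 →ₗ[GroupRing G] augKer G H :=
  PermQuot.descLin (relAugSum H)
    (fun c hc => (relAugSum_eq_zero_iff H c).2 (toCosets_bd_eq_zero H hc)) fun g c => by
      refine augKer.val_injective (Eq.trans ?_ (augKer.val_smul g _).symm)
      refine congrArg MonoidAlgebra.ofCoeff ?_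
      change toCosets H ((Tup G).bd 0 (Finsupp.mapDomain ((g * ·) ∘ ·) c)) =
        Finsupp.mapDomain (g • ·) (toCosets H ((Tup G).bd 0 c))
      rw [bd_tup_mapDomain, toCosets_apply, toCosets_apply, ← Finsupp.mapDomain_comp,
        ← Finsupp.mapDomain_comp]
      rfl

lemma relPerm_exact_zero (x : (relPerm H).complex.X 0) (hx : relAug H x = 0) :
    ∃ y, (relPerm H).complex.d 1 0 y = x := by
  obtain ⟨c, rfl⟩ := PermQuot.mk_surjective x
  obtain ⟨b, hb⟩ := mem_supported_of_toCosets_bd_eq_zero H ((relAugSum_eq_zero_iff H c).1 hx)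
  refine ⟨(relPerm H).cls 1 b, ((relPerm H).complex_d_mk 0 b).trans ?_⟩
  rw [← sub_eq_zero, ← map_sub]
  exact PermQuot.mk_eq_zero_iff.2 hb

/-- Choosing representatives lifts an element of `K` to a 0-chain of degree zero on `G`, and such a
chain bounds. -/
lemma relAug_surjective : Function.Surjective (relAug H) := by
  intro k
  let c : (Fin 1 → G) →₀ ℤ := Finsupp.mapDomain (fun x _ => Quotient.out x) (augKer.val k).coeff
  have h1 : toCosets H c = (augKer.val k).coeff := by
    rw [toCosets_apply, ← Finsupp.mapDomain_comp]
    refine Eq.trans ?_ Finsupp.mapDomain_id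
    congr 1
    exact funext fun x => Quotient.out_eq' x
  obtain ⟨b, hb⟩ := (tup_acyclic G).exists_bd_eq_zero c (by
    rw [SemiSimp.deg_mapDomain, ← sumCoeff_ofCoeff]
    exact sumCoeff_val k)
  refine ⟨(relPerm H).cls 0 b, augKer.val_injective ?_⟩
  refine (val_relAugSum H b).trans ?_
  rw [hb, h1]

/-- The relative bar resolution. -/
def relResolution : ProjectiveResolution (augKer G H) :=
  mkResolution (relPerm H).complex (relPerm H).projective (ModuleCat.ofHom (relAug H))
    (by
      refine ModuleCat.hom_ext (PermQuot.linearMap_ext fun c => ?_)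
      refine (congrArg (relAug H) ((relPerm H).complex_d_mk 0 c)).trans ?_
      refine (relAugSum_eq_zero_iff H _).2 ?_
      change toCosets H ((Tup G).bd 0 ((Tup G).bd 1 c)) = 0
      rw [SemiSimp.bd_bd, map_zero])
    (relAug_surjective H) (relPerm_exact_zero H) (relPerm_exact H)

lemma relResolution_π_f_zero : (relResolution H).π.f 0 = ModuleCat.ofHom (relAug H) :=
  mkResolution_π_f_zero ..

/-! ### Coinvariants of the relative bar resolution -/

/-- The coinvariants of the relative bar resolution. -/
abbrev relTensor : ChainComplex (ModuleCat.{u} ℤ) ℕ :=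
  ((tensorZ G).mapHomologicalComplex _).obj (relPerm H).complex

/-- The coinvariants of the relative bar resolution are relative chains of the bar construction. -/
def relCoinv (n : ℕ) :
    TensorZ ((relPerm H).M n) →ₗ[ℤ] (relChains (Nerve.map H.subtype)).X (n + 1) :=
  PermQuot.coinvariantsMap quots (fun g v => quots_mul g v) (relMk (Nerve.map H.subtype) (n + 1))
    (relMk_eq_zero_iff_mem_supported H (n + 1))

lemma relCoinv_tmk (n : ℕ) (c : (Fin (n + 2) → G) →₀ ℤ) :
    relCoinv H n (tmk _ ((relPerm H).cls n c)) =
      relMk (Nerve.map H.subtype) (n + 1) (Finsupp.mapDomain quots c) :=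
  PermQuot.coinvariantsMap_tmk ..

lemma relCoinv_bijective (n : ℕ) : Function.Bijective (relCoinv H n) :=
  PermQuot.coinvariantsMap_bijective _ _ _ _ (fun x => ⟨Fin.partialProd x, quots_partialProd x⟩)
    (fun v w h => (freeAction_tup G).exists_smul (n + 1) v w h) (relMk_surjective _ _)

lemma relCoinv_d (n : ℕ) (x : (relTensor H).X (n + 1)) :
    (relChains (Nerve.map H.subtype)).d (n + 2) (n + 1)
      ((ModuleCat.ofHom (relCoinv H (n + 1))) x) =
      (ModuleCat.ofHom (relCoinv H n)) ((relTensor H).d (n + 1) n x) := by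
  obtain ⟨m, rfl⟩ := tmk_surjective _ x
  obtain ⟨c, rfl⟩ := PermQuot.mk_surjective m
  refine (congrArg ((relChains (Nerve.map H.subtype)).d (n + 2) (n + 1))
    (relCoinv_tmk H (n + 1) c)).trans ?_
  refine (d_relMk _ _).trans ((congrArg (relMk _ (n + 1))
    (SemiSimp.bd_mapDomain (quotsHom G) c)).trans ?_)
  refine (relCoinv_tmk H n ((Tup G).bd (n + 1) c)).symm.trans ?_
  exact congrArg (fun m => relCoinv H n (tmk _ m)) ((relPerm H).complex_d_mk n c).symm

/-- The homology of the coinvariants of the relative bar resolution is the relative homology of the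
bar construction. -/
def relShift (n : ℕ) :
    (relTensor H).homology n ⟶ (relChains (Nerve.map H.subtype)).homology (n + 1) :=
  shiftHomology (fun n => ModuleCat.ofHom (relCoinv H n)) (relCoinv_d H)
    (subsingleton_relChains_nerve_zero H) n

instance (n : ℕ) : IsIso (relShift H n) := isIso_shiftHomology _ _ _ (relCoinv_bijective H) n

/-- The homology of the coinvariants of the relative bar resolution is the relative homology. -/
def relBarIso (n : ℕ) : (relTensor H).homology n ≅ relH G H (n + 1) :=
  have := quasiIso_relNerveToSing H
  asIso (relShift H n) ≪≫ asIso (HomologicalComplex.homologyMap (relNerveToSing H) (n + 1)) ≪≫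
    Cof.relIso (BG.map H.subtype) (bgMap_subtype_injective H) n

/-! ### Naturality of the relative bar resolution -/

variable {H H'} (φ : G →* G') (h : ∀ x ∈ H, φ x ∈ H')

/-- The map of relative bar resolutions induced by a homomorphism. -/
def relPermMap (n : ℕ) : (relPerm H).M n →+ (relPerm H').M n :=
  PermQuot.desc (((relPerm H').cls n).comp (Finsupp.lmapDomain ℤ ℤ (φ ∘ ·)).toAddMonoidHom)
    fun c hc => PermQuot.mk_eq_zero_iff.2 (mapDomain_mem_supported (fun v hv j => by
      change (φ (v 0))⁻¹ * φ (v j) ∈ H'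
      rw [← map_inv, ← map_mul]
      exact h _ (hv j)) hc)

lemma isEquivariant_relPermMap (n : ℕ) : IsEquivariant φ (relPermMap φ h n) := fun g m => by
  obtain ⟨c, rfl⟩ := PermQuot.mk_surjective m
  refine (congrArg (relPermMap φ h n) (PermQuot.smul_mk g c)).trans ?_
  refine Eq.trans ?_ (PermQuot.smul_mk (φ g) (Finsupp.mapDomain (φ ∘ ·) c)).symm
  refine congrArg ((relPerm H').cls n) ?_
  refine Finsupp.mapDomain_comp.symm.trans (Eq.trans ?_ Finsupp.mapDomain_comp)
  congr 1
  funext v j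
  exact map_mul φ g (v j)

lemma relPermMap_d (n : ℕ) (x : (relPerm H).complex.X (n + 1)) :
    relPermMap φ h n ((relPerm H).complex.d (n + 1) n x) =
      (relPerm H').complex.d (n + 1) n (relPermMap φ h (n + 1) x) := by
  obtain ⟨c, rfl⟩ := PermQuot.mk_surjective x
  refine (congrArg (relPermMap φ h n) ((relPerm H).complex_d_mk n c)).trans ?_
  refine Eq.trans ?_ ((relPerm H').complex_d_mk n (Finsupp.mapDomain (φ ∘ ·) c)).symm
  exact congrArg ((relPerm H').cls n) (bd_tup_mapDomain φ c).symm

lemma val_relAug_relPermMap (x : (relPerm H).M 0) :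
    augKer.val (relAug H' (relPermMap φ h 0 x)) =
      MonoidAlgebra.mapDomain (cosetMap φ h) (augKer.val (relAug H x)) := by
  obtain ⟨c, rfl⟩ := PermQuot.mk_surjective x
  refine congrArg MonoidAlgebra.ofCoeff ?_
  change toCosets H' ((Tup G').bd 0 (Finsupp.mapDomain (φ ∘ ·) c)) =
    Finsupp.mapDomain (cosetMap φ h) (toCosets H ((Tup G).bd 0 c))
  rw [bd_tup_mapDomain, toCosets_apply, toCosets_apply, ← Finsupp.mapDomain_comp,
    ← Finsupp.mapDomain_comp]
  rfl

/-- The map of coinvariants of relative bar resolutions induced by a homomorphism. -/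
def relTensorMap : relTensor H ⟶ relTensor H' where
  f n := TensorZ.map φ (relPermMap φ h n) (isEquivariant_relPermMap φ h n)
  comm' := by
    rintro _ n rfl
    refine ModuleCat.hom_ext (LinearMap.ext fun x => ?_)
    obtain ⟨m, rfl⟩ := tmk_surjective _ x
    exact congrArg (tmk _) (relPermMap_d φ h n m).symm

lemma nerveMap_comm : Nerve.map H.subtype ≫ Nerve.map φ =
    Nerve.map (restrictHom φ h) ≫ Nerve.map H'.subtype := rfl

/-- The map of relative chains of bar constructions induced by a homomorphism. -/
abbrev relNerveMap : relChains (Nerve.map H.subtype) ⟶ relChains (Nerve.map H'.subtype) :=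
  relChainsMap _ _ (Nerve.map (restrictHom φ h)) (Nerve.map φ) (nerveMap_comm φ h)

lemma relShift_naturality (n : ℕ) :
    HomologicalComplex.homologyMap (relTensorMap φ h) n ≫ relShift H' n =
      relShift H n ≫ HomologicalComplex.homologyMap (relNerveMap φ h) (n + 1) := by
  refine shiftHomology_naturality _ _ _ _ _ _ _ _ (fun n x => ?_) n
  obtain ⟨m, rfl⟩ := tmk_surjective _ x
  obtain ⟨c, rfl⟩ := PermQuot.mk_surjective m
  refine (relCoinv_tmk H' n (Finsupp.mapDomain (φ ∘ ·) c)).trans ?_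
  refine Eq.trans ?_ (congrArg ((relNerveMap φ h).f (n + 1)) (relCoinv_tmk H n c)).symm
  refine Eq.trans ?_ (relChainsMap_relMk _ _ _ _ (nerveMap_comm φ h) _).symm
  refine congrArg (relMk _ (n + 1)) ?_
  rw [← Finsupp.mapDomain_comp, ← Finsupp.mapDomain_comp]
  congr 1
  exact funext fun v => quots_comp φ v

lemma bgMap_comm : (BG.map φ).comp (BG.map H.subtype) =
    (BG.map H'.subtype).comp (BG.map (restrictHom φ h)) := by
  rw [BG.map_comp, BG.map_comp]
  rfl

lemma relNerveToSing_naturality :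
    relNerveMap φ h ≫ relNerveToSing H' = relNerveToSing H ≫
      relSingMap (TopCat.ofHom (BG.map H.subtype)) (TopCat.ofHom (BG.map H'.subtype))
        (TopCat.ofHom (BG.map (restrictHom φ h))) (TopCat.ofHom (BG.map φ))
        (Cof.ofHom_comm _ _ (bgMap_comm φ h)) := by
  rw [relChainsMap_comp (h := nerveMap_comm φ h) (h' := nerveToSing_naturality H'.subtype)]
  rw [relChainsMap_comp (h := nerveToSing_naturality H.subtype)]
  rfl

lemma relBarIso_naturality (n : ℕ) :
    HomologicalComplex.homologyMap (relTensorMap φ h) n ≫ (relBarIso H' n).hom =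
      (relBarIso H n).hom ≫ relHMap φ h (n + 1) := by
  have h1 := relShift_naturality φ h n
  change HomologicalComplex.homologyMap (relTensorMap φ h) n ≫ relShift H' n ≫
      HomologicalComplex.homologyMap (relNerveToSing H') (n + 1) ≫
      (Cof.relIso (BG.map H'.subtype) (bgMap_subtype_injective H') n).hom =
    (relShift H n ≫ HomologicalComplex.homologyMap (relNerveToSing H) (n + 1) ≫
      (Cof.relIso (BG.map H.subtype) (bgMap_subtype_injective H) n).hom) ≫
      reducedHMap (n + 1) (TopCat.ofHom (Cof.map _ _ (bgMap_comm φ h)))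
  rw [reassoc_of% h1, Category.assoc, Category.assoc]
  congr 1
  rw [← Category.assoc, ← HomologicalComplex.homologyMap_comp, relNerveToSing_naturality,
    HomologicalComplex.homologyMap_comp, Category.assoc]
  congr 1
  exact Cof.relIso_naturality _ _ (bgMap_comm φ h) _ _ n

end RelBar

/-! ### The comparison isomorphisms -/

section Comparison

variable {G G' : Type u} [Group G] [Group G'] {H : Subgroup G} {H' : Subgroup G'}

/-- The comparison of a free resolution with the relative bar resolution. -/
def toRelResolution (F : FreeResolution (augKer G H)) : F.complex ⟶ (relPerm H).complex :=
  ProjectiveResolution.lift (𝟙 (augKer G H)) F.toProjectiveResolution (relResolution H)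

lemma relAug_toRelResolution (F : FreeResolution (augKer G H)) (x : F.complex.X 0) :
    relAug H ((toRelResolution F).f 0 x) = F.π.f 0 x := by
  have h := HomologicalComplex.congr_hom
    (ProjectiveResolution.lift_commutes (𝟙 (augKer G H)) F.toProjectiveResolution
      (relResolution H)) 0
  refine (ConcreteCategory.congr_hom (relResolution_π_f_zero H) _).symm.trans
    ((ConcreteCategory.congr_hom h x).trans ?_)
  rw [CategoryTheory.Functor.map_id, Category.comp_id]

/-- The map on coinvariants induced by the comparison with the relative bar resolution. -/
abbrev tensorToRel (F : FreeResolution (augKer G H)) : F.tensorComplex ⟶ relTensor H :=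
  ((tensorZ G).mapHomologicalComplex _).map (toRelResolution F)

/-- The derived functors computed by the relative bar resolution. -/
def torIsoRel (G : Type u) [Group G] (H : Subgroup G) (n : ℕ) :
    (TorZ G n).obj (augKer G H) ≅ relH G H (n + 1) :=
  (relResolution H).isoLeftDerivedObj (tensorZ G) n ≪≫ relBarIso H n

/-- The homology of the coinvariants of a free resolution is the relative homology. -/
def tensorIsoRel (F : FreeResolution (augKer G H)) (n : ℕ) :
    F.tensorComplex.homology n ≅ relH G H (n + 1) :=
  (F.isoLeftDerivedObj (tensorZ G) n).symm ≪≫ torIsoRel G H n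

/-- The isomorphism is defined through `Tor`, which makes its independence of the resolution
immediate. Written through the comparison with the relative bar resolution, it can be compared along
a change of groups. -/
lemma tensorIsoRel_hom (F : FreeResolution (augKer G H)) (n : ℕ) :
    (tensorIsoRel F n).hom =
      HomologicalComplex.homologyMap (tensorToRel F) n ≫ (relBarIso H n).hom := by
  have h := ProjectiveResolution.isoLeftDerivedObj_hom_naturality (𝟙 (augKer G H))
    F.toProjectiveResolution (relResolution H) (toRelResolution F) (by
      refine Eq.trans ?_ (Category.comp_id _).symm
      refine ModuleCat.hom_ext (LinearMap.ext fun x => ?_)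
      exact (ConcreteCategory.congr_hom (relResolution_π_f_zero H) _).trans
        (relAug_toRelResolution F x)) (tensorZ G) n
  rw [CategoryTheory.Functor.map_id, Category.id_comp, ← Iso.inv_comp_eq] at h
  refine (Category.assoc _ _ _).symm.trans ?_
  exact congrArg (· ≫ (relBarIso H n).hom) h

/-- Both composites come from `φ`-equivariant chain maps into the relative bar resolution of `(G',
H')` over the same map `K → K'`. The source is projective and the target exact, so they agree on the
homology of the coinvariants. -/
lemma homologyMap_tensorMap_comp (φ : G →* G') (h : ∀ x ∈ H, φ x ∈ H')
    (F : FreeResolution (augKer G H)) (F' : FreeResolution (augKer G' H'))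
    (α : ResolutionMap φ h F F') (n : ℕ) :
    HomologicalComplex.homologyMap α.tensorMap n ≫
        HomologicalComplex.homologyMap (tensorToRel F') n =
      HomologicalComplex.homologyMap (tensorToRel F) n ≫
        HomologicalComplex.homologyMap (relTensorMap φ h) n := by
  rw [← HomologicalComplex.homologyMap_comp, ← HomologicalComplex.homologyMap_comp]
  have hP (n : ℕ) : Module.Projective (GroupRing G) (F.complex.X n) :=
    have := F.free n
    inferInstance
  refine homologyMap_eq_of_equivariant φ hP (relPerm_exact H')
    (fun n => ((toRelResolution F').f n).hom.toAddMonoidHom.comp (α.toFun n))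
    (fun n => (relPermMap φ h n).comp ((toRelResolution F).f n).hom.toAddMonoidHom)
    (fun n g m => ?_) (fun n g m => ?_) (fun n x => ?_) (fun n x => ?_) (fun x => ?_) _ _
    (fun n x => rfl) (fun n x => rfl) n
  · exact (congrArg ((toRelResolution F').f n) (α.equivariant n g m)).trans
      (((toRelResolution F').f n).hom.map_smul _ _)
  · exact (congrArg (relPermMap φ h n) (((toRelResolution F).f n).hom.map_smul _ m)).trans
      (isEquivariant_relPermMap φ h n g _)
  · exact (congrArg ((toRelResolution F').f n) (α.comm_d (n + 1) n x)).trans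
      (f_d (toRelResolution F') _)
  · exact (congrArg (relPermMap φ h n) (f_d (toRelResolution F) x)).trans
      (relPermMap_d φ h n _)
  · refine relPerm_exact_zero H' _ ?_
    refine (map_sub (relAug H') _ _).trans (sub_eq_zero.2 (augKer.val_injective ?_))
    refine (congrArg augKer.val (relAug_toRelResolution F' (α.toFun 0 x))).trans ?_
    refine (α.comm_aug x).trans ?_
    refine Eq.trans ?_ (val_relAug_relPermMap φ h ((toRelResolution F).f 0 x)).symm
    exact congrArg (fun y => MonoidAlgebra.mapDomain (cosetMap φ h) (augKer.val y))
      (relAug_toRelResolution F x).symm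

lemma tensorIsoRel_naturality (φ : G →* G') (h : ∀ x ∈ H, φ x ∈ H')
    (F : FreeResolution (augKer G H)) (F' : FreeResolution (augKer G' H'))
    (α : ResolutionMap φ h F F') (n : ℕ) :
    HomologicalComplex.homologyMap α.tensorMap n ≫ (tensorIsoRel F' n).hom =
      (tensorIsoRel F n).hom ≫ relHMap φ h (n + 1) := by
  have h1 := homologyMap_tensorMap_comp φ h F F' α n
  rw [tensorIsoRel_hom, tensorIsoRel_hom, reassoc_of% h1, Category.assoc, relBarIso_naturality]

/-- The cone is path connected because `BG` is and `BH` is nonempty. -/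
lemma isZero_relH_zero (G : Type u) [Group G] (H : Subgroup G) : Limits.IsZero (relH G H 0) := by
  have : PathConnectedSpace (TopCat.of (Cof (BG.map H.subtype))) :=
    inferInstanceAs (PathConnectedSpace (Cof (BG.map H.subtype)))
  exact isZero_reducedH_zero _

end Comparison

end RelHom

end

theorem mainTheorem10 :
    (∀ (G : Type u) [Group G] (H : Subgroup G), Limits.IsZero (RelHom.relH G H 0)) ∧
    ∃ Φ : ∀ (G : Type u) [Group G] (H : Subgroup G) (F : RelHom.FreeResolution (RelHom.augKer G H))
        (n : ℕ), F.tensorComplex.homology n ≅ RelHom.relH G H (n + 1),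
      (∀ (G G' : Type u) [Group G] [Group G'] (H : Subgroup G) (H' : Subgroup G')
        (φ : G →* G') (h : ∀ x ∈ H, φ x ∈ H')
        (F : RelHom.FreeResolution (RelHom.augKer G H))
        (F' : RelHom.FreeResolution (RelHom.augKer G' H'))
        (α : RelHom.ResolutionMap φ h F F') (n : ℕ),
        HomologicalComplex.homologyMap α.tensorMap n ≫ (Φ G' H' F' n).hom =
          (Φ G H F n).hom ≫ RelHom.relHMap φ h (n + 1)) ∧
      ∀ (G : Type u) [Group G] (H : Subgroup G) (n : ℕ),
        ∃ Ψ : (RelHom.TorZ G n).obj (RelHom.augKer G H) ≅ RelHom.relH G H (n + 1),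
          ∀ F : RelHom.FreeResolution (RelHom.augKer G H),
            Ψ = F.isoLeftDerivedObj (RelHom.tensorZ G) n ≪≫ Φ G H F n :=
  ⟨fun G _ H => RelHom.isZero_relH_zero G H, fun _ _ _ F n => RelHom.tensorIsoRel F n,
    fun _ _ _ _ _ _ φ h F F' α n => RelHom.tensorIsoRel_naturality φ h F F' α n,
    -- The isomorphism from `Tor` is built from the relative bar resolution and does not involve
    -- `F`. `Φ` is the inverse of the isomorphism from `Tor` given by `F`, followed by it, so the
    -- composite cancels.
    fun G _ H n => ⟨RelHom.torIsoRel G H n, fun F =>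
      (Iso.self_symm_id_assoc (F.isoLeftDerivedObj (RelHom.tensorZ G) n)
        (RelHom.torIsoRel G H n)).symm⟩⟩
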